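/- **Setting.** Let $h\in C^1([0,1];(0,\infty))$ and $f\in C^1([0,\infty);[0,\infty))$, and let $t_0\ge 0$ be such that $f>0$ on $[t_0,\infty)$ and $f\in C^2([t_0,\infty))$; put $g=\log f$ on $[t_0,\infty)$. Let $q\in[1,2)$ and assume (H1) $g'>0$ and $g''>0$ on $[t_0,\infty)$; $\lim_{t\to\infty}\frac{g'(t)^2}{g(t)g''(t)}=q$; and $\lim_{t\to\infty}\frac{t g'(t)}{g(t)}$ exists in $(0,\infty]$ and is finite if $q>1$. If $q=1$, moreover $t g'(t)/g(t)$ is nondecreasing on $[t_0,\infty)$, and there are an integer $j\ge1$ and $\hat g\in C^2([t_0,\infty))$ such that on $[t_0,\infty)$ the function $f$ is the $j$-fold iterated exponential of $\hat g$, and $\hat g'/\hat g$ is nonincreasing. Let $(\lambda_n,\mu_n,u_n)\in(0,\infty)\times(0,\infty)\times C^2([0,1])$, $n\in\mathbb N$, satisfy $$-u_n''-\tfrac1r u_n'=\lambda_n h(r) f(u_n),\quad u_n>0\ \text{ in }(0,1),\qquad u_n(0)=\mu_n,\quad u_n'(0)=0=u_n(1),$$ with $\mu_n\to\infty$. Define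 $(a_k)_{k\ge1}\subset(0,2]$ and $(\delta_k)_{k\ge 1},(\eta_k)_{k\ge1}\subset(0,1]$ by $a_1=2$, $\delta_1=\eta_1=1$ and the following recurrences. If $q>1$, put $p=q/(q-1)$; let $x_k\in(0,1)$ be the unique solution in $(0,1)$ of $\frac{2p}{2+a_k}(1-x)-1+x^p=0$, and put $\delta_{k+1}=x_k\delta_k$, $a_{k+1}=2-x_k^{p-1}(2+a_k)$, $\eta_k=\delta_k^p$. If $q=1$, let $x_k\in(0,1)$ be the unique solution in $(0,1)$ of $\frac{2}{2+a_k}\log\frac1x-1+x=0$, and put $\eta_{k+1}=x_k\eta_k$, $a_{k+1}=2-x_k(2+a_k)$, $\delta_k=1$. For $k\ge1$, a sequence $(r_{k,n})_n\subset(0,1)$ is called a sequence of *$k$-th centers* of a (sub)sequence of $(\lambda_n,\mu_n,u_n)$ if, along it, $$\frac{u_n(r_{k,n})}{\mu_n}\to\delta_k,\qquad \lambda_n r_{k,n}^2h(r_{k,n})f'(u_n(r_{k,n}))\to\frac{a_k^2}{2},$$ and, if $q=1$, also $(\mu_n-u_n(r_{k,n}))\,\frac{g'(\mu_n)}{g(\mu_n)}\to\log\frac1{\eta_k}$.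 **Theorem.** (1) For every sequence $(r_n)\subset(0,1)$ such that $u_n(r_n)/\mu_n\to0$ if $q>1$, respectively $(\mu_n-u_n(r_n))\,g'(\mu_n)/g(\mu_n)\to\infty$ if $q=1$, we have $$\lim_{n\to\infty}\int_0^{r_n}\lambda_n h f'(u_n)\,r\,dr=\infty.$$ (2) $g'(\mu_n)u_n(r)\to\infty$ for every $r\in[0,1)$. (3) There is a subsequence along which sequences of $k$-th centers exist for all $k\ge1$ simultaneously. (4) If $q=1$, assume in addition (H2): $\inf_{t>0}f(t)/t>0$. Then $$\lim_{n\to\infty}\frac{\log(1/\lambda_n)}{g(\mu_n)}=0,$$ and for every $k\ge1$, every subsequence, and every sequence $(r_{k,n})$ of $k$-th centers of that subsequence, $$\lim_{n\to\infty}\frac{\log(1/r_{k,n})}{g(\mu_n)}=\frac{\eta_k}{2}$$ along that subsequence. -/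

import Mathlib

open Set Filter Topology

noncomputable section

namespace DiscBlowup

/-! ### The nonlinearity -/

/-- `g = log f`. -/
def g (f : ℝ → ℝ) (t : ℝ) : ℝ := Real.log (f t)

/-- `g'` on `[t₀, ∞)` (one-sided at `t₀`). -/
def g' (f : ℝ → ℝ) (t₀ : ℝ) (t : ℝ) : ℝ := derivWithin (g f) (Ici t₀) t

/-- `g''` on `[t₀, ∞)` (one-sided at `t₀`). -/
def g'' (f : ℝ → ℝ) (t₀ : ℝ) (t : ℝ) : ℝ := derivWithin (g' f t₀) (Ici t₀) t

/-- `f'` on `[0, ∞)` (one-sided at `0`). -/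
def f' (f : ℝ → ℝ) (t : ℝ) : ℝ := derivWithin f (Ici 0) t

/-- The basic condition on the weight `h : [0,1] → (0,∞)` and on `f : [0,∞) → [0,∞)`.
Values of `h` outside `[0,1]` and of `f` outside `[0,∞)` play no role. -/
structure H0 (h f : ℝ → ℝ) (t₀ : ℝ) : Prop where
  h_contDiff : ContDiffOn ℝ 1 h (Icc 0 1)
  h_pos : ∀ r ∈ Icc (0 : ℝ) 1, 0 < h r
  f_contDiff : ContDiffOn ℝ 1 f (Ici 0)
  f_nonneg : ∀ t ≥ 0, 0 ≤ f t
  t₀_nonneg : 0 ≤ t₀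
  f_pos : ∀ t ≥ t₀, 0 < f t
  f_contDiff_two : ContDiffOn ℝ 2 f (Ici t₀)

/-- The generalized exponential growth condition with exponent `q`. The limit `p` of
`t g'(t) / g(t)` lies in `(0, ∞]`, and in `(0, ∞)` if `q > 1`. In the condition for `q = 1`,
`Real.exp^[k]` is the `k`-fold exponential. -/
structure H1 (f : ℝ → ℝ) (t₀ q : ℝ) : Prop where
  g'_pos : ∀ t ≥ t₀, 0 < g' f t₀ t
  g''_pos : ∀ t ≥ t₀, 0 < g'' f t₀ t
  one_le_q : 1 ≤ q
  lim_q : Tendsto (fun t => g' f t₀ t ^ 2 / (g f t * g'' f t₀ t)) atTop (𝓝 q)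
  lim_p : ∃ p : EReal, 0 < p ∧ (1 < q → p < ⊤) ∧
    Tendsto (fun t => ((t * g' f t₀ t / g f t : ℝ) : EReal)) atTop (𝓝 p)
  monotone_of_q_eq_one : q = 1 → MonotoneOn (fun t => t * g' f t₀ t / g f t) (Ici t₀)
  exp_form_of_q_eq_one : q = 1 → ∃ k : ℕ, 1 ≤ k ∧ ∃ G : ℝ → ℝ,
    ContDiffOn ℝ 2 G (Ici t₀) ∧ (∀ t ≥ t₀, f t = Real.exp^[k] (G t)) ∧
    AntitoneOn (fun t => derivWithin G (Ici t₀) t / G t) (Ici t₀)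

/-- `inf_{t > 0} f(t) / t > 0`. -/
def H2 (f : ℝ → ℝ) : Prop := ∃ c > 0, ∀ t > 0, c ≤ f t / t

/-! ### The boundary value problem -/

/-- `(l, m, u) ∈ (0,∞) × (0,∞) × C²([0,1])` solves `-u'' - u'/r = l h f(u)`, `u > 0` in `(0,1)`,
`u(0) = m`, `u'(0) = 0 = u(1)`. -/
structure IsSolution (h f : ℝ → ℝ) (l m : ℝ) (u : ℝ → ℝ) : Prop where
  l_pos : 0 < l
  m_pos : 0 < m
  contDiff : ContDiffOn ℝ 2 u (Icc 0 1)
  equation : ∀ r ∈ Ioo (0 : ℝ) 1,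
    -derivWithin (derivWithin u (Icc 0 1)) (Icc 0 1) r - 1 / r * derivWithin u (Icc 0 1) r
      = l * h r * f (u r)
  pos : ∀ r ∈ Ioo (0 : ℝ) 1, 0 < u r
  at_zero : u 0 = m
  deriv_zero : derivWithin u (Icc 0 1) 0 = 0
  at_one : u 1 = 0

/-! ### The energy recurrence

`p = q / (q - 1)` is the conjugate exponent of `q` (finite for `q > 1`). All sequences are indexed
from `0`: the value at `k` is the one with index `k + 1` in the usual counting from `1`. -/

/-- The equation for the ratio `x` of two successive terms of `δ` (if `q > 1`) or of `η`
(if `q = 1`). -/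
def ratioEq (q a x : ℝ) : ℝ :=
  if q = 1 then 2 / (2 + a) * Real.log (1 / x) - 1 + x
  else 2 * q.conjExponent / (2 + a) * (1 - x) - 1 + x ^ q.conjExponent

/-- The zero of `ratioEq q a` in `(0, 1)`; it exists and is unique for `q ∈ [1,2)` and
`a ∈ (0,2]`, see `existsUnique_ratio`. -/
def ratio (q a : ℝ) : ℝ := Classical.epsilon fun x => x ∈ Ioo (0 : ℝ) 1 ∧ ratioEq q a x = 0

/-- The energies: `a₁ = 2` and `a_{k+1} = 2 - x ^ (p - 1) * (2 + a_k)` if `q > 1`,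
`a_{k+1} = 2 - x * (2 + a_k)` if `q = 1`, where `x` is the ratio belonging to `a_k`. -/
def a (q : ℝ) : ℕ → ℝ
  | 0 => 2
  | k + 1 => 2 - (if q = 1 then ratio q (a q k) else ratio q (a q k) ^ (q.conjExponent - 1))
      * (2 + a q k)

/-- `δ₁ = 1` and `δ_{k+1} = x δ_k` if `q > 1`; `δ_k = 1` for all `k` if `q = 1`. -/
def δ (q : ℝ) : ℕ → ℝ
  | 0 => 1
  | k + 1 => if q = 1 then 1 else ratio q (a q k) * δ q k

/-- `η_k = δ_k ^ p` if `q > 1`; `η₁ = 1` and `η_{k+1} = x η_k` if `q = 1`. -/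
def η (q : ℝ) : ℕ → ℝ
  | 0 => 1
  | k + 1 => if q = 1 then ratio q (a q k) * η q k else δ q (k + 1) ^ q.conjExponent

lemma conj_gt_two {q : ℝ} (h1 : 1 < q) (h2 : q < 2) : 2 < q.conjExponent := by
  unfold Real.conjExponent
  rw [lt_div_iff₀ (by linarith)]; linarith

lemma ratioEq_one (q a : ℝ) : ratioEq q a 1 = 0 := by
  unfold ratioEq; split_ifs <;> simp

lemma strictConvexOn_ratioEq {q a : ℝ} (hq : q ∈ Ico (1 : ℝ) 2) (ha : a ∈ Ioc (0 : ℝ) 2) :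
    StrictConvexOn ℝ (Ioi 0) (ratioEq q a) := by
  have hc : 0 < 2 / (2 + a) := by have := ha.1; positivity
  by_cases h : q = 1
  · refine ⟨convex_Ioi 0, fun x hx y hy hxy s t hs ht hst => ?_⟩
    have := strictConcaveOn_log_Ioi.2 hx hy hxy hs ht hst
    simp only [ratioEq, if_pos h, one_div, Real.log_inv, smul_eq_mul] at *
    have h3 := mul_lt_mul_of_pos_left this hc
    obtain rfl : t = 1 - s := by linarith
    nlinarith
  · have hp := conj_gt_two (lt_of_le_of_ne hq.1 (Ne.symm h)) hq.2
    refine ⟨convex_Ioi 0, fun x hx y hy hxy s t hs ht hst => ?_⟩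
    have := (strictConvexOn_rpow (p := q.conjExponent) (by linarith)).2
      (mem_Ici.2 (le_of_lt hx)) (mem_Ici.2 (le_of_lt hy)) hxy hs ht hst
    simp only [ratioEq, if_neg h, smul_eq_mul] at *
    obtain rfl : t = 1 - s := by linarith
    nlinarith

lemma hasDerivAt_ratioEq {q a x : ℝ} (hx : 0 < x) :
    HasDerivAt (ratioEq q a) (if q = 1 then -(2 / (2 + a)) / x + 1 else
      -(2 * q.conjExponent / (2 + a)) + q.conjExponent * x ^ (q.conjExponent - 1)) x := by
  by_cases h : q = 1
  · have : ratioEq q a = fun x => 2 / (2 + a) * (-Real.log x) - 1 + x := by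
      funext y; simp [ratioEq, h]
    rw [this, if_pos h]
    have h1 := ((((Real.hasDerivAt_log hx.ne').neg).const_mul (2 / (2 + a))).sub_const 1).add
      (hasDerivAt_id x)
    refine h1.congr_deriv ?_
    ring
  · have : ratioEq q a = fun x => 2 * q.conjExponent / (2 + a) * (1 - x) - 1
        + x ^ q.conjExponent := by
      funext y; simp [ratioEq, h]
    rw [this, if_neg h]
    have h1 := ((((hasDerivAt_id x).const_sub 1).const_mul
      (2 * q.conjExponent / (2 + a))).sub_const 1).add
      (Real.hasDerivAt_rpow_const (p := q.conjExponent) (Or.inl hx.ne'))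
    refine h1.congr_deriv ?_
    ring

/-- The ratio is well defined. -/
theorem existsUnique_ratio {q a : ℝ} (hq : q ∈ Ico (1 : ℝ) 2) (ha : a ∈ Ioc (0 : ℝ) 2) :
    ∃! x, x ∈ Ioo (0 : ℝ) 1 ∧ ratioEq q a x = 0 := by
  have ha0 := ha.1
  have hconv := strictConvexOn_ratioEq hq ha
  -- positive near the left end
  obtain ⟨y, hy, hypos⟩ : ∃ y ∈ Ioo (0 : ℝ) 1, 0 < ratioEq q a y := by
    by_cases h : q = 1
    · refine ⟨Real.exp (-2), ⟨by positivity, by simp⟩, ?_⟩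
      simp only [ratioEq, if_pos h, one_div, Real.log_inv, Real.log_exp, neg_neg]
      have : 1 ≤ 2 / (2 + a) * 2 := by
        rw [div_mul_eq_mul_div, le_div_iff₀ (by linarith)]; linarith [ha.2]
      linarith [Real.exp_pos (-2)]
    · have hp := conj_gt_two (lt_of_le_of_ne hq.1 (Ne.symm h)) hq.2
      set p := q.conjExponent
      have hlt : 1 < 2 * p / (2 + a) := by
        rw [lt_div_iff₀ (by linarith)]; linarith [ha.2]
      set c := 2 * p / (2 + a) with hcdef
      refine ⟨(c - 1) / (2 * c), ⟨by apply div_pos <;> linarith, ?_⟩, ?_⟩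
      · rw [div_lt_one (by linarith)]; linarith
      · simp only [ratioEq, if_neg h]
        have h0 : 0 < (c - 1) / (2 * c) := by apply div_pos <;> linarith
        have h2 := Real.rpow_pos_of_pos h0 p
        have h3 : c * (1 - (c - 1) / (2 * c)) = c - (c - 1) / 2 := by
          field_simp
        change 0 < c * (1 - (c - 1) / (2 * c)) - 1 + ((c - 1) / (2 * c)) ^ p
        rw [h3]; linarith
  -- negative near the right end
  have hd := hasDerivAt_ratioEq (q := q) (a := a) one_pos
  have hdpos : 0 < (if q = 1 then -(2 / (2 + a)) / 1 + 1 else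
      -(2 * q.conjExponent / (2 + a)) + q.conjExponent * (1 : ℝ) ^ (q.conjExponent - 1)) := by
    have hc : 2 / (2 + a) < 1 := by rw [div_lt_one (by linarith)]; linarith
    split_ifs with h
    · linarith
    · have hp := conj_gt_two (lt_of_le_of_ne hq.1 (Ne.symm h)) hq.2
      rw [Real.one_rpow, mul_div_right_comm]
      nlinarith
  obtain ⟨z, hz, hzneg⟩ : ∃ z ∈ Ioo y 1, ratioEq q a z < 0 := by
    have h1 := (hasDerivAt_iff_tendsto_slope.1 hd).eventually (lt_mem_nhds hdpos)
    have h2 : ∀ᶠ x in 𝓝[<] (1 : ℝ), _ :=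
      h1.filter_mono (nhdsWithin_mono 1 (fun x (hx : x < 1) => hx.ne))
    obtain ⟨z, hz1, hz2⟩ := (h2.and (Ioo_mem_nhdsLT hy.2)).exists
    refine ⟨z, hz2, ?_⟩
    rw [slope_def_field, ratioEq_one, sub_zero] at hz1
    by_contra hcon
    push Not at hcon
    have := div_nonpos_of_nonneg_of_nonpos hcon (by linarith [hz2.2] : z - 1 ≤ 0)
    linarith
  have hcont : ContinuousOn (ratioEq q a) (Icc y z) := fun x hx =>
    (hasDerivAt_ratioEq (lt_of_lt_of_le hy.1 hx.1)).continuousAt.continuousWithinAt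
  obtain ⟨x, hx, hx0⟩ := intermediate_value_Icc' hz.1.le hcont ⟨hzneg.le, hypos.le⟩
  have huniq : ∀ x y, x ∈ Ioo (0 : ℝ) 1 → y ∈ Ioo (0 : ℝ) 1 → ratioEq q a x = 0 →
      ratioEq q a y = 0 → ¬ x < y := by
    intro x y hx hy hx0 hy0 hxy
    have hs := hconv.slope_strict_mono_adjacent (mem_Ioi.2 hx.1) (mem_Ioi.2 one_pos) hxy hy.2
    rw [hx0, hy0, ratioEq_one] at hs
    simp at hs
  refine ⟨x, ⟨⟨lt_of_lt_of_le hy.1 hx.1, lt_of_le_of_lt hx.2 hz.2⟩, hx0⟩, ?_⟩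
  rintro x' ⟨hx', hx0'⟩
  have hxm : x ∈ Ioo (0 : ℝ) 1 := ⟨lt_of_lt_of_le hy.1 hx.1, lt_of_le_of_lt hx.2 hz.2⟩
  exact le_antisymm (not_lt.1 (huniq _ _ hxm hx' hx0 hx0')) (not_lt.1 (huniq _ _ hx' hxm hx0' hx0))

lemma ratio_spec {q a : ℝ} (hq : q ∈ Ico (1 : ℝ) 2) (ha : a ∈ Ioc (0 : ℝ) 2) :
    ratio q a ∈ Ioo (0 : ℝ) 1 ∧ ratioEq q a (ratio q a) = 0 :=
  Classical.epsilon_spec (existsUnique_ratio hq ha).exists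

/-- The energies stay in `(0, 2]`, so that every step of the recurrence is well defined. -/
theorem a_mem {q : ℝ} (hq : q ∈ Ico (1 : ℝ) 2) (k : ℕ) : a q k ∈ Ioc (0 : ℝ) 2 := by
  induction k with
  | zero => simp [a]
  | succ k ih =>
    obtain ⟨⟨hx0, hx1⟩, hx⟩ := ratio_spec hq ih
    have ha0 := ih.1
    rw [a]
    generalize ratio q (a q k) = x at *
    generalize a q k = b at *
    by_cases h : q = 1
    · simp only [ratioEq, if_pos h] at *
      refine ⟨?_, by nlinarith⟩
      have hl := Real.log_lt_sub_one_of_pos (x := 1 / x) (by positivity)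
        (by rw [one_div]; exact (one_lt_inv₀ hx0 |>.2 hx1).ne')
      have e : 2 * Real.log (1 / x) = (1 - x) * (2 + b) := by
        field_simp at hx; linarith
      have e2 : x * (1 / x - 1) = 1 - x := by field_simp
      have := mul_lt_mul_of_pos_left hl hx0
      have h3 : 0 < (1 - x) * (2 - x * (2 + b)) := by nlinarith
      exact (pos_iff_pos_of_mul_pos h3).1 (by linarith)
    · have hp := conj_gt_two (lt_of_le_of_ne hq.1 (Ne.symm h)) hq.2
      simp only [ratioEq, if_neg h] at *
      generalize q.conjExponent = p at *
      have hxp := Real.rpow_pos_of_pos hx0 (p - 1)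
      refine ⟨?_, by nlinarith⟩
      have hb := one_add_mul_self_lt_rpow_one_add (s := 1 / x - 1) (p := p)
        (by have : 0 < 1 / x := by positivity
            linarith)
        (by have : 1 < 1 / x := by rw [one_div]; exact one_lt_inv₀ hx0 |>.2 hx1
            linarith) (by linarith)
      have e1 : x ^ p = x ^ (p - 1) * x := by
        rw [Real.rpow_sub_one hx0.ne']; field_simp
      rw [add_sub_cancel, one_div, Real.inv_rpow hx0.le] at hb
      have hpp := Real.rpow_pos_of_pos hx0 p
      have h2 := mul_lt_mul_of_pos_left hb hpp
      rw [mul_inv_cancel₀ hpp.ne', e1] at h2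
      have e3 : x ^ (p - 1) * x * (1 + p * (x⁻¹ - 1))
          = x ^ (p - 1) * x + p * x ^ (p - 1) * (1 - x) := by field_simp
      rw [e3] at h2
      rw [e1] at hx
      have e4 : 2 * p * (1 - x) = (1 - x ^ (p - 1) * x) * (2 + b) := by
        field_simp at hx; linarith
      have h3 : 0 < (p * (1 - x)) * (2 - x ^ (p - 1) * (2 + b)) := by nlinarith
      exact (pos_iff_pos_of_mul_pos h3).1 (by nlinarith)

/-! ### Centers of concentration -/

/-- `r = (r_n) ⊂ (0,1)` is a sequence of centers of the concentration with number `k`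
(counted from `0`) of the solutions `(l_n, m_n, u_n)`: the heights satisfy `u_n(r_n)/m_n → δ_k`,
and more precisely `u_n(r_n) = m_n - (log (1/η_k) + o(1)) g(m_n)/g'(m_n)` if `q = 1`, and
`l_n r_n² h(r_n) f'(u_n(r_n)) → a_k² / 2`. -/
structure IsCenter (h f : ℝ → ℝ) (t₀ q : ℝ) (l m : ℕ → ℝ) (u : ℕ → ℝ → ℝ) (k : ℕ)
    (r : ℕ → ℝ) : Prop where
  mem : ∀ n, r n ∈ Ioo (0 : ℝ) 1
  height : Tendsto (fun n => u n (r n) / m n) atTop (𝓝 (δ q k))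
  height_of_q_eq_one : q = 1 →
    Tendsto (fun n => (m n - u n (r n)) * (g' f t₀ (m n) / g f (m n))) atTop
      (𝓝 (Real.log (1 / η q k)))
  scale : Tendsto (fun n => l n * r n ^ 2 * h (r n) * f' f (u n (r n))) atTop
    (𝓝 (a q k ^ 2 / 2))

end DiscBlowup

end

noncomputable section
namespace DiscBlowup

/-! In the variable t = log r let U(t) = u(r), H(t) = h(r) and y = -U', so that y' = λ r² h f(U) ≥
0. With G = log f and ε = G''(U)/G'(U)², the quantities Z = y G'(U) and B = λ r² h f'(U) satisfy Z'
= B - εZ² and B' = B (2 - Z - εZ + H'/H). At large heights ε is of order 1/G(U), and H'/H is of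
order exp t. Hence, over times that are o(G(μ)), the motion is that of Z' = B, B' = B(2 - Z), which
conserves B + (Z - 2)²/2. The orbit of energy a²/2 takes Z from 2 - a to 2 + a with B → 0 at both
ends. Its summit Z = 2, B = a²/2 is a center of concentration, and the depth (μ - U) G'(μ)/G(μ) does
not change along it (`reach_bubble`).

Between two concentrations B is negligible, so y is constant and the depth grows linearly over a
time of order G(μ). Since G at depth s is asymptotically G(μ) times `profile` s, the quantity log(λ
r² f'(U)) / G(μ) becomes a strictly convex function of the depth. It vanishes at departure, becomes
negative, and vanishes again exactly where B can return to order one (`reach_travel`). The equation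
for this second zero is `ratioEq`, and the slope Z = y G'(U) on arrival is 2 - a_{k+1}
(`chord_depth`, `slope_depth`). Alternating the two motions gives all centers by induction
(`reach_before`, `reach_center`). The set of limit states is closed, so each motion need only be
followed up to interior points.

This describes any fixed number of concentrations, but their number is unbounded and errors could
accumulate. Control down to a fixed height comes from a Lyapunov function. Once the energy is below
the value 2 of the first concentration, the energy corrected by a multiple of log(1/(λ r²
f'(U)))/G(U) stays below 2 (`exists_uniform_bounds`, `dissipation_neg`); here q < 2 is essential.
Hence Z stays between two positive constants until U has a fixed height M. Evaluating at height M
bounds log λ on both sides and keeps u away from zero at every fixed r < 1. The derivative of Z - c₀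
log G'(U) is at most B, so the integral of B diverges when G'(U)/G'(μ) → 0. Finally, solving the
definition of log(λ r² f'(U)) for log r locates the centers (`tendsto_time_div`). -/

/-- Comparison of growth from the comparison of derivatives. -/
lemma tendsto_div_of_deriv_div {φ φ' χ χ' : ℝ → ℝ} {a c : ℝ}
    (hφ : ∀ t > a, HasDerivAt φ (φ' t) t) (hχ : ∀ t > a, HasDerivAt χ (χ' t) t)
    (hpos : ∀ t > a, 0 < χ' t) (hlim : Tendsto (fun t => φ' t / χ' t) atTop (𝓝 c))
    (hinf : Tendsto χ atTop atTop) : Tendsto (fun t => φ t / χ t) atTop (𝓝 c) := by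
  rw [Metric.tendsto_nhds]
  intro ε hε
  have h1 := (Metric.tendsto_nhds.1 hlim (ε / 2) (by positivity)).and (eventually_gt_atTop a)
  obtain ⟨T, hT⟩ := eventually_atTop.1 h1
  have hTa : a < T := (hT T le_rfl).2
  have key : ∀ t ≥ T, |φ' t - c * χ' t| ≤ ε / 2 * χ' t := by
    intro t ht
    have h2 := (hT t ht).1
    have h3 := hpos t (lt_of_lt_of_le hTa ht)
    rw [Real.dist_eq] at h2
    have : φ' t - c * χ' t = (φ' t / χ' t - c) * χ' t := by field_simp
    rw [this, abs_mul, abs_of_pos h3]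
    exact mul_le_mul_of_nonneg_right h2.le h3.le
  -- Together with `hB` this confines φ - cχ to ±(ε/2)χ up to a constant fixed at T. The constant is
  -- absorbed into another (ε/2)χ because χ → ∞.
  have hA : AntitoneOn (fun t => φ t - (c + ε / 2) * χ t) (Ici T) := by
    apply antitoneOn_of_hasDerivWithinAt_nonpos (f' := fun t => φ' t - (c + ε / 2) * χ' t)
      (convex_Ici T)
    · intro t ht
      have ht' : a < t := lt_of_lt_of_le hTa ht
      exact ((hφ t ht').sub ((hχ t ht').const_mul _)).continuousAt.continuousWithinAt
    · intro t ht
      rw [interior_Ici] at ht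
      have ht' : a < t := lt_trans hTa ht
      exact ((hφ t ht').sub ((hχ t ht').const_mul _)).hasDerivWithinAt
    · intro t ht
      rw [interior_Ici] at ht
      have := abs_le.1 (key t (le_of_lt ht))
      linarith [this.2]
  have hB : MonotoneOn (fun t => φ t - (c - ε / 2) * χ t) (Ici T) := by
    apply monotoneOn_of_hasDerivWithinAt_nonneg (f' := fun t => φ' t - (c - ε / 2) * χ' t)
      (convex_Ici T)
    · intro t ht
      have ht' : a < t := lt_of_lt_of_le hTa ht
      exact ((hφ t ht').sub ((hχ t ht').const_mul _)).continuousAt.continuousWithinAt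
    · intro t ht
      rw [interior_Ici] at ht
      have ht' : a < t := lt_trans hTa ht
      exact ((hφ t ht').sub ((hχ t ht').const_mul _)).hasDerivWithinAt
    · intro t ht
      rw [interior_Ici] at ht
      have := abs_le.1 (key t (le_of_lt ht))
      linarith [this.1]
  set C1 := |φ T - (c + ε / 2) * χ T| + |φ T - (c - ε / 2) * χ T| + 1 with hC1
  filter_upwards [hinf.eventually_gt_atTop (2 * C1 / ε), eventually_ge_atTop T] with t ht htT
  have a1 := hA (mem_Ici.2 le_rfl) (mem_Ici.2 htT) htT
  have a2 := hB (mem_Ici.2 le_rfl) (mem_Ici.2 htT) htT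
  simp only at a1 a2
  have hC0 : 0 < C1 := by positivity
  have hχ0 : 0 < χ t := lt_trans (by positivity) ht
  have e1 : C1 < ε / 2 * χ t := by
    rw [div_lt_iff₀ hε] at ht; linarith
  have b1 := le_abs_self (φ T - (c + ε / 2) * χ T)
  have b2 := neg_abs_le (φ T - (c - ε / 2) * χ T)
  have b3 := abs_nonneg (φ T - (c + ε / 2) * χ T)
  have b4 := abs_nonneg (φ T - (c - ε / 2) * χ T)
  rw [Real.dist_eq, show φ t / χ t - c = (φ t - c * χ t) / χ t by field_simp, abs_div,
    abs_of_pos hχ0, div_lt_iff₀ hχ0, abs_lt]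
  constructor <;> nlinarith

/-! ### Generalized exponential growth and its scaling limits -/

/-- A nonlinearity `f = exp ∘ G` on `(t₀, ∞)` with `G' = G1`, `G'' = G2`, of generalized
exponential growth with exponent `q`. -/
structure Nonlin (f G G1 G2 : ℝ → ℝ) (t₀ q : ℝ) : Prop where
  t₀_nonneg : 0 ≤ t₀
  f_nonneg : ∀ t ≥ 0, 0 ≤ f t
  f_cont : ContinuousOn f (Ici 0)
  f_eq : ∀ t > t₀, f t = Real.exp (G t)
  hasDerivAt_G : ∀ t > t₀, HasDerivAt G (G1 t) t
  hasDerivAt_G1 : ∀ t > t₀, HasDerivAt G1 (G2 t) t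
  G1_pos : ∀ t > t₀, 0 < G1 t
  G2_pos : ∀ t > t₀, 0 < G2 t
  q_mem : q ∈ Ico (1 : ℝ) 2
  lim_q : Tendsto (fun t => G1 t ^ 2 / (G t * G2 t)) atTop (𝓝 q)

/-- The limit of `G` in the scaled variable. -/
def profile (κ s : ℝ) : ℝ := if κ = 0 then Real.exp (-s) else (1 - κ * s) ^ (1 / κ)

/-- The limit of `G'` in the scaled variable. -/
def slope' (κ s : ℝ) : ℝ := profile κ s / (1 - κ * s)

lemma profile_zero (κ : ℝ) : profile κ 0 = 1 := by
  unfold profile; split_ifs <;> simp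

lemma profile_pos {κ s : ℝ} (h : κ * s < 1) : 0 < profile κ s := by
  unfold profile; split_ifs
  · positivity
  · exact Real.rpow_pos_of_pos (by linarith) _

lemma slope'_pos {κ s : ℝ} (h : κ * s < 1) : 0 < slope' κ s :=
  div_pos (profile_pos h) (by linarith)

lemma hasDerivAt_log_profile {κ s : ℝ} (h : κ * s < 1) :
    HasDerivAt (fun x => Real.log (profile κ x)) (-(1 / (1 - κ * s))) s := by
  by_cases hk : κ = 0
  · subst hk
    simp only [profile, if_true, Real.log_exp, zero_mul, sub_zero, div_one]
    exact (hasDerivAt_id s).neg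
  · have h1 : HasDerivAt (fun x => 1 / κ * Real.log (1 - κ * x)) (-(1 / (1 - κ * s))) s := by
      have h2 := ((((hasDerivAt_id s).const_mul κ).const_sub 1).log
        (by simp; linarith)).const_mul (1 / κ)
      refine h2.congr_deriv ?_
      simp only [id]
      field_simp
    refine h1.congr_of_eventuallyEq ?_
    have : ∀ᶠ x in 𝓝 s, κ * x < 1 :=
      (continuous_const.mul continuous_id).continuousAt.eventually_lt continuousAt_const h
    filter_upwards [this] with x hx
    simp only [profile, if_neg hk]
    rw [Real.log_rpow (by linarith)]

lemma hasDerivAt_profile {κ s : ℝ} (h : κ * s < 1) :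
    HasDerivAt (profile κ) (-slope' κ s) s := by
  have h1 := (hasDerivAt_log_profile h).exp
  rw [Real.exp_log (profile_pos h)] at h1
  have h2 : HasDerivAt (profile κ) (profile κ s * -(1 / (1 - κ * s))) s := by
    refine h1.congr_of_eventuallyEq ?_
    have : ∀ᶠ x in 𝓝 s, κ * x < 1 :=
      (continuous_const.mul continuous_id).continuousAt.eventually_lt continuousAt_const h
    filter_upwards [this] with x hx
    rw [Real.exp_log (profile_pos hx)]
  refine h2.congr_deriv ?_
  unfold slope'; ring

lemma continuousAt_slope' {κ s : ℝ} (h : κ * s < 1) : ContinuousAt (slope' κ) s := by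
  unfold slope'
  exact (hasDerivAt_profile h).continuousAt.div (by fun_prop) (by linarith)

/-- The derivative of `slope' κ` is -(1 - κ) `profile` / (1 - κy)². As `slope'` is minus the
derivative of `profile`, this is the strict convexity of the profile. -/
lemma slope'_strictAnti {κ s x : ℝ} (hκ : κ < 1) (hx : κ * x < 1) (hs : κ * s < 1) (h : s < x) :
    slope' κ x < slope' κ s := by
  have hd : ∀ y ∈ Icc s x, κ * y < 1 := by
    intro y hy
    rcases le_or_gt 0 κ with h0 | h0
    · nlinarith [hy.2]
    · nlinarith [hy.1]
  have hderiv : ∀ y ∈ Icc s x, HasDerivAt (slope' κ)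
      (-((1 - κ) * profile κ y / (1 - κ * y) ^ 2)) y := by
    intro y hy
    have h1 := (hasDerivAt_profile (hd y hy)).div
      (((hasDerivAt_id y).const_mul κ).const_sub 1) (by simp; linarith [hd y hy])
    refine h1.congr_deriv ?_
    have : 1 - κ * y ≠ 0 := by linarith [hd y hy]
    simp only [id, slope']
    field_simp
    ring
  have := strictAntiOn_of_deriv_neg (convex_Icc s x)
    (fun y hy => (hderiv y hy).continuousAt.continuousWithinAt) (fun y hy => by
      rw [interior_Icc] at hy
      rw [(hderiv y (Ioo_subset_Icc_self hy)).deriv]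
      have h1 := profile_pos (hd y (Ioo_subset_Icc_self hy))
      have h2 : 0 < 1 - κ * y := by linarith [hd y (Ioo_subset_Icc_self hy)]
      have : 0 < 1 - κ := by linarith
      have : 0 < (1 - κ) * profile κ y / (1 - κ * y) ^ 2 := by positivity
      linarith)
  exact this (left_mem_Icc.2 h.le) (right_mem_Icc.2 h.le) h

/-- A strictly convex function with two zeros is negative in between. -/
lemma profile_chord_neg {κ s s' x c : ℝ} (hκ : κ < 1) (hκ0 : 0 ≤ κ) (hs' : κ * s' < 1)
    (h : c * (s' - s) + profile κ s' - profile κ s = 0) (hx : x ∈ Ioo s s') :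
    c * (x - s) + profile κ x - profile κ s < 0 := by
  have hd : ∀ y ∈ Icc s s', κ * y < 1 := fun y hy => by nlinarith [hy.2]
  have hconv : StrictConvexOn ℝ (Icc s s') (profile κ) := by
    apply StrictMonoOn.strictConvexOn_of_deriv (convex_Icc s s')
    · exact fun y hy => (hasDerivAt_profile (hd y hy)).continuousAt.continuousWithinAt
    · intro y hy z hz hyz
      rw [interior_Icc] at hy hz
      have hy' := hd y (Ioo_subset_Icc_self hy)
      have hz' := hd z (Ioo_subset_Icc_self hz)
      rw [(hasDerivAt_profile hy').deriv, (hasDerivAt_profile hz').deriv]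
      linarith [slope'_strictAnti hκ hz' hy' hyz]
  have hss : s < s' := hx.1.trans hx.2
  have ha : 0 < (s' - x) / (s' - s) := div_pos (by linarith [hx.2]) (by linarith)
  have hb : 0 < (x - s) / (s' - s) := div_pos (by linarith [hx.1]) (by linarith)
  have := hconv.2 (left_mem_Icc.2 hss.le) (right_mem_Icc.2 hss.le) hss.ne ha hb
    (by rw [← add_div]; rw [div_eq_one_iff_eq (by linarith)]; ring)
  simp only [smul_eq_mul] at this
  have hne : s' - s ≠ 0 := by linarith
  have e : (s' - x) / (s' - s) * s + (x - s) / (s' - s) * s' = x := by field_simp; ring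
  rw [e] at this
  have e2 : (s' - x) / (s' - s) * profile κ s + (x - s) / (s' - s) * profile κ s'
      = profile κ s - c * (x - s) := by
    have : profile κ s' = profile κ s - c * (s' - s) := by linarith
    rw [this]; field_simp; ring
  linarith

namespace Nonlin

variable {f G G1 G2 : ℝ → ℝ} {t₀ q : ℝ}

lemma strictMonoOn_G1 (h : Nonlin f G G1 G2 t₀ q) : StrictMonoOn G1 (Ioi t₀) := by
  apply strictMonoOn_of_deriv_pos (convex_Ioi t₀)
  · exact fun t ht => (h.hasDerivAt_G1 t ht).continuousAt.continuousWithinAt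
  · intro t ht
    rw [interior_Ioi] at ht
    rw [(h.hasDerivAt_G1 t ht).deriv]; exact h.G2_pos t ht

lemma strictMonoOn_G (h : Nonlin f G G1 G2 t₀ q) : StrictMonoOn G (Ioi t₀) := by
  apply strictMonoOn_of_deriv_pos (convex_Ioi t₀)
  · exact fun t ht => (h.hasDerivAt_G t ht).continuousAt.continuousWithinAt
  · intro t ht
    rw [interior_Ioi] at ht
    rw [(h.hasDerivAt_G t ht).deriv]; exact h.G1_pos t ht

lemma convexOn_G (h : Nonlin f G G1 G2 t₀ q) : ConvexOn ℝ (Ioi t₀) G := by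
  apply MonotoneOn.convexOn_of_deriv (convex_Ioi t₀)
  · exact fun t ht => (h.hasDerivAt_G t ht).continuousAt.continuousWithinAt
  · intro t ht
    rw [interior_Ioi] at ht
    exact (h.hasDerivAt_G t ht).differentiableAt.differentiableWithinAt
  · intro t ht s hs hts
    rw [interior_Ioi] at ht hs
    rw [(h.hasDerivAt_G t ht).deriv, (h.hasDerivAt_G s hs).deriv]
    exact h.strictMonoOn_G1.monotoneOn ht hs hts

/-- A convex function lies above its tangent lines, and these have positive slope. -/
lemma tendsto_G (h : Nonlin f G G1 G2 t₀ q) : Tendsto G atTop atTop := by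
  set T := t₀ + 1
  have hT : t₀ < T := by simp [T]
  have h0 := h.G1_pos T hT
  have hmono : MonotoneOn (fun t => G t - G1 T * t) (Ici T) := by
    apply monotoneOn_of_hasDerivWithinAt_nonneg (f' := fun t => G1 t - G1 T * 1) (convex_Ici T)
    · intro t ht
      exact ((h.hasDerivAt_G t (lt_of_lt_of_le hT ht)).sub
        ((hasDerivAt_id t).const_mul _)).continuousAt.continuousWithinAt
    · intro t ht
      rw [interior_Ici] at ht
      exact ((h.hasDerivAt_G t (lt_trans hT ht)).sub
        ((hasDerivAt_id t).const_mul _)).hasDerivWithinAt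
    · intro t ht
      rw [interior_Ici] at ht
      have := h.strictMonoOn_G1 hT (mem_Ioi.2 (lt_trans hT ht)) ht
      linarith
  have h1 : Tendsto (fun t => G1 T * t + (G T - G1 T * T)) atTop atTop :=
    tendsto_atTop_add_const_right _ _ (tendsto_id.const_mul_atTop h0)
  refine tendsto_atTop_mono' _ ?_ h1
  filter_upwards [eventually_ge_atTop T] with t ht
  have := hmono (mem_Ici.2 le_rfl) (mem_Ici.2 ht) ht
  simp only at this
  linarith

lemma q_pos (h : Nonlin f G G1 G2 t₀ q) : 0 < q := by linarith [h.q_mem.1]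

lemma kappa_nonneg (h : Nonlin f G G1 G2 t₀ q) : 0 ≤ 1 - 1 / q := by
  have : 1 / q ≤ 1 := by rw [div_le_one h.q_pos]; exact h.q_mem.1
  linarith

lemma kappa_lt_half (h : Nonlin f G G1 G2 t₀ q) : 1 - 1 / q < 1 / 2 := by
  have : 1 / 2 < 1 / q := one_div_lt_one_div_of_lt h.q_pos h.q_mem.2
  linarith

lemma tendsto_GG2 (h : Nonlin f G G1 G2 t₀ q) :
    Tendsto (fun t => G t * G2 t / G1 t ^ 2) atTop (𝓝 (1 / q)) := by
  have := h.lim_q.inv₀ h.q_pos.ne'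
  simpa using this

/-- This quotient is (G G''/G'²)/G with bounded numerator. It is the small parameter ε that perturbs
the conservative system for Z and B. -/
lemma tendsto_eps (h : Nonlin f G G1 G2 t₀ q) :
    Tendsto (fun t => G2 t / G1 t ^ 2) atTop (𝓝 0) := by
  have := h.tendsto_GG2.mul (tendsto_inv_atTop_zero.comp h.tendsto_G)
  rw [mul_zero] at this
  refine this.congr' ?_
  filter_upwards [h.tendsto_G.eventually_gt_atTop 0] with t ht
  simp only [Function.comp]
  field_simp

lemma hasDerivAt_psi (h : Nonlin f G G1 G2 t₀ q) {t : ℝ} (ht : t₀ < t) :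
    HasDerivAt (fun x => G x / G1 x) (1 - G t * G2 t / G1 t ^ 2) t := by
  have h0 := (h.G1_pos t ht).ne'
  refine ((h.hasDerivAt_G t ht).div (h.hasDerivAt_G1 t ht) h0).congr_deriv ?_
  field_simp

/-- The function ψ = G/G' has derivative 1 - G G''/G'², which tends to κ = 1 - 1/q. For q > 1 the
unit of depth ψ(m) is thus comparable with m, for q = 1 it is o(m). -/
lemma tendsto_psi_div (h : Nonlin f G G1 G2 t₀ q) :
    Tendsto (fun t => G t / G1 t / t) atTop (𝓝 (1 - 1 / q)) := by
  have := tendsto_div_of_deriv_div (χ := id) (χ' := fun _ => 1) (a := t₀)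
    (fun t ht => h.hasDerivAt_psi ht) (fun t _ => hasDerivAt_id t) (fun _ _ => one_pos)
    (by simpa using h.tendsto_GG2.const_sub 1) tendsto_id
  simpa using this

/-- The quotient of the derivatives is ε = G''/G'², so f' and f agree to leading order on the
logarithmic scale. -/
lemma tendsto_logG1_div (h : Nonlin f G G1 G2 t₀ q) :
    Tendsto (fun t => Real.log (G1 t) / G t) atTop (𝓝 0) := by
  refine tendsto_div_of_deriv_div (a := t₀)
    (fun t ht => (h.hasDerivAt_G1 t ht).log (h.G1_pos t ht).ne') h.hasDerivAt_G h.G1_pos ?_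
    h.tendsto_G
  refine h.tendsto_eps.congr fun t => ?_
  rw [div_div, sq]

/-- `ψ (m - x ψ m) ≈ (1 - κ x) ψ m` with `ψ = G / G'`. -/
lemma psi_uniform (h : Nonlin f G G1 G2 t₀ q) {b : ℝ} (hb : 0 ≤ b) (hkb : (1 - 1 / q) * b < 1)
    {ε : ℝ} (hε : 0 < ε) (T : ℝ) : ∀ᶠ m in atTop, ∀ x ∈ Icc 0 b,
      T ≤ m - x * (G m / G1 m) ∧
      |G (m - x * (G m / G1 m)) / G1 (m - x * (G m / G1 m)) - (1 - (1 - 1 / q) * x) * (G m / G1 m)|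
        ≤ ε * (G m / G1 m) := by
  set κ := 1 - 1 / q with hκ
  set ε1 := ε / (b + 1) with hε1
  have hε1pos : 0 < ε1 := by positivity
  have hd : Tendsto (fun t => 1 - G t * G2 t / G1 t ^ 2) atTop (𝓝 κ) := h.tendsto_GG2.const_sub 1
  obtain ⟨T1, hT1⟩ := eventually_atTop.1
    ((Metric.tendsto_nhds.1 hd ε1 hε1pos).and (eventually_gt_atTop t₀))
  -- With this d one has (κ + d) b ≤ (1 + κb)/2 < 1. Since ψ(m) ≤ (κ + d) m for large m, the point m
  -- - xψ(m) is at least a fixed fraction of m for all x ≤ b.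
  set d := (1 - κ * b) / (2 * (b + 1)) with hdd
  have hdpos : 0 < d := by
    have : 0 < 1 - κ * b := by linarith
    positivity
  have hlow : (κ + d) * b ≤ 1 - (1 - κ * b) / 2 := by
    have : d * b ≤ (1 - κ * b) / 2 := by
      rw [hdd, div_mul_eq_mul_div, div_le_div_iff₀ (by positivity) (by positivity)]
      nlinarith
    linarith
  filter_upwards [h.tendsto_psi_div.eventually_le_const (show κ < κ + d by linarith),
    eventually_gt_atTop (max t₀ 0), h.tendsto_G.eventually_gt_atTop 0,
    eventually_ge_atTop (max T T1 * (2 / (1 - κ * b)))] with m h1 h2 h3 h4 x hx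
  have hm0 : 0 < m := lt_of_le_of_lt (le_max_right _ _) h2
  have hmt : t₀ < m := lt_of_le_of_lt (le_max_left _ _) h2
  have hψ : 0 < G m / G1 m := div_pos h3 (h.G1_pos m hmt)
  set ψ := G m / G1 m with hψdef
  rw [div_le_iff₀ hm0] at h1
  have hkb' : 0 < 1 - κ * b := by linarith
  have hv : max T T1 ≤ m - x * ψ := by
    have e1 : x * ψ ≤ b * ((κ + d) * m) := mul_le_mul hx.2 h1 hψ.le hb
    have e2 : max T T1 ≤ m * ((1 - κ * b) / 2) := by
      rw [mul_div_assoc', div_le_iff₀ hkb'] at h4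
      linarith
    nlinarith
  refine ⟨(le_max_left _ _).trans hv, ?_⟩
  have hvm : m - x * ψ ≤ m := by nlinarith [hx.1]
  have hvT : T1 ≤ m - x * ψ := (le_max_right _ _).trans hv
  -- Mean value inequality for ψ - κ·id, whose derivative is at most ε1 in modulus beyond T1, over a
  -- distance of at most b ψ(m).
  have := Convex.norm_image_sub_le_of_norm_hasDerivWithin_le
    (f := fun t => G t / G1 t - κ * t) (f' := fun t => 1 - G t * G2 t / G1 t ^ 2 - κ * 1)
    (s := Icc (m - x * ψ) m) (C := ε1) (x := m) (y := m - x * ψ)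
    (fun t ht => ((h.hasDerivAt_psi (hT1 t (hvT.trans ht.1)).2).sub
      ((hasDerivAt_id t).const_mul κ)).hasDerivWithinAt)
    (fun t ht => by
      have := (hT1 t (hvT.trans ht.1)).1
      rw [Real.dist_eq] at this
      rw [Real.norm_eq_abs, mul_one]; exact this.le)
    (convex_Icc _ _) (right_mem_Icc.2 hvm) (left_mem_Icc.2 hvm)
  rw [Real.norm_eq_abs, Real.norm_eq_abs, show m - x * ψ - m = -(x * ψ) by ring, abs_neg,
    abs_of_nonneg (mul_nonneg hx.1 hψ.le)] at this
  have e3 : ε1 * (x * ψ) ≤ ε * ψ := by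
    have : ε1 * x ≤ ε := by
      rw [hε1, div_mul_eq_mul_div, div_le_iff₀ (by positivity)]
      nlinarith [hx.2]
    nlinarith
  refine le_trans (le_of_eq ?_) (this.trans e3)
  congr 1
  rw [← hψdef]; ring

/-- The x-derivative of log G(m - xψ(m)) is -ψ(m)/ψ(m - xψ(m)). By `psi_uniform` it is uniformly
close to -1/(1 - κx), the derivative of log `profile`. -/
lemma log_G_uniform (h : Nonlin f G G1 G2 t₀ q) {b : ℝ} (hb : 0 ≤ b) (hkb : (1 - 1 / q) * b < 1)
    {ε : ℝ} (hε : 0 < ε) : ∀ᶠ m in atTop, ∀ x ∈ Icc 0 b,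
      |Real.log (G (m - x * (G m / G1 m))) - Real.log (G m) - Real.log (profile (1 - 1 / q) x)|
        ≤ ε := by
  have hκ0 := h.kappa_nonneg
  obtain ⟨T, hT⟩ := eventually_atTop.1
    ((eventually_gt_atTop t₀).and (h.tendsto_G.eventually_gt_atTop 0))
  set κ := 1 - 1 / q with hκ
  set d := 1 - κ * b with hd
  have hdpos : 0 < d := by linarith
  -- With w = 1 - κt ≥ d and r = ψ(v)/ψ(m), the first entry gives r ≥ d/2, and the second gives |1/w
  -- - 1/r| ≤ ε/(b + 1).
  set ε' := min (d / 2) (ε / (b + 1) * (d * (d / 2))) with hε'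
  have hε'pos : 0 < ε' := by positivity
  filter_upwards [h.psi_uniform hb hkb hε'pos T, eventually_ge_atTop T] with m hm hmT x hx
  have hψ : 0 < G m / G1 m := div_pos (hT m hmT).2 (h.G1_pos m (hT m hmT).1)
  set ψ := G m / G1 m with hψdef
  have := Convex.norm_image_sub_le_of_norm_hasDerivWithin_le
    (f := fun t => Real.log (G (m - t * ψ)) - Real.log (profile κ t))
    (f' := fun t => G1 (m - t * ψ) * (-(1 * ψ)) / G (m - t * ψ) - -(1 / (1 - κ * t)))
    (s := Icc 0 b) (C := ε / (b + 1)) (x := 0) (y := x) ?_ ?_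
    (convex_Icc _ _) (left_mem_Icc.2 hb) hx
  · simp only [zero_mul, sub_zero, profile_zero, Real.log_one, Real.norm_eq_abs] at this
    rw [abs_of_nonneg hx.1] at this
    have e3 : ε / (b + 1) * x ≤ ε := by
      rw [div_mul_eq_mul_div, div_le_iff₀ (by positivity)]
      nlinarith [hx.2]
    refine le_trans (le_of_eq ?_) (this.trans e3)
    congr 1; ring
  · intro t ht
    have hkt : κ * t < 1 := by nlinarith [ht.2]
    have hv := hT _ (hm t ht).1
    have h1 : HasDerivAt (fun t => G (m - t * ψ)) (G1 (m - t * ψ) * (-(1 * ψ))) t :=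
      (h.hasDerivAt_G _ hv.1).comp t (((hasDerivAt_id t).mul_const ψ).const_sub m)
    exact ((h1.log hv.2.ne').sub (hasDerivAt_log_profile hkt)).hasDerivWithinAt
  · intro t ht
    have hv := hT _ (hm t ht).1
    have hp := (hm t ht).2
    have hg1 := h.G1_pos _ hv.1
    have hg := hv.2
    set v := m - t * ψ
    have hkt : d ≤ 1 - κ * t := by nlinarith [ht.2]
    set w := 1 - κ * t with hw
    have hw0 : 0 < w := lt_of_lt_of_le hdpos hkt
    set r := G v / G1 v / ψ with hr
    have hr1 : |r - w| ≤ ε' := by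
      rw [hr, show G v / G1 v / ψ - w = (G v / G1 v - w * ψ) / ψ by field_simp, abs_div,
        abs_of_pos hψ, div_le_iff₀ hψ]
      exact hp
    have hr2 : d / 2 ≤ r := by
      have := (abs_le.1 hr1).1
      have := min_le_left (d / 2) (ε / (b + 1) * (d * (d / 2)))
      linarith
    have hr0 : 0 < r := lt_of_lt_of_le (by positivity) hr2
    have e : G1 v * (-(1 * ψ)) / G v - -(1 / w) = (r - w) / (w * r) := by
      have : G1 v * (-(1 * ψ)) / G v = - (1 / r) := by
        rw [hr]; field_simp
      rw [this]; field_simp; ring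
    rw [Real.norm_eq_abs, e, abs_div, abs_of_pos (mul_pos hw0 hr0), div_le_iff₀ (mul_pos hw0 hr0)]
    refine (hr1.trans (min_le_right _ _)).trans ?_
    apply mul_le_mul_of_nonneg_left _ (by positivity)
    exact mul_le_mul hkt hr2 (by positivity) hw0.le

section scaled
variable {ι : Type*} {l : Filter ι} {m v : ι → ℝ} {σ : ℝ}

/-- If `v = m - (σ + o(1)) G(m)/G'(m)`, then `v → ∞`, `G(v)/G(m)` tends to the profile, and
`G'(v)/G'(m)` to its slope. -/
lemma scaled_limits (h : Nonlin f G G1 G2 t₀ q) (hm : Tendsto m l atTop)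
    (hS : Tendsto (fun n => (m n - v n) * (G1 (m n) / G (m n))) l (𝓝 σ))
    (hv : ∀ᶠ n in l, v n ≤ m n) (hσ0 : 0 ≤ σ) (hσ : (1 - 1 / q) * σ < 1) :
    Tendsto v l atTop ∧ Tendsto (fun n => G (v n) / G (m n)) l (𝓝 (profile (1 - 1 / q) σ)) ∧
      Tendsto (fun n => G1 (v n) / G1 (m n)) l (𝓝 (slope' (1 - 1 / q) σ)) := by
  have hκ0 := h.kappa_nonneg
  set κ := 1 - 1 / q with hκ
  set S := fun n => (m n - v n) * (G1 (m n) / G (m n)) with hSdef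
  -- Room to the right of σ, so that the depths S n eventually lie in an interval [0, b] on which
  -- the uniform estimates hold.
  obtain ⟨b, hσb, hkb⟩ : ∃ b, σ < b ∧ κ * b < 1 := by
    have : ∀ᶠ x in 𝓝[>] σ, κ * x < 1 :=
      ((continuous_const.mul continuous_id).continuousAt.eventually_lt
        continuousAt_const hσ).filter_mono nhdsWithin_le_nhds
    obtain ⟨b, hb⟩ := (this.and self_mem_nhdsWithin).exists
    exact ⟨b, hb.2, hb.1⟩
  have hb0 : 0 ≤ b := by linarith
  have hgood : ∀ᶠ n in l, t₀ < m n ∧ 0 < G (m n) ∧ 0 < G1 (m n) := by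
    filter_upwards [hm.eventually_gt_atTop t₀, (h.tendsto_G.comp hm).eventually_gt_atTop 0]
      with n h1 h2 using ⟨h1, h2, h.G1_pos _ h1⟩
  have hSmem : ∀ᶠ n in l, S n ∈ Icc 0 b := by
    filter_upwards [hS.eventually_lt_const hσb, hgood, hv] with n h1 h2 h3
    exact ⟨mul_nonneg (by linarith) (div_nonneg h2.2.1.le h2.2.2.le |> fun _ =>
      div_nonneg h2.2.2.le h2.2.1.le), h1.le⟩
  have hveq : ∀ᶠ n in l, m n - S n * (G (m n) / G1 (m n)) = v n := by
    filter_upwards [hgood] with n h1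
    have := h1.2.1.ne'
    have := h1.2.2.ne'
    simp only [hSdef]; field_simp; ring
  have hvinf : Tendsto v l atTop := by
    rw [tendsto_atTop]
    intro T
    filter_upwards [hm.eventually (h.psi_uniform hb0 hkb one_pos T), hSmem, hveq] with n h1 h2 h3
    rw [← h3]; exact (h1 _ h2).1
  have hGratio : Tendsto (fun n => G (v n) / G (m n)) l (𝓝 (profile κ σ)) := by
    have h1 : Tendsto (fun n => Real.log (G (v n)) - Real.log (G (m n))
        - Real.log (profile κ (S n))) l (𝓝 0) := by
      rw [Metric.tendsto_nhds]
      intro ε hε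
      filter_upwards [hm.eventually (h.log_G_uniform hb0 hkb (half_pos hε)), hSmem, hveq]
        with n h1 h2 h3
      have := h1 _ h2
      rw [h3] at this
      rw [Real.dist_eq, sub_zero]; linarith
    have h2 : Tendsto (fun n => Real.log (profile κ (S n))) l (𝓝 (Real.log (profile κ σ))) :=
      (hasDerivAt_log_profile hσ).continuousAt.tendsto.comp hS
    have h3 := (h1.add h2).rexp
    rw [zero_add, Real.exp_log (profile_pos hσ)] at h3
    refine h3.congr' ?_
    filter_upwards [hgood, (h.tendsto_G.comp hvinf).eventually_gt_atTop 0] with n h4 h5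
    simp only [Function.comp] at h5
    rw [sub_add_cancel, Real.exp_sub, Real.exp_log h5, Real.exp_log h4.2.1]
  refine ⟨hvinf, hGratio, ?_⟩
  -- The limit of the derivative ratio follows from G'(v)/G'(m) = (G(v)/G(m)) / (ψ(v)/ψ(m)).
  have hψ : Tendsto (fun n => G (v n) / G1 (v n) / (G (m n) / G1 (m n))) l (𝓝 (1 - κ * σ)) := by
    have h1 : Tendsto (fun n => G (v n) / G1 (v n) / (G (m n) / G1 (m n)) - (1 - κ * S n))
        l (𝓝 0) := by
      rw [Metric.tendsto_nhds]
      intro ε hε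
      filter_upwards [hm.eventually (h.psi_uniform hb0 hkb (half_pos hε) 0), hSmem, hveq, hgood]
        with n h1 h2 h3 h4
      have := (h1 _ h2).2
      rw [h3] at this
      have hψ : 0 < G (m n) / G1 (m n) := div_pos h4.2.1 h4.2.2
      rw [Real.dist_eq, sub_zero, div_sub' hψ.ne', abs_div, abs_of_pos hψ, div_lt_iff₀ hψ]
      rw [mul_comm (G (m n) / G1 (m n))]
      nlinarith
    have h2 := h1.add ((hS.const_mul κ).const_sub 1)
    simpa using h2
  have := hGratio.div hψ (by linarith)
  refine this.congr' ?_
  filter_upwards [hgood, (h.tendsto_G.comp hvinf).eventually_gt_atTop 0,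
    hvinf.eventually_gt_atTop t₀] with n h1 h2 h3
  have := h.G1_pos _ h3
  have := h1.2.1
  have := h1.2.2
  simp only [Function.comp] at h2
  simp only [Pi.div_apply]
  field_simp

end scaled

end Nonlin

/-- The first time at which a continuous function becomes nonnegative. -/
lemma exists_first_zero {φ : ℝ → ℝ} {α β : ℝ} (hαβ : α ≤ β) (hφ : ContinuousOn φ (Icc α β))
    (hα : φ α < 0) (hβ : 0 ≤ φ β) :
    ∃ τ ∈ Ioc α β, φ τ = 0 ∧ (∀ t ∈ Icc α τ, φ t ≤ 0) ∧ ∀ t ∈ Ico α τ, φ t < 0 := by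
  set K := Icc α β ∩ φ ⁻¹' Ici 0 with hK
  have hKc : IsClosed K := hφ.preimage_isClosed_of_isClosed isClosed_Icc isClosed_Ici
  have hKcomp : IsCompact K := isCompact_Icc.of_isClosed_subset hKc inter_subset_left
  have hne : K.Nonempty := ⟨β, right_mem_Icc.2 hαβ, hβ⟩
  obtain ⟨τ, hτ, hmin⟩ := hKcomp.exists_isLeast hne
  have hlt : ∀ t ∈ Ico α τ, φ t < 0 := by
    intro t ht
    by_contra hcon
    have := hmin ⟨⟨ht.1, ht.2.le.trans hτ.1.2⟩, not_lt.1 hcon⟩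
    linarith [ht.2]
  have hατ : α < τ := by
    rcases hτ.1.1.eq_or_lt with h | h
    · subst h; exact absurd hτ.2 (not_le.2 hα)
    · exact h
  have hle : φ τ ≤ 0 := by
    have hc : ContinuousWithinAt φ (Ico α τ) τ :=
      (hφ τ hτ.1).mono (fun t ht => ⟨ht.1, ht.2.le.trans hτ.1.2⟩)
    have : τ ∈ closure (Ico α τ) := by
      rw [closure_Ico hατ.ne]; exact right_mem_Icc.2 hατ.le
    have := hc.mem_closure this (t := Iic 0) (fun t ht => (hlt t ht).le)
    simpa using this
  refine ⟨τ, ⟨hατ, hτ.1.2⟩, le_antisymm hle hτ.2, fun t ht => ?_, hlt⟩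
  rcases ht.2.eq_or_lt with h | h
  · rw [h]; exact hle
  · exact (hlt t ⟨ht.1, h⟩).le

/-! ### The radial equation in the variable log r -/

/-- A weight `H` on `(-∞, 0]` between `b` and `c` with `|H'| ≤ C exp(t) H`. -/
structure Weight (H H1 : ℝ → ℝ) (b c C : ℝ) : Prop where
  b_pos : 0 < b
  C_nonneg : 0 ≤ C
  lower : ∀ t ≤ 0, b ≤ H t
  upper : ∀ t ≤ 0, H t ≤ c
  hasDerivAt : ∀ t < 0, HasDerivAt H (H1 t) t
  deriv_le : ∀ t < 0, |H1 t| ≤ C * Real.exp t * H t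

/-- A radial solution in the variable `t = log r`, with `y = -U'`. -/
structure LogSol (f H : ℝ → ℝ) (l m : ℝ) (U y : ℝ → ℝ) : Prop where
  l_pos : 0 < l
  m_pos : 0 < m
  cont_U : ContinuousOn U (Iic 0)
  hasDerivAt_U : ∀ t < 0, HasDerivAt U (-y t) t
  hasDerivAt_y : ∀ t < 0, HasDerivAt y (l * Real.exp (2 * t) * H t * f (U t)) t
  U_bot : Tendsto U atBot (𝓝 m)
  y_bot : Tendsto y atBot (𝓝 0)
  U_zero : U 0 = 0
  U_pos : ∀ t < 0, 0 < U t

/-- The slope of `U` in units of `1 / G'(U)`. -/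
def scZ (G1 U y : ℝ → ℝ) (t : ℝ) : ℝ := y t * G1 (U t)

/-- The logarithm of `l r² f'(U)`. -/
def scP (G G1 : ℝ → ℝ) (l : ℝ) (U : ℝ → ℝ) (t : ℝ) : ℝ :=
  Real.log l + 2 * t + G (U t) + Real.log (G1 (U t))

/-- The quantity `l r² h f'(U)`. -/
def scB (G G1 H : ℝ → ℝ) (l : ℝ) (U : ℝ → ℝ) (t : ℝ) : ℝ := H t * Real.exp (scP G G1 l U t)

/-- The depth `m - U` in units of `G(m) / G'(m)`. -/
def scS (G G1 : ℝ → ℝ) (m : ℝ) (U : ℝ → ℝ) (t : ℝ) : ℝ := (m - U t) * (G1 m / G m)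

section
variable {f G G1 G2 H H1 U y : ℝ → ℝ} {t₀ q b c C l m : ℝ}

/-- Monotonicity is known only beyond t₀. On the compact rest f is bounded, and f(x) exceeds that
bound for large x. -/
lemma Nonlin.exists_f_le (h : Nonlin f G G1 G2 t₀ q) :
    ∃ X > t₀, ∀ x ≥ X, ∀ z ∈ Icc 0 x, f z ≤ f x := by
  obtain ⟨K, hK⟩ := isCompact_Icc.bddAbove_image (h.f_cont.mono
    (Icc_subset_Ici_self : Icc 0 (t₀ + 1) ⊆ Ici 0))
  obtain ⟨X, hX⟩ := eventually_atTop.1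
    ((Real.tendsto_exp_atTop.comp h.tendsto_G).eventually_ge_atTop K)
  refine ⟨max X (t₀ + 1), lt_of_lt_of_le (by linarith) (le_max_right _ _), fun x hx z hz => ?_⟩
  have hxt : t₀ < x := lt_of_lt_of_le (by linarith) ((le_max_right X (t₀ + 1)).trans hx)
  rcases le_or_gt z (t₀ + 1) with h1 | h1
  · have h2 := hK ⟨z, ⟨hz.1, h1⟩, rfl⟩
    have h3 := hX x ((le_max_left _ _).trans hx)
    rw [h.f_eq x hxt]
    exact h2.trans h3
  · have hzt : t₀ < z := by linarith
    rw [h.f_eq x hxt, h.f_eq z hzt]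
    exact Real.exp_le_exp.2 (h.strictMonoOn_G.monotoneOn hzt hxt hz.2)

namespace Weight
lemma pos (w : Weight H H1 b c C) {t : ℝ} (ht : t ≤ 0) : 0 < H t :=
  w.b_pos.trans_le (w.lower t ht)

lemma c_pos (w : Weight H H1 b c C) : 0 < c := (w.pos le_rfl).trans_le (w.upper 0 le_rfl)
end Weight

lemma le_of_tendsto_atBot {φ : ℝ → ℝ} {T v : ℝ} (h : MonotoneOn φ (Iio T))
    (hlim : Tendsto φ atBot (𝓝 v)) {t : ℝ} (ht : t < T) : v ≤ φ t := by
  refine le_of_tendsto hlim ?_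
  filter_upwards [eventually_le_atBot t] with s hs
  exact h (mem_Iio.2 (hs.trans_lt ht)) ht hs

namespace LogSol

lemma y_monotoneOn (s : LogSol f H l m U y) (w : Weight H H1 b c C)
    (h : Nonlin f G G1 G2 t₀ q) : MonotoneOn y (Iio 0) := by
  apply monotoneOn_of_hasDerivWithinAt_nonneg (convex_Iio 0)
    (f' := fun t => l * Real.exp (2 * t) * H t * f (U t))
  · exact fun t ht => (s.hasDerivAt_y t ht).continuousAt.continuousWithinAt
  · intro t ht
    rw [interior_Iio] at ht
    exact (s.hasDerivAt_y t ht).hasDerivWithinAt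
  · intro t ht
    rw [interior_Iio] at ht
    have := s.l_pos
    have := w.pos (le_of_lt ht)
    have := h.f_nonneg _ (s.U_pos t ht).le
    positivity

lemma y_nonneg (s : LogSol f H l m U y) (w : Weight H H1 b c C)
    (h : Nonlin f G G1 G2 t₀ q) {t : ℝ} (ht : t < 0) : 0 ≤ y t :=
  le_of_tendsto_atBot (s.y_monotoneOn w h) s.y_bot ht

lemma U_antitoneOn (s : LogSol f H l m U y) (w : Weight H H1 b c C)
    (h : Nonlin f G G1 G2 t₀ q) : AntitoneOn U (Iic 0) := by
  apply antitoneOn_of_hasDerivWithinAt_nonpos (convex_Iic 0) (f' := fun t => - y t) s.cont_U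
  · intro t ht
    rw [interior_Iic] at ht
    exact (s.hasDerivAt_U t ht).hasDerivWithinAt
  · intro t ht
    rw [interior_Iic] at ht
    linarith [s.y_nonneg w h ht]

lemma U_le (s : LogSol f H l m U y) (w : Weight H H1 b c C)
    (h : Nonlin f G G1 G2 t₀ q) {t : ℝ} (ht : t ≤ 0) : U t ≤ m := by
  refine ge_of_tendsto s.U_bot ?_
  filter_upwards [eventually_le_atBot t] with r hr
  exact s.U_antitoneOn w h (mem_Iic.2 (hr.trans ht)) ht hr

lemma lt_zero_of_U_pos (s : LogSol f H l m U y) {t : ℝ} (ht : t ≤ 0) (hU : 0 < U t) :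
    t < 0 := by
  rcases ht.eq_or_lt with h | h
  · rw [h, s.U_zero] at hU; exact absurd hU (lt_irrefl 0)
  · exact h

lemma hasDerivAt_G (s : LogSol f H l m U y) (h : Nonlin f G G1 G2 t₀ q) {t : ℝ}
    (ht : t < 0) (hU : t₀ < U t) : HasDerivAt (fun x => G (U x)) (-scZ G1 U y t) t := by
  refine ((h.hasDerivAt_G _ hU).comp t (s.hasDerivAt_U t ht)).congr_deriv ?_
  unfold scZ; ring

lemma hasDerivAt_logG1 (s : LogSol f H l m U y) (h : Nonlin f G G1 G2 t₀ q) {t : ℝ}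
    (ht : t < 0) (hU : t₀ < U t) : HasDerivAt (fun x => Real.log (G1 (U x)))
      (-(G2 (U t) / G1 (U t) ^ 2 * scZ G1 U y t)) t := by
  have h0 := (h.G1_pos _ hU).ne'
  refine (((h.hasDerivAt_G1 _ hU).comp t (s.hasDerivAt_U t ht)).log h0).congr_deriv ?_
  unfold scZ
  simp only [Function.comp]; field_simp

lemma hasDerivAt_scP (s : LogSol f H l m U y) (h : Nonlin f G G1 G2 t₀ q) {t : ℝ}
    (ht : t < 0) (hU : t₀ < U t) : HasDerivAt (scP G G1 l U)
      (2 - scZ G1 U y t - G2 (U t) / G1 (U t) ^ 2 * scZ G1 U y t) t := by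
  refine (((((hasDerivAt_id t).const_mul 2).const_add (Real.log l)).add
    (s.hasDerivAt_G h ht hU)).add (s.hasDerivAt_logG1 h ht hU)).congr_deriv ?_
  ring

lemma scB_eq (s : LogSol f H l m U y) (h : Nonlin f G G1 G2 t₀ q) {t : ℝ} (hU : t₀ < U t) :
    scB G G1 H l U t = l * Real.exp (2 * t) * H t * f (U t) * G1 (U t) := by
  unfold scB scP
  rw [Real.exp_add, Real.exp_add, Real.exp_add, Real.exp_log s.l_pos,
    Real.exp_log (h.G1_pos _ hU), h.f_eq _ hU]
  ring

/-- With `hasDerivAt_scB` this is the governing system. For ε → 0 and constant H it becomes Z' = B,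
B' = B(2 - Z), with first integral B + (Z - 2)²/2. -/
lemma hasDerivAt_scZ (s : LogSol f H l m U y) (h : Nonlin f G G1 G2 t₀ q) {t : ℝ}
    (ht : t < 0) (hU : t₀ < U t) : HasDerivAt (scZ G1 U y)
      (scB G G1 H l U t - G2 (U t) / G1 (U t) ^ 2 * scZ G1 U y t ^ 2) t := by
  have h0 := (h.G1_pos _ hU).ne'
  refine ((s.hasDerivAt_y t ht).mul
    ((h.hasDerivAt_G1 _ hU).comp t (s.hasDerivAt_U t ht))).congr_deriv ?_
  rw [s.scB_eq h hU]
  unfold scZ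
  simp only [Function.comp]; field_simp; ring

lemma hasDerivAt_scB (s : LogSol f H l m U y) (h : Nonlin f G G1 G2 t₀ q)
    (w : Weight H H1 b c C) {t : ℝ} (ht : t < 0) (hU : t₀ < U t) :
    HasDerivAt (scB G G1 H l U) (scB G G1 H l U t *
      (H1 t / H t + 2 - scZ G1 U y t - G2 (U t) / G1 (U t) ^ 2 * scZ G1 U y t)) t := by
  have h0 := (w.pos ht.le).ne'
  refine ((w.hasDerivAt t ht).mul (s.hasDerivAt_scP h ht hU).exp).congr_deriv ?_
  unfold scB
  field_simp
  ring

lemma hasDerivAt_scS (s : LogSol f H l m U y) {t : ℝ} (ht : t < 0) :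
    HasDerivAt (scS G G1 m U) (y t * (G1 m / G m)) t := by
  refine (((s.hasDerivAt_U t ht).const_sub m).mul_const (G1 m / G m)).congr_deriv ?_
  ring

lemma scZ_nonneg (s : LogSol f H l m U y) (w : Weight H H1 b c C) (h : Nonlin f G G1 G2 t₀ q)
    {t : ℝ} (ht : t < 0) (hU : t₀ < U t) : 0 ≤ scZ G1 U y t :=
  mul_nonneg (s.y_nonneg w h ht) (h.G1_pos _ hU).le

lemma scB_pos (w : Weight H H1 b c C) {t : ℝ} (ht : t ≤ 0) : 0 < scB G G1 H l U t :=
  mul_pos (w.pos ht) (Real.exp_pos _)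

lemma scP_eq_log (w : Weight H H1 b c C) {t : ℝ} (ht : t ≤ 0) :
    scP G G1 l U t = Real.log (scB G G1 H l U t) - Real.log (H t) := by
  unfold scB
  rw [Real.log_mul (w.pos ht).ne' (Real.exp_pos _).ne', Real.log_exp]; ring

/-- Far from its zero, a solution is at a distance from the boundary that is large on the
logarithmic scale. -/
lemma height_le (s : LogSol f H l m U y) (w : Weight H H1 b c C) (h : Nonlin f G G1 G2 t₀ q)
    {X : ℝ} (hX0 : t₀ < X) (hX : ∀ x ≥ X, ∀ z ∈ Icc 0 x, f z ≤ f x) {τ T : ℝ} (hτ : τ < 0)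
    (hT : -T ≤ τ) (hU : X ≤ U τ) :
    U τ * G1 (U τ) ≤ T * (scZ G1 U y τ
      + T * (c / b * Real.exp (2 * T) * scB G G1 H l U τ)) := by
  have hUt : t₀ < U τ := lt_of_lt_of_le hX0 hU
  have hg := h.G1_pos _ hUt
  have hT0 : 0 < T := by linarith
  -- A bounds y' on [τ, 0). Compared with time τ, the factor exp(2t) grows by at most exp(2T), H by
  -- at most c/b, and f(U) does not exceed f(U τ). Integrating twice up to the zero of U bounds U τ.
  set A := c / b * Real.exp (2 * T) * (l * Real.exp (2 * τ) * H τ * f (U τ)) with hA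
  have hl := s.l_pos
  have hf0 := h.f_nonneg _ (s.U_pos τ hτ).le
  have hA0 : 0 ≤ A := by
    have := w.b_pos; have := w.c_pos; have := w.pos hτ.le
    positivity
  have hAb : ∀ t ∈ Ico τ 0, l * Real.exp (2 * t) * H t * f (U t) ≤ A := by
    intro t ht
    have h1 : Real.exp (2 * t) ≤ Real.exp (2 * T) * Real.exp (2 * τ) := by
      rw [← Real.exp_add]; exact Real.exp_le_exp.2 (by linarith [ht.2])
    have h2 : H t ≤ c / b * H τ := by
      rw [div_mul_eq_mul_div, le_div_iff₀ w.b_pos]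
      exact mul_le_mul (w.upper t ht.2.le) (w.lower τ hτ.le) w.b_pos.le w.c_pos.le
    have h3 : f (U t) ≤ f (U τ) := hX _ hU _ ⟨(s.U_pos t ht.2).le,
      s.U_antitoneOn w h (mem_Iic.2 hτ.le) (mem_Iic.2 ht.2.le) ht.1⟩
    have hH := w.pos ht.2.le
    have hHτ := w.pos hτ.le
    have hft := h.f_nonneg _ (s.U_pos t ht.2).le
    have hcb : 0 < c / b := div_pos w.c_pos w.b_pos
    calc l * Real.exp (2 * t) * H t * f (U t)
        ≤ l * (Real.exp (2 * T) * Real.exp (2 * τ)) * (c / b * H τ) * f (U τ) := by gcongr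
      _ = A := by rw [hA]; ring
  have hy : ∀ t ∈ Ico τ 0, y t ≤ y τ + T * A := by
    intro t ht
    have hmono : AntitoneOn (fun t => y t - A * t) (Ico τ 0) := by
      apply antitoneOn_of_hasDerivWithinAt_nonpos (convex_Ico τ 0)
        (f' := fun t => l * Real.exp (2 * t) * H t * f (U t) - A * 1)
      · exact fun t ht => ((s.hasDerivAt_y t ht.2).sub
          ((hasDerivAt_id t).const_mul A)).continuousAt.continuousWithinAt
      · intro t ht
        rw [interior_Ico] at ht
        exact ((s.hasDerivAt_y t ht.2).sub ((hasDerivAt_id t).const_mul A)).hasDerivWithinAt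
      · intro t ht
        rw [interior_Ico] at ht
        linarith [hAb t (Ioo_subset_Ico_self ht)]
    have := hmono (left_mem_Ico.2 hτ) ht ht.1
    simp only at this
    have h4 : A * (t - τ) ≤ A * T := mul_le_mul_of_nonneg_left (by linarith [ht.2]) hA0
    linarith
  have hUl : U τ ≤ T * (y τ + T * A) := by
    have hmono : MonotoneOn (fun t => U t + (y τ + T * A) * t) (Icc τ 0) := by
      apply monotoneOn_of_hasDerivWithinAt_nonneg (convex_Icc τ 0)
        (f' := fun t => -y t + (y τ + T * A) * 1)
      · exact (s.cont_U.mono Icc_subset_Iic_self).add (by fun_prop)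
      · intro t ht
        rw [interior_Icc] at ht
        exact ((s.hasDerivAt_U t ht.2).add ((hasDerivAt_id t).const_mul _)).hasDerivWithinAt
      · intro t ht
        rw [interior_Icc] at ht
        linarith [hy t (Ioo_subset_Ico_self ht)]
    have := hmono (left_mem_Icc.2 hτ.le) (right_mem_Icc.2 hτ.le) hτ.le
    simp only [s.U_zero] at this
    have h5 := s.y_nonneg w h hτ
    have h6 : 0 ≤ y τ + T * A := by positivity
    have : (y τ + T * A) * (-τ) ≤ (y τ + T * A) * T :=
      mul_le_mul_of_nonneg_left (by linarith) h6
    nlinarith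
  rw [s.scB_eq h hUt]
  calc U τ * G1 (U τ) ≤ T * (y τ + T * A) * G1 (U τ) := by gcongr
    _ = _ := by rw [hA]; unfold scZ; ring

end LogSol

/-- Times at which a solution is high and `Z`, `B` are bounded are close to `-∞`. -/
lemma Nonlin.exists_time_lt (h : Nonlin f G G1 G2 t₀ q) (w : Weight H H1 b c C) (K T : ℝ) :
    ∃ X > t₀, ∀ (l m : ℝ) (U y : ℝ → ℝ), LogSol f H l m U y → ∀ τ < 0, X ≤ U τ →
      scZ G1 U y τ ≤ K → scB G G1 H l U τ ≤ K → τ < -T := by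
  obtain ⟨X, hX0, hX⟩ := h.exists_f_le
  set T' := max T 1 with hT'
  have hT'0 : 0 < T' := lt_of_lt_of_le one_pos (le_max_right _ _)
  set M := T' * (K + T' * (c / b * Real.exp (2 * T') * K)) with hM
  have hg := h.G1_pos X hX0
  refine ⟨max X (|M| / G1 X + 1), lt_of_lt_of_le hX0 (le_max_left _ _), ?_⟩
  intro l m U y s τ hτ hU hZ hB
  by_contra hcon
  have hX' : X ≤ U τ := (le_max_left _ _).trans hU
  have h1 := s.height_le w h hX0 hX hτ (T := T') (by linarith [le_max_left T 1]) hX'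
  have hcb : 0 < c / b := div_pos w.c_pos w.b_pos
  have h2 : T' * (scZ G1 U y τ + T' * (c / b * Real.exp (2 * T') * scB G G1 H l U τ)) ≤ M := by
    rw [hM]; gcongr
  have h3 : G1 X ≤ G1 (U τ) := h.strictMonoOn_G1.monotoneOn hX0 (lt_of_lt_of_le hX0 hX') hX'
  have h4 : |M| / G1 X + 1 ≤ U τ := (le_max_right _ _).trans hU
  have h5 : (|M| / G1 X + 1) * G1 X ≤ U τ * G1 (U τ) :=
    mul_le_mul h4 h3 hg.le (s.U_pos τ hτ).le
  have h6 : (|M| / G1 X + 1) * G1 X = |M| + G1 X := by field_simp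
  linarith [le_abs_self M]

end

/-! ### Limit states of a sequence of solutions -/

/-- `p` is a limit of values `X n t` at suitable times `t = t n < 0`. -/
def Reach {α : Type*} [TopologicalSpace α] (X : ℕ → ℝ → α) (p : α) : Prop :=
  ∀ V ∈ 𝓝 p, ∀ᶠ n in atTop, ∃ t < 0, X n t ∈ V

lemma Reach.of_seq {α : Type*} [TopologicalSpace α] {X : ℕ → ℝ → α} {p : α} {τ : ℕ → ℝ}
    (hτ : ∀ᶠ n in atTop, τ n < 0) (h : Tendsto (fun n => X n (τ n)) atTop (𝓝 p)) :
    Reach X p := fun V hV => by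
  filter_upwards [hτ, h hV] with n h1 h2 using ⟨τ n, h1, h2⟩

/-- The set of limit states is closed. This supplies the endpoints that a single motion only
approaches: the slope 2 + a after a concentration, and the depth of the next concentration. -/
lemma Reach.of_mem_closure {α : Type*} [TopologicalSpace α] {X : ℕ → ℝ → α} {p : α}
    (h : p ∈ closure {p | Reach X p}) : Reach X p := by
  intro V hV
  obtain ⟨W, hWV, hWo, hpW⟩ := mem_nhds_iff.1 hV
  obtain ⟨p', hp'W, hp'⟩ := mem_closure_iff.1 h W hWo hpW
  exact (hp' W (hWo.mem_nhds hp'W)).mono fun n ⟨t, ht, h2⟩ => ⟨t, ht, hWV h2⟩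

/-- For each n take a time that minimizes the distance to p up to 1/(n + 1). Limits are therefore
attained along the whole sequence, without extraction. -/
lemma Reach.exists_seq {α : Type*} [PseudoMetricSpace α] {X : ℕ → ℝ → α} {p : α}
    (h : Reach X p) : ∃ τ : ℕ → ℝ, (∀ n, τ n < 0) ∧ Tendsto (fun n => X n (τ n)) atTop (𝓝 p) := by
  set D : ℕ → Set ℝ := fun n => (fun t => dist (X n t) p) '' Iio 0
  have hbdd : ∀ n, BddBelow (D n) := fun n => ⟨0, by rintro _ ⟨t, _, rfl⟩; exact dist_nonneg⟩
  have hne : ∀ n, (D n).Nonempty := fun n => ⟨_, -1, by simp, rfl⟩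
  have h1 : ∀ n : ℕ, ∃ t < 0, dist (X n t) p < sInf (D n) + 1 / (n + 1 : ℝ) := by
    intro n
    obtain ⟨_, ⟨t, ht, rfl⟩, h2⟩ := exists_lt_of_csInf_lt (hne n)
      (show sInf (D n) < sInf (D n) + 1 / (n + 1 : ℝ) by
        have : (0 : ℝ) < 1 / (n + 1 : ℝ) := by positivity
        linarith)
    exact ⟨t, ht, h2⟩
  choose τ hτ hd using h1
  refine ⟨τ, hτ, ?_⟩
  rw [Metric.tendsto_nhds]
  intro ε hε
  have h3 := h _ (Metric.ball_mem_nhds p (half_pos hε))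
  have h4 := (tendsto_one_div_add_atTop_nhds_zero_nat (𝕜 := ℝ)).eventually_lt_const (half_pos hε)
  filter_upwards [h3, h4] with n ⟨t, ht, h5⟩ h6
  have : sInf (D n) ≤ dist (X n t) p := csInf_le (hbdd n) ⟨t, ht, rfl⟩
  have := hd n
  rw [Metric.mem_ball] at h5
  linarith

lemma exists_seq_of_eventually {P : ℕ → ℝ → Prop} (h : ∀ᶠ n in atTop, ∃ t, P n t) :
    ∃ τ : ℕ → ℝ, ∀ᶠ n in atTop, P n (τ n) := by
  refine ⟨fun n => Classical.epsilon (P n), ?_⟩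
  filter_upwards [h] with n hn using Classical.epsilon_spec hn

/-- A sequence of solutions whose heights tend to infinity. -/
structure Family (f G G1 G2 H H1 : ℝ → ℝ) (t₀ q b c C : ℝ) (l m : ℕ → ℝ)
    (U y : ℕ → ℝ → ℝ) : Prop where
  nonlin : Nonlin f G G1 G2 t₀ q
  weight : Weight H H1 b c C
  sol : ∀ n, LogSol f H (l n) (m n) (U n) (y n)
  lim_m : Tendsto m atTop atTop

/-- The scaled quantities `(S, Z, B, P / G(m))`. -/
def scState (G G1 H : ℝ → ℝ) (l m : ℕ → ℝ) (U y : ℕ → ℝ → ℝ) (n : ℕ) (t : ℝ) : ℝ × ℝ × ℝ × ℝ :=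
  (scS G G1 (m n) (U n) t, scZ G1 (U n) (y n) t, scB G G1 H (l n) (U n) t,
    scP G G1 (l n) (U n) t / G (m n))

lemma tendsto_scState {G G1 H : ℝ → ℝ} {l m : ℕ → ℝ} {U y : ℕ → ℝ → ℝ} {τ : ℕ → ℝ}
    {σ z β e : ℝ} : Tendsto (fun n => scState G G1 H l m U y n (τ n)) atTop (𝓝 (σ, z, β, e)) ↔
      Tendsto (fun n => scS G G1 (m n) (U n) (τ n)) atTop (𝓝 σ) ∧
      Tendsto (fun n => scZ G1 (U n) (y n) (τ n)) atTop (𝓝 z) ∧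
      Tendsto (fun n => scB G G1 H (l n) (U n) (τ n)) atTop (𝓝 β) ∧
      Tendsto (fun n => scP G G1 (l n) (U n) (τ n) / G (m n)) atTop (𝓝 e) := by
  simp only [scState, Prod.tendsto_iff]

namespace Family
variable {f G G1 G2 H H1 : ℝ → ℝ} {t₀ q b c C : ℝ} {l m : ℕ → ℝ} {U y : ℕ → ℝ → ℝ}

lemma eventually_good (F : Family f G G1 G2 H H1 t₀ q b c C l m U y) (K : ℝ) :
    ∀ᶠ n in atTop, t₀ < m n ∧ 0 < G1 (m n) ∧ 0 < G (m n) ∧ K < G (m n) := by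
  filter_upwards [F.lim_m.eventually_gt_atTop t₀,
    (F.nonlin.tendsto_G.comp F.lim_m).eventually_gt_atTop 0,
    (F.nonlin.tendsto_G.comp F.lim_m).eventually_gt_atTop K] with n h1 h2 h3
  exact ⟨h1, F.nonlin.G1_pos _ h1, h2, h3⟩

lemma tendsto_N (F : Family f G G1 G2 H H1 t₀ q b c C l m U y) :
    Tendsto (fun n => G (m n)) atTop atTop := F.nonlin.tendsto_G.comp F.lim_m

lemma scaled_limits (F : Family f G G1 G2 H H1 t₀ q b c C l m U y) {τ : ℕ → ℝ} {σ : ℝ}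
    (hτ : ∀ᶠ n in atTop, τ n ≤ 0)
    (hS : Tendsto (fun n => scS G G1 (m n) (U n) (τ n)) atTop (𝓝 σ))
    (hσ0 : 0 ≤ σ) (hσ : (1 - 1 / q) * σ < 1) :
    Tendsto (fun n => U n (τ n)) atTop atTop ∧
      Tendsto (fun n => G (U n (τ n)) / G (m n)) atTop (𝓝 (profile (1 - 1 / q) σ)) ∧
      Tendsto (fun n => G1 (U n (τ n)) / G1 (m n)) atTop (𝓝 (slope' (1 - 1 / q) σ)) := by
  refine F.nonlin.scaled_limits F.lim_m hS ?_ hσ0 hσ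
  filter_upwards [hτ] with n hn
  exact (F.sol n).U_le F.weight F.nonlin hn

lemma scS_monotoneOn (F : Family f G G1 G2 H H1 t₀ q b c C l m U y) {n : ℕ}
    (h1 : 0 < G1 (m n)) (h2 : 0 < G (m n)) : MonotoneOn (scS G G1 (m n) (U n)) (Iic 0) := by
  intro s hs t ht hst
  have := (F.sol n).U_antitoneOn F.weight F.nonlin hs ht hst
  unfold scS
  have h3 : 0 < G1 (m n) / G (m n) := div_pos h1 h2
  nlinarith

lemma scS_continuousOn (F : Family f G G1 G2 H H1 t₀ q b c C l m U y) (n : ℕ) :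
    ContinuousOn (scS G G1 (m n) (U n)) (Iic 0) :=
  (continuousOn_const.sub (F.sol n).cont_U).mul continuousOn_const

/-- At the boundary the depth is m G'(m)/G(m) = m/ψ(m), and ψ(m)/m → κ. Every x with κx < 1 is thus
eventually a depth attained inside. -/
lemma eventually_scS_zero (F : Family f G G1 G2 H H1 t₀ q b c C l m U y) {x : ℝ}
    (hx : (1 - 1 / q) * x < 1) : ∀ᶠ n in atTop, x < scS G G1 (m n) (U n) 0 := by
  have h1 := (F.nonlin.tendsto_psi_div.comp F.lim_m).mul_const x
  filter_upwards [h1.eventually_lt_const hx, F.eventually_good 0] with n h2 h3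
  have hm := (F.sol n).m_pos
  have := h3.2.1
  have := h3.2.2.1
  unfold scS
  rw [(F.sol n).U_zero, sub_zero]
  simp only [Function.comp] at h2
  rw [div_div, div_mul_eq_mul_div, div_lt_one (by positivity)] at h2
  rw [mul_div_assoc', lt_div_iff₀ (by positivity)]
  linarith

lemma exists_time_scS (F : Family f G G1 G2 H H1 t₀ q b c C l m U y) {n : ℕ} {x τ : ℝ}
    (hτ : τ ≤ 0) (h1 : scS G G1 (m n) (U n) τ < x) (h0 : x < scS G G1 (m n) (U n) 0) :
    ∃ t, τ < t ∧ t < 0 ∧ scS G G1 (m n) (U n) t = x := by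
  obtain ⟨t, ht, hx⟩ := intermediate_value_Icc hτ
    ((F.scS_continuousOn n).mono Icc_subset_Iic_self) ⟨h1.le, h0.le⟩
  refine ⟨t, lt_of_le_of_ne ht.1 ?_, lt_of_le_of_ne ht.2 ?_, hx⟩
  · rintro rfl; linarith
  · rintro rfl; linarith

/-- Before the first concentration. -/
lemma reach_zero (F : Family f G G1 G2 H H1 t₀ q b c C l m U y) :
    Reach (scState G G1 H l m U y) (0, 0, 0, 0) := by
  have h := F.nonlin
  have w := F.weight
  have hc := w.c_pos
  obtain ⟨X, hX0, hX⟩ := h.exists_f_le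
  -- D is λ r² f'(μ). Since f(U) ≤ f(m) and H ≤ c, it satisfies y' G'(m) ≤ cD, and D' = 2D.
  -- Integrating from -∞ gives the factors c/2 for y and c/4 for m - U.
  set D : ℕ → ℝ → ℝ := fun n t => l n * f (m n) * G1 (m n) * Real.exp (2 * t) with hD
  have hDy : ∀ n t, HasDerivAt (D n) (2 * D n t) t := by
    intro n t
    refine ((((hasDerivAt_id t).const_mul 2).exp).const_mul _).congr_deriv ?_
    simp only [hD, id]; ring
  have hDlim : ∀ n, Tendsto (D n) atBot (𝓝 0) := by
    intro n
    have : Tendsto (fun t : ℝ => Real.exp (2 * t)) atBot (𝓝 0) :=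
      Real.tendsto_exp_atBot.comp (tendsto_id.const_mul_atBot two_pos)
    simpa using this.const_mul (l n * f (m n) * G1 (m n))
  have hyb : ∀ n, X ≤ m n → ∀ t < 0, y n t * G1 (m n) ≤ c / 2 * D n t := by
    intro n hn t ht
    have s := F.sol n
    have hg := h.G1_pos _ (lt_of_lt_of_le hX0 hn)
    have hmono : MonotoneOn (fun t => c / 2 * D n t - y n t * G1 (m n)) (Iio 0) := by
      apply monotoneOn_of_hasDerivWithinAt_nonneg (convex_Iio 0)
        (f' := fun t => c / 2 * (2 * D n t)
          - l n * Real.exp (2 * t) * H t * f (U n t) * G1 (m n))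
      · exact fun t ht => (((hDy n t).const_mul _).sub
          ((s.hasDerivAt_y t ht).mul_const _)).continuousAt.continuousWithinAt
      · intro t ht
        rw [interior_Iio] at ht
        exact (((hDy n t).const_mul _).sub
          ((s.hasDerivAt_y t ht).mul_const _)).hasDerivWithinAt
      · intro t ht
        rw [interior_Iio] at ht
        have h1 : f (U n t) ≤ f (m n) := hX _ hn _ ⟨(s.U_pos t ht).le, s.U_le w h (le_of_lt ht)⟩
        have h2 := w.upper t (le_of_lt ht)
        have h3 := s.l_pos
        have h4 := h.f_nonneg _ (s.U_pos t ht).le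
        have h5 := w.pos (le_of_lt ht)
        have : l n * Real.exp (2 * t) * H t * f (U n t) * G1 (m n)
            ≤ l n * Real.exp (2 * t) * c * f (m n) * G1 (m n) := by gcongr
        simp only [hD]
        linarith
    have := le_of_tendsto_atBot hmono (v := 0)
      (by simpa using ((hDlim n).const_mul (c / 2)).sub (s.y_bot.mul_const (G1 (m n)))) ht
    linarith
  have hUb : ∀ n, X ≤ m n → ∀ t ≤ 0, (m n - U n t) * G1 (m n) ≤ c / 4 * D n t := by
    intro n hn
    have s := F.sol n
    have hmono : MonotoneOn (fun t => c / 4 * D n t - (m n - U n t) * G1 (m n)) (Iic 0) := by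
      apply monotoneOn_of_hasDerivWithinAt_nonneg (convex_Iic 0)
        (f' := fun t => c / 4 * (2 * D n t) - -(-y n t) * G1 (m n))
      · apply ContinuousOn.sub
        · exact fun t _ => ((hDy n t).const_mul _).continuousAt.continuousWithinAt
        · exact (continuousOn_const.sub s.cont_U).mul continuousOn_const
      · intro t ht
        rw [interior_Iic] at ht
        exact (((hDy n t).const_mul _).sub
          (((s.hasDerivAt_U t ht).const_sub (m n)).mul_const _)).hasDerivWithinAt
      · intro t ht
        rw [interior_Iic] at ht
        linarith [hyb n hn t ht]
    have hneg : ∀ t < 0, 0 ≤ c / 4 * D n t - (m n - U n t) * G1 (m n) := by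
      intro t ht
      refine le_of_tendsto_atBot (hmono.mono Iio_subset_Iic_self) ?_ ht
      simpa using ((hDlim n).const_mul (c / 4)).sub
        ((s.U_bot.const_sub (m n)).mul_const (G1 (m n)))
    intro t ht
    rcases ht.eq_or_lt with h1 | h1
    · subst h1
      have := hneg (-1) (by norm_num)
      have h2 := hmono (show (-1 : ℝ) ∈ Iic 0 by simp) (show (0 : ℝ) ∈ Iic 0 by simp) (by norm_num)
      simp only at h2
      linarith
    · linarith [hneg t h1]
  -- The time at which D = 1/G(m). This is small enough that Z, B and the depth still tend to zero,
  -- yet log D = -log G(m) is negligible against G(m), so that P/G(m) → 0 as well.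
  set τ : ℕ → ℝ := fun n =>
    (-Real.log (G (m n)) - Real.log (l n) - G (m n) - Real.log (G1 (m n))) / 2 with hτdef
  have hDτ : ∀ n, t₀ < m n → 0 < G (m n) → D n (τ n) = 1 / G (m n) := by
    intro n h1 h2
    have e : 2 * τ n = -Real.log (G (m n)) - Real.log (l n) - G (m n) - Real.log (G1 (m n)) := by
      simp only [hτdef]; ring
    have h3 := h.G1_pos _ h1
    have h4 := (F.sol n).l_pos
    simp only [hD]
    rw [e, Real.exp_sub, Real.exp_sub, Real.exp_sub, Real.exp_neg, Real.exp_log h2,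
      Real.exp_log h3, Real.exp_log h4, h.f_eq _ h1]
    field_simp
  -- Otherwise D ≤ 1 at the boundary, and `hUb` there gives m G'(m) ≤ c/4, which fails for large m.
  have hτ : ∀ᶠ n in atTop, τ n < 0 := by
    filter_upwards [F.eventually_good 1, F.lim_m.eventually_ge_atTop X,
      F.lim_m.eventually_gt_atTop (c / 4 / G1 X)] with n h1 h2 h3
    by_contra hcon
    rw [not_lt] at hcon
    have h4 := hUb n h2 0 le_rfl
    rw [(F.sol n).U_zero, sub_zero] at h4
    have h5 : D n 0 ≤ D n (τ n) := by
      have := (F.sol n).l_pos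
      have := h.f_nonneg _ (F.sol n).m_pos.le
      have := h1.2.1
      simp only [hD]
      gcongr
    rw [hDτ n h1.1 h1.2.2.1] at h5
    have h6 : 1 / G (m n) ≤ 1 := by
      rw [div_le_one h1.2.2.1]; exact h1.2.2.2.le
    have h7 := h.G1_pos X hX0
    rw [div_lt_iff₀ h7] at h3
    have h8 : G1 X ≤ G1 (m n) := h.strictMonoOn_G1.monotoneOn hX0 h1.1 h2
    have h9 := (F.sol n).m_pos
    nlinarith
  have hNinv : Tendsto (fun n => 1 / G (m n)) atTop (𝓝 0) := by
    simp only [one_div]; exact tendsto_inv_atTop_zero.comp F.tendsto_N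
  have hS : Tendsto (fun n => scS G G1 (m n) (U n) (τ n)) atTop (𝓝 0) := by
    refine squeeze_zero' (g := fun n => c / 4 * (1 / G (m n)) * (1 / G (m n))) ?_ ?_ ?_
    · filter_upwards [hτ, F.eventually_good 0] with n h1 h2
      exact mul_nonneg (by linarith [(F.sol n).U_le w h h1.le]) (div_pos h2.2.1 h2.2.2.1).le
    · filter_upwards [hτ, F.eventually_good 0, F.lim_m.eventually_ge_atTop X] with n h1 h2 h3
      have h4 := hUb n h3 _ h1.le
      rw [hDτ n h2.1 h2.2.2.1] at h4
      unfold scS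
      rw [mul_div_assoc', div_eq_mul_one_div]
      exact mul_le_mul_of_nonneg_right h4 (by have := h2.2.2.1; positivity)
    · simpa using (hNinv.const_mul (c / 4)).mul hNinv
  obtain ⟨hUinf, hGr, hG1r⟩ := F.scaled_limits (hτ.mono fun n hn => hn.le) hS le_rfl (by simp)
  refine Reach.of_seq hτ (tendsto_scState.2 ⟨hS, ?_, ?_, ?_⟩)
  · refine squeeze_zero' (g := fun n => c / 2 * (1 / G (m n))) ?_ ?_ ?_
    · filter_upwards [hτ, hUinf.eventually_gt_atTop t₀] with n h1 h2
      exact (F.sol n).scZ_nonneg w h h1 h2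
    · filter_upwards [hτ, F.eventually_good 0, F.lim_m.eventually_ge_atTop X,
        hUinf.eventually_gt_atTop t₀] with n h1 h2 h3 h4
      have h5 := hyb n h3 _ h1
      rw [hDτ n h2.1 h2.2.2.1] at h5
      refine le_trans ?_ h5
      exact mul_le_mul_of_nonneg_left (h.strictMonoOn_G1.monotoneOn h4 h2.1
        ((F.sol n).U_le w h h1.le)) ((F.sol n).y_nonneg w h h1)
    · simpa using hNinv.const_mul (c / 2)
  · refine squeeze_zero' (g := fun n => c * (1 / G (m n))) ?_ ?_ ?_
    · filter_upwards [hτ] with n h1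
      exact (LogSol.scB_pos w h1.le).le
    · filter_upwards [hτ, F.eventually_good 0, hUinf.eventually_gt_atTop t₀] with n h1 h2 h4
      have hU := (F.sol n).U_le w h h1.le
      unfold scB
      refine mul_le_mul (w.upper _ h1.le) ?_ (Real.exp_pos _).le hc.le
      have e : 1 / G (m n) = Real.exp (-Real.log (G (m n))) := by
        rw [Real.exp_neg, Real.exp_log h2.2.2.1, one_div]
      rw [e]
      apply Real.exp_le_exp.2
      unfold scP
      have h5 := h.strictMonoOn_G.monotoneOn h4 h2.1 hU
      have h6 := Real.log_le_log (h.G1_pos _ h4) (h.strictMonoOn_G1.monotoneOn h4 h2.1 hU)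
      simp only [hτdef]
      simp only [hτdef] at h5 h6
      linarith
    · simpa using hNinv.const_mul c
  · have hlogN : Tendsto (fun n => Real.log (G (m n)) / G (m n)) atTop (𝓝 0) := by
      have := (Real.isLittleO_log_id_atTop.tendsto_div_nhds_zero).comp F.tendsto_N
      exact this
    have hlogG1 : Tendsto (fun n => Real.log (G1 (U n (τ n)) / G1 (m n))) atTop (𝓝 0) := by
      have := hG1r.log (slope'_pos (by simp)).ne'
      simpa [slope', profile_zero] using this
    have := (hlogN.neg.add (hGr.sub_const 1)).add (hlogG1.mul hNinv)
    simp only [profile_zero, sub_self, neg_zero, add_zero, zero_mul] at this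
    refine this.congr' ?_
    filter_upwards [F.eventually_good 0, hUinf.eventually_gt_atTop t₀] with n h2 h4
    have h5 := h2.2.2.1
    rw [Real.log_div (h.G1_pos _ h4).ne' h2.2.1.ne']
    have e : scP G G1 (l n) (U n) (τ n) = -Real.log (G (m n)) + (G (U n (τ n)) - G (m n))
        + (Real.log (G1 (U n (τ n))) - Real.log (G1 (m n))) := by
      unfold scP; simp only [hτdef]; ring
    rw [e]
    field_simp

end Family

/-! ### Motion between two concentrations -/

lemma sub_le_sub_of_deriv_le {φ χ φ' χ' : ℝ → ℝ} {τ T : ℝ} (hτT : τ ≤ T)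
    (hφ : ∀ r ∈ Icc τ T, HasDerivAt φ (φ' r) r) (hχ : ∀ r ∈ Icc τ T, HasDerivAt χ (χ' r) r)
    (hle : ∀ r ∈ Icc τ T, φ' r ≤ χ' r) : φ T - φ τ ≤ χ T - χ τ := by
  have : MonotoneOn (fun r => χ r - φ r) (Icc τ T) := by
    apply monotoneOn_of_hasDerivWithinAt_nonneg (convex_Icc τ T) (f' := fun r => χ' r - φ' r)
    · exact fun r hr => ((hχ r hr).sub (hφ r hr)).continuousAt.continuousWithinAt
    · intro r hr
      rw [interior_Icc] at hr
      exact ((hχ r (Ioo_subset_Icc_self hr)).sub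
        (hφ r (Ioo_subset_Icc_self hr))).hasDerivWithinAt
    · intro r hr
      rw [interior_Icc] at hr
      linarith [hle r (Ioo_subset_Icc_self hr)]
  have := this (left_mem_Icc.2 hτT) (right_mem_Icc.2 hτT) hτT
  simp only at this
  linarith

/-- Between two concentrations the slope is nearly constant: if `c_* > 0`, then the mass between
`τ` and `t` is at most a constant times `B(τ) / c_*`. -/
lemma LogSol.y_sub_le {f G G1 G2 H H1 U y : ℝ → ℝ} {t₀ q b c C l m : ℝ}
    (s : LogSol f H l m U y)
    (w : Weight H H1 b c C) (h : Nonlin f G G1 G2 t₀ q) {τ t cs : ℝ} (hτt : τ < t) (ht : t < 0)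
    (hUt : t₀ < U t) (hUlt : U t < U τ)
    (hcs : cs = (G (U τ) - G (U t)) * y τ / (U τ - U t) - 2) (hcs0 : 0 < cs) :
    y t * G1 (U τ) ≤ scZ G1 U y τ + c / b * scB G G1 H l U τ / cs := by
  have hUτ : t₀ < U τ := hUt.trans hUlt
  set A := l * Real.exp (2 * τ) * f (U τ) with hA
  have hA0 : 0 ≤ A := by
    have := s.l_pos
    have := h.f_nonneg _ (s.U_pos τ (hτt.trans ht)).le
    positivity
  have hGG : G (U t) < G (U τ) := h.strictMonoOn_G hUt hUτ hUlt
  have hden : 0 < U τ - U t := by linarith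
  have hbound : ∀ r ∈ Icc τ t, l * Real.exp (2 * r) * H r * f (U r)
      ≤ c * A * Real.exp (-cs * (r - τ)) := by
    intro r hr
    have hr0 : r < 0 := hr.2.trans_lt ht
    have hU1 : U t ≤ U r := s.U_antitoneOn w h (mem_Iic.2 hr0.le) (mem_Iic.2 ht.le) hr.2
    have hU2 : U r ≤ U τ :=
      s.U_antitoneOn w h (mem_Iic.2 (hτt.trans ht).le) (mem_Iic.2 hr0.le) hr.1
    have hUr : t₀ < U r := hUt.trans_le hU1
    -- By convexity G is below its chord. As y increases, U falls at least at the rate y τ. Hence 2r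
    -- + G(U r) decreases at least at the rate cs, so y' decays like exp(-cs (r - τ)) and its
    -- integral is of order B(τ)/cs.
    have hchord : G (U r) ≤ G (U τ) - (U τ - U r) * ((G (U τ) - G (U t)) / (U τ - U t)) := by
      have ha : 0 ≤ (U τ - U r) / (U τ - U t) := div_nonneg (by linarith) hden.le
      have hb : 0 ≤ (U r - U t) / (U τ - U t) := div_nonneg (by linarith) hden.le
      have := h.convexOn_G.2 (mem_Ioi.2 hUt) (mem_Ioi.2 hUτ) ha hb (by field_simp; ring)
      simp only [smul_eq_mul] at this
      have e : (U τ - U r) / (U τ - U t) * U t + (U r - U t) / (U τ - U t) * U τ = U r := by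
        field_simp; ring
      rw [e] at this
      refine this.trans (le_of_eq ?_)
      field_simp; ring
    have hdrop : y τ * (r - τ) ≤ U τ - U r := by
      have := sub_le_sub_of_deriv_le (φ := U) (χ := fun r => -(y τ * r)) (φ' := fun r => -y r)
        (χ' := fun _ => -(y τ * 1)) hr.1
        (fun x hx => s.hasDerivAt_U x (hx.2.trans_lt hr0))
        (fun x _ => ((hasDerivAt_id x).const_mul _).neg)
        (fun x hx => by
          have := s.y_monotoneOn w h (mem_Iio.2 (hτt.trans ht))
            (mem_Iio.2 (hx.2.trans_lt hr0)) hx.1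
          linarith)
      linarith
    have hslope : 0 ≤ (G (U τ) - G (U t)) / (U τ - U t) := div_nonneg (by linarith) hden.le
    have hG : 2 * r + G (U r) ≤ 2 * τ + G (U τ) + -cs * (r - τ) := by
      have h1 := mul_le_mul_of_nonneg_right hdrop hslope
      have e : y τ * (r - τ) * ((G (U τ) - G (U t)) / (U τ - U t)) = (cs + 2) * (r - τ) := by
        rw [hcs]; ring
      rw [e] at h1
      linarith
    have hl := s.l_pos
    have hH := w.upper r hr0.le
    have hH0 := w.pos hr0.le
    have e1 : l * Real.exp (2 * r) * H r * f (U r)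
        = l * H r * Real.exp (2 * r + G (U r)) := by
      rw [h.f_eq _ hUr, Real.exp_add]; ring
    have e2 : c * A * Real.exp (-cs * (r - τ))
        = l * c * Real.exp (2 * τ + G (U τ) + -cs * (r - τ)) := by
      rw [hA, h.f_eq _ hUτ, Real.exp_add, Real.exp_add]; ring
    have hc := w.c_pos
    rw [e1, e2]
    gcongr
  have hy := sub_le_sub_of_deriv_le (φ := y)
    (χ := fun r => -(c * A / cs * Real.exp (-cs * (r - τ))))
    (χ' := fun r => c * A * Real.exp (-cs * (r - τ))) hτt.le
    (fun x hx => s.hasDerivAt_y x (hx.2.trans_lt ht))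
    (fun x _ => by
      refine ((((((hasDerivAt_id x).sub_const τ).const_mul (-cs)).exp).const_mul
        (c * A / cs)).neg).congr_deriv ?_
      simp only [id]; field_simp)
    hbound
  have h1 : y t ≤ y τ + c * A / cs := by
    have h2 : 0 ≤ c * A / cs * Real.exp (-cs * (t - τ)) := by
      have := w.c_pos; positivity
    simp only [sub_self, mul_zero, Real.exp_zero, mul_one] at hy
    linarith
  have hg := h.G1_pos _ hUτ
  have h2 : A * G1 (U τ) ≤ scB G G1 H l U τ / b := by
    rw [s.scB_eq h hUτ, le_div_iff₀ w.b_pos]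
    have h3 := w.lower τ (hτt.trans ht).le
    have : A * G1 (U τ) * b ≤ A * G1 (U τ) * H τ := by gcongr
    calc A * G1 (U τ) * b ≤ A * G1 (U τ) * H τ := this
      _ = _ := by rw [hA]; ring
  calc y t * G1 (U τ) ≤ (y τ + c * A / cs) * G1 (U τ) := by gcongr
    _ = scZ G1 U y τ + c / cs * (A * G1 (U τ)) := by unfold scZ; ring
    _ ≤ scZ G1 U y τ + c / cs * (scB G G1 H l U τ / b) := by
        have := w.c_pos; gcongr
    _ = _ := by ring

namespace Family
variable {f G G1 G2 H H1 : ℝ → ℝ} {t₀ q b c C : ℝ} {l m : ℕ → ℝ} {U y : ℕ → ℝ → ℝ}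

/-- The motion between two concentrations. -/
lemma reach_travel (F : Family f G G1 G2 H H1 t₀ q b c C l m U y) {σ x a : ℝ} (ha : 0 < a)
    (hσ0 : 0 ≤ σ) (hσx : σ < x) (hx : (1 - 1 / q) * x < 1)
    (hneg : 2 * slope' (1 - 1 / q) σ / (2 + a) * (x - σ) + profile (1 - 1 / q) x
      - profile (1 - 1 / q) σ < 0)
    (hR : Reach (scState G G1 H l m U y) (σ, 2 + a, 0, 0)) :
    Reach (scState G G1 H l m U y) (x, (2 + a) / slope' (1 - 1 / q) σ * slope' (1 - 1 / q) x, 0,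
      2 * slope' (1 - 1 / q) σ / (2 + a) * (x - σ) + profile (1 - 1 / q) x
        - profile (1 - 1 / q) σ) := by
  have h := F.nonlin
  have w := F.weight
  have hκ0 := h.kappa_nonneg
  set κ := 1 - 1 / q with hκ
  have hσ : κ * σ < 1 := by nlinarith
  obtain ⟨τ, hτ, hlim⟩ := hR.exists_seq
  obtain ⟨hS, hZ, hB, hP⟩ := tendsto_scState.1 hlim
  obtain ⟨hUτ, hGτ, hG1τ⟩ := F.scaled_limits (Eventually.of_forall fun n => (hτ n).le) hS hσ0 hσ
  have hex : ∀ᶠ n in atTop, ∃ t, τ n < t ∧ t < 0 ∧ scS G G1 (m n) (U n) t = x := by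
    filter_upwards [hS.eventually_lt_const hσx, F.eventually_scS_zero hx] with n h1 h2
    exact F.exists_time_scS (hτ n).le h1 h2
  obtain ⟨t, ht⟩ := exists_seq_of_eventually hex
  have hSt : Tendsto (fun n => scS G G1 (m n) (U n) (t n)) atTop (𝓝 x) :=
    tendsto_const_nhds.congr' (ht.mono fun n hn => hn.2.2.symm)
  obtain ⟨hUt, hGt, hG1t⟩ := F.scaled_limits (ht.mono fun n hn => hn.2.1.le) hSt
    (hσ0.trans hσx.le) hx
  have hslσ := slope'_pos hσ
  set Y := (2 + a) / slope' κ σ with hY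
  have hYpos : 0 < Y := by positivity
  -- the slope in units of `G'(m)`
  have hYτ : Tendsto (fun n => y n (τ n) * G1 (m n)) atTop (𝓝 Y) := by
    refine (hZ.div hG1τ hslσ.ne').congr' ?_
    filter_upwards [hUτ.eventually_gt_atTop t₀, F.eventually_good 0] with n h1 h2
    have := h.G1_pos _ h1
    have := h2.2.1
    simp only [scZ, Pi.div_apply]; field_simp
  set cs : ℕ → ℝ := fun n => (G (U n (τ n)) - G (U n (t n))) * y n (τ n)
    / (U n (τ n) - U n (t n)) - 2 with hcsdef
  have hD : Tendsto (fun n => (U n (τ n) - U n (t n)) * (G1 (m n) / G (m n))) atTop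
      (𝓝 (x - σ)) := by
    refine (hSt.sub hS).congr fun n => ?_
    unfold scS; ring
  have hUlt : ∀ᶠ n in atTop, U n (t n) < U n (τ n) := by
    filter_upwards [hD.eventually_const_lt (show 0 < x - σ by linarith), F.eventually_good 0]
      with n h1 h2
    have := pos_of_mul_pos_left h1 (div_pos h2.2.1 h2.2.2.1).le
    linarith
  have hcs : Tendsto cs atTop (𝓝 ((profile κ σ - profile κ x) * Y / (x - σ) - 2)) := by
    refine ((((hGτ.sub hGt).mul hYτ).div hD (by linarith)).sub_const 2).congr' ?_
    filter_upwards [F.eventually_good 0, hUlt] with n h2 h3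
    have := h2.2.1
    have := h2.2.2.1
    have : U n (τ n) - U n (t n) ≠ 0 := by linarith
    simp only [hcsdef, Pi.div_apply]; field_simp
  -- This is the hypothesis `hneg`, that the chord function is still negative at x, multiplied by
  -- -Y/(x - σ).
  have hcspos : 0 < (profile κ σ - profile κ x) * Y / (x - σ) - 2 := by
    have e : 2 * slope' κ σ / (2 + a) = 2 / Y := by rw [hY]; field_simp
    rw [e] at hneg
    have h1 : 2 / Y * (x - σ) < profile κ σ - profile κ x := by linarith
    rw [div_mul_eq_mul_div, div_lt_iff₀ hYpos] at h1
    have : 2 < (profile κ σ - profile κ x) * Y / (x - σ) := by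
      rw [lt_div_iff₀ (by linarith)]; exact h1
    linarith
  have hyt : Tendsto (fun n => y n (t n) * G1 (U n (τ n))) atTop (𝓝 (2 + a)) := by
    refine tendsto_of_tendsto_of_tendsto_of_le_of_le' hZ
      (h := fun n => scZ G1 (U n) (y n) (τ n)
        + c / b * scB G G1 H (l n) (U n) (τ n) / cs n) ?_ ?_ ?_
    · have := hZ.add ((hB.const_mul (c / b)).div hcs hcspos.ne')
      simpa using this
    · filter_upwards [hUτ.eventually_gt_atTop t₀, ht] with n h1 h2
      exact mul_le_mul_of_nonneg_right ((F.sol n).y_monotoneOn w h (hτ n) h2.2.1 h2.1.le)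
        (h.G1_pos _ h1).le
    · filter_upwards [hUt.eventually_gt_atTop t₀, ht, hUlt, hcs.eventually_const_lt hcspos]
        with n h1 h2 h3 h4
      exact (F.sol n).y_sub_le w h h2.1 h2.2.1 h1 h3 rfl h4
  have hYt : Tendsto (fun n => y n (t n) * G1 (m n)) atTop (𝓝 Y) := by
    refine (hyt.div hG1τ hslσ.ne').congr' ?_
    filter_upwards [hUτ.eventually_gt_atTop t₀, F.eventually_good 0] with n h1 h2
    have := h.G1_pos _ h1
    have := h2.2.1
    simp only [Pi.div_apply]; field_simp
  have hZt : Tendsto (fun n => scZ G1 (U n) (y n) (t n)) atTop (𝓝 (Y * slope' κ x)) := by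
    refine (hYt.mul hG1t).congr' ?_
    filter_upwards [F.eventually_good 0] with n h2
    have := h2.2.1
    simp only [scZ]; field_simp
  -- The fall of U takes place at a speed between y τ and y t, and both have the limit Y in units of
  -- 1/G'(m).
  have htime : Tendsto (fun n => (t n - τ n) / G (m n)) atTop (𝓝 ((x - σ) / Y)) := by
    refine tendsto_of_tendsto_of_tendsto_of_le_of_le' (hD.div hYt hYpos.ne')
      (hD.div hYτ hYpos.ne') ?_ ?_
    · filter_upwards [F.eventually_good 0, ht, hYt.eventually_const_lt hYpos] with n h1 h2 h3
      simp only [Pi.div_apply]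
      rw [div_le_iff₀ h3, mul_div_assoc', div_mul_eq_mul_div]
      refine div_le_div_of_nonneg_right ?_ h1.2.2.1.le
      have := sub_le_sub_of_deriv_le (φ := fun r => -U n r) (φ' := fun r => - -y n r)
        (χ := fun r => y n (t n) * r) (χ' := fun r => y n (t n) * 1) h2.1.le
        (fun r hr => ((F.sol n).hasDerivAt_U r (hr.2.trans_lt h2.2.1)).neg)
        (fun r _ => (hasDerivAt_id r).const_mul _)
        (fun r hr => by
          have := (F.sol n).y_monotoneOn w h (mem_Iio.2 (hr.2.trans_lt h2.2.1)) h2.2.1 hr.2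
          linarith)
      have h5 := h1.2.1
      nlinarith
    · filter_upwards [F.eventually_good 0, ht, hYτ.eventually_const_lt hYpos] with n h1 h2 h3
      simp only [Pi.div_apply]
      rw [le_div_iff₀ h3, mul_div_assoc', div_mul_eq_mul_div]
      refine div_le_div_of_nonneg_right ?_ h1.2.2.1.le
      have := sub_le_sub_of_deriv_le (χ := fun r => -U n r) (χ' := fun r => - -y n r)
        (φ := fun r => y n (τ n) * r) (φ' := fun r => y n (τ n) * 1) h2.1.le
        (fun r _ => (hasDerivAt_id r).const_mul _)
        (fun r hr => ((F.sol n).hasDerivAt_U r (hr.2.trans_lt h2.2.1)).neg)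
        (fun r hr => by
          have := (F.sol n).y_monotoneOn w h (hτ n) (mem_Iio.2 (hr.2.trans_lt h2.2.1)) hr.1
          linarith)
      have h5 := h1.2.1
      nlinarith
  have hPt : Tendsto (fun n => scP G G1 (l n) (U n) (t n) / G (m n)) atTop
      (𝓝 (2 * slope' κ σ / (2 + a) * (x - σ) + profile κ x - profile κ σ)) := by
    have hlog : ∀ {z : ℕ → ℝ} {v : ℝ}, 0 < v → Tendsto z atTop (𝓝 v) →
        Tendsto (fun n => Real.log (z n) / G (m n)) atTop (𝓝 0) := fun hv hz =>
      (hz.log hv.ne').div_atTop F.tendsto_N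
    have := (((hP.add (htime.const_mul 2)).add (hGt.sub hGτ)).add
      (hlog (slope'_pos hx) hG1t)).sub (hlog hslσ hG1τ)
    have e : 0 + 2 * ((x - σ) / Y) + (profile κ x - profile κ σ) + 0 - 0
        = 2 * slope' κ σ / (2 + a) * (x - σ) + profile κ x - profile κ σ := by
      rw [hY]; field_simp; ring
    rw [e] at this
    refine this.congr' ?_
    filter_upwards [F.eventually_good 0, hUt.eventually_gt_atTop t₀,
      hUτ.eventually_gt_atTop t₀] with n h1 h2 h3
    rw [Real.log_div (h.G1_pos _ h2).ne' h1.2.1.ne', Real.log_div (h.G1_pos _ h3).ne' h1.2.1.ne']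
    have := h1.2.2.1
    unfold scP
    field_simp
    ring
  have hBt : Tendsto (fun n => scB G G1 H (l n) (U n) (t n)) atTop (𝓝 0) := by
    have h1 : Tendsto (fun n => scP G G1 (l n) (U n) (t n)) atTop atBot := by
      refine (hPt.neg_mul_atTop hneg F.tendsto_N).congr' ?_
      filter_upwards [F.eventually_good 0] with n h1
      have := h1.2.2.1
      field_simp
    refine squeeze_zero' (g := fun n => c * Real.exp (scP G G1 (l n) (U n) (t n))) ?_ ?_ ?_
    · filter_upwards [ht] with n h1
      exact (LogSol.scB_pos w h1.2.1.le).le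
    · filter_upwards [ht] with n h1
      exact mul_le_mul_of_nonneg_right (w.upper _ h1.2.1.le) (Real.exp_pos _).le
    · simpa using (Real.tendsto_exp_atBot.comp h1).const_mul c
  exact Reach.of_seq (ht.mono fun n hn => hn.2.1) (tendsto_scState.2 ⟨hSt, hZt, hBt, hPt⟩)

end Family
-- Conservation of energy across a concentration
namespace Family
variable {f G G1 G2 H H1 : ℝ → ℝ} {t₀ q b c C : ℝ} {l m : ℕ → ℝ} {U y : ℕ → ℝ → ℝ}

set_option maxHeartbeats 2000000 in
/-- A concentration: from slope `2 - a` the solution passes through every slope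
`z ∈ (2 - a, 2 + a)` at the same scaled height, and the energy `B + (Z - 2)² / 2` is conserved. -/
lemma reach_bubble (F : Family f G G1 G2 H H1 t₀ q b c C l m U y) {σ a z : ℝ} (ha : 0 < a)
    (ha2 : a ≤ 2) (hσ0 : 0 ≤ σ) (hσ : (1 - 1 / q) * σ < 1) (hz : z ∈ Ioo (2 - a) (2 + a))
    (hR : Reach (scState G G1 H l m U y) (σ, 2 - a, 0, 0)) :
    Reach (scState G G1 H l m U y) (σ, z, (a ^ 2 - (z - 2) ^ 2) / 2, 0) := by
  have h := F.nonlin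
  have w := F.weight
  have hκ0 := h.kappa_nonneg
  obtain ⟨η, hη, hση⟩ : ∃ η > 0, (1 - 1 / q) * (σ + η) < 1 := by
    have : ∀ᶠ x in 𝓝[>] σ, (1 - 1 / q) * x < 1 :=
      ((continuous_const.mul continuous_id).continuousAt.eventually_lt
        continuousAt_const hσ).filter_mono nhdsWithin_le_nhds
    obtain ⟨x, hx⟩ := (this.and self_mem_nhdsWithin).exists
    have hx2 : σ < x := hx.2
    exact ⟨x - σ, by linarith, by rw [add_sub_cancel]; exact hx.1⟩
  obtain ⟨τ, hτ, hlim⟩ := hR.exists_seq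
  obtain ⟨hS, hZ, hB, hP⟩ := tendsto_scState.1 hlim
  obtain ⟨hUτ, hGτ, hG1τ⟩ := F.scaled_limits (Eventually.of_forall fun n => (hτ n).le) hS hσ0 hσ
  -- the constants of the window
  set μ := max ((a / 2) ^ 2) ((z - 2) ^ 2) with hμ
  set gap := a ^ 2 - μ with hgap
  have hgap0 : 0 < gap := by
    have : μ < a ^ 2 := max_lt (by nlinarith) (by nlinarith [hz.1, hz.2])
    linarith
  set δ := gap / 4 with hδ
  set Bm := a ^ 2 / 2 + δ with hBm
  have hBm0 : 0 < Bm := by positivity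
  have hz0 : 0 < z := by linarith [hz.1]
  -- Where Z > 2 - a/2, the bound on E gives B ≥ gap/4, hence KB ≥ z + 1. This outweighs the
  -- possibly negative term 2 - Z in P'.
  set K := 4 * (z + 1) / gap with hK
  have hK0 : 0 < K := by positivity
  set v0 := min (a / 4) 1 with hv0
  have hv0pos : 0 < v0 := by positivity
  set Z : ℕ → ℝ → ℝ := fun n => scZ G1 (U n) (y n) with hZdef
  set B : ℕ → ℝ → ℝ := fun n => scB G G1 H (l n) (U n) with hBdef
  set S : ℕ → ℝ → ℝ := fun n => scS G G1 (m n) (U n) with hSdef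
  set E : ℕ → ℝ → ℝ := fun n t => B n t + (Z n t - 2) ^ 2 / 2 with hE
  -- the end of the range of heights
  have hex : ∀ᶠ n in atTop, ∃ t, τ n < t ∧ t < 0 ∧ S n t = σ + η := by
    filter_upwards [hS.eventually_lt_const (show σ < σ + η by linarith),
      F.eventually_scS_zero hση] with n h1 h2
    exact F.exists_time_scS (hτ n).le h1 h2
  obtain ⟨te, hte⟩ := exists_seq_of_eventually hex
  have hSte : Tendsto (fun n => S n (te n)) atTop (𝓝 (σ + η)) :=
    tendsto_const_nhds.congr' (hte.mono fun n hn => hn.2.2.symm)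
  obtain ⟨hUe, hGe, hG1e⟩ := F.scaled_limits (hte.mono fun n hn => hn.2.1.le) hSte
    (by linarith) hση
  have hsl := slope'_pos hση
  have hpr := profile_pos hση
  -- bounds on the whole range of heights
  have hUge : ∀ᶠ n in atTop, ∀ r ∈ Icc (τ n) (te n), U n (te n) ≤ U n r ∧ r < 0 := by
    filter_upwards [hte] with n h1 r hr
    have hr0 := hr.2.trans_lt h1.2.1
    exact ⟨(F.sol n).U_antitoneOn w h (mem_Iic.2 hr0.le) (mem_Iic.2 h1.2.1.le) hr.2, hr0⟩
  have hUt₀ : ∀ᶠ n in atTop, ∀ r ∈ Icc (τ n) (te n), t₀ < U n r ∧ r < 0 := by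
    filter_upwards [hUge, hUe.eventually_gt_atTop t₀] with n h1 h2 r hr
    exact ⟨h2.trans_le (h1 r hr).1, (h1 r hr).2⟩
  -- An upper bound for ε down to the height U(te), since G G''/G'² → 1/q < 2 and G(U) decreases
  -- along the solution. It is of order 1/G(m), so its integral over a window of length o(G(m))
  -- vanishes in the limit.
  set D : ℕ → ℝ := fun n => 2 / G (U n (te n)) with hD
  have hDlim : Tendsto D atTop (𝓝 0) :=
    tendsto_const_nhds.div_atTop (h.tendsto_G.comp hUe)
  have hDN : Tendsto (fun n => D n * G (m n)) atTop (𝓝 (2 / profile (1 - 1 / q) (σ + η))) := by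
    refine (tendsto_const_nhds.div hGe hpr.ne').congr' ?_
    filter_upwards [F.eventually_good 0, (h.tendsto_G.comp hUe).eventually_gt_atTop 0]
      with n h1 h2
    have := h1.2.2.1
    simp only [Function.comp] at h2
    simp only [Pi.div_apply, hD]; field_simp
  have hεD : ∀ᶠ n in atTop, ∀ r ∈ Icc (τ n) (te n),
      0 ≤ G2 (U n r) / G1 (U n r) ^ 2 ∧ G2 (U n r) / G1 (U n r) ^ 2 ≤ D n := by
    have h1q : 1 / q < 2 := by linarith [h.kappa_lt_half, h.kappa_nonneg]
    obtain ⟨X, hX⟩ := eventually_atTop.1 ((h.tendsto_GG2.eventually_lt_const h1q).and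
      (h.tendsto_G.eventually_gt_atTop 0))
    filter_upwards [hUge, hUt₀, hUe.eventually_ge_atTop X, hte] with n h1 h2 h3 h4 r hr
    have h5 := hX _ (h3.trans (h1 r hr).1)
    have h6 := hX _ h3
    have h7 := h.G1_pos _ (h2 r hr).1
    have h8 := h.G2_pos _ (h2 r hr).1
    refine ⟨by positivity, ?_⟩
    have h9 : G (U n (te n)) ≤ G (U n r) := h.strictMonoOn_G.monotoneOn
      (h2 (te n) (right_mem_Icc.2 h4.1.le)).1 (h2 r hr).1 (h1 r hr).1
    have h10 : G2 (U n r) / G1 (U n r) ^ 2 * G (U n r) ≤ 2 := by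
      refine le_trans (le_of_eq ?_) h5.1.le
      ring
    simp only [hD]
    rw [le_div_iff₀ h6.2]
    refine le_trans ?_ h10
    exact mul_le_mul_of_nonneg_left h9 (by positivity)
  -- the stopping time
  set φ : ℕ → ℝ → ℝ := fun n t => max (max (Z n t - z) (|E n t - a ^ 2 / 2| - δ))
    (S n t - (σ + η)) with hφ
  have hElim : Tendsto (fun n => E n (τ n)) atTop (𝓝 (a ^ 2 / 2)) := by
    have := hB.add (((hZ.sub_const 2).pow 2).div_const 2)
    rw [show (0 : ℝ) + (2 - a - 2) ^ 2 / 2 = a ^ 2 / 2 by ring] at this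
    exact this
  have hφτ : ∀ᶠ n in atTop, φ n (τ n) < 0 := by
    have h1 : Tendsto (fun n => |E n (τ n) - a ^ 2 / 2|) atTop (𝓝 0) := by
      have := (hElim.sub_const (a ^ 2 / 2)).abs
      simpa using this
    filter_upwards [hZ.eventually_lt_const hz.1, h1.eventually_lt_const (show 0 < δ by positivity),
      hS.eventually_lt_const (show σ < σ + η by linarith)] with n h2 h3 h4
    exact max_lt (max_lt (sub_neg.2 h2) (sub_neg.2 h3)) (sub_neg.2 h4)
  have hcontZ : ∀ᶠ n in atTop, ContinuousOn (Z n) (Icc (τ n) (te n)) := by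
    filter_upwards [hUt₀] with n h1 r hr
    exact ((F.sol n).hasDerivAt_scZ h (h1 r hr).2 (h1 r hr).1).continuousAt.continuousWithinAt
  have hcontB : ∀ᶠ n in atTop, ContinuousOn (B n) (Icc (τ n) (te n)) := by
    filter_upwards [hUt₀] with n h1 r hr
    exact ((F.sol n).hasDerivAt_scB h w (h1 r hr).2 (h1 r hr).1).continuousAt.continuousWithinAt
  have h_exit : ∀ᶠ n in atTop, ∃ T, T ∈ Ioc (τ n) (te n) ∧ φ n T = 0 ∧
      ∀ t ∈ Icc (τ n) T, φ n t ≤ 0 := by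
    filter_upwards [hφτ, hcontZ, hcontB, hte] with n h1 h2 h3 h4
    have hSc : ContinuousOn (S n) (Icc (τ n) (te n)) :=
      (F.scS_continuousOn n).mono fun r hr => hr.2.trans h4.2.1.le
    have hφc : ContinuousOn (φ n) (Icc (τ n) (te n)) := by
      simp only [hφ, hE]
      fun_prop
    have hφe : 0 ≤ φ n (te n) := by
      simp only [hφ]
      refine le_max_of_le_right ?_
      rw [h4.2.2]; simp
    obtain ⟨T, hT, hT0, hTle, -⟩ := exists_first_zero h4.1.le hφc h1 hφe
    exact ⟨T, hT, hT0, hTle⟩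
  obtain ⟨T, hT⟩ := exists_seq_of_eventually h_exit
  have hT0 : ∀ᶠ n in atTop, T n < 0 := by
    filter_upwards [hT, hte] with n h1 h2 using h1.1.2.trans_lt h2.2.1
  -- bounds in the window
  have hwin : ∀ᶠ n in atTop, ∀ r ∈ Icc (τ n) (T n), 0 ≤ Z n r ∧ Z n r ≤ z ∧ 0 < B n r ∧
      |E n r - a ^ 2 / 2| ≤ δ ∧ B n r ≤ Bm := by
    filter_upwards [hT, hUt₀] with n h1 h2 r hr
    have h3 := h1.2.2 r hr
    have h4 := h2 r ⟨hr.1, hr.2.trans h1.1.2⟩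
    simp only [hφ, max_le_iff] at h3
    have h5 : |E n r - a ^ 2 / 2| ≤ δ := by linarith [h3.1.2]
    refine ⟨(F.sol n).scZ_nonneg w h h4.2 h4.1, by linarith [h3.1.1],
      LogSol.scB_pos w h4.2.le, h5, ?_⟩
    have h6 := (abs_le.1 h5).2
    simp only [hE] at h6
    have := sq_nonneg (Z n r - 2)
    simp only [hBm]
    linarith
  -- the length of the window
  have hlen : Tendsto (fun n => (T n - τ n) / G (m n)) atTop (𝓝 0) := by
    have hup : ∀ᶠ n in atTop, v0 * (T n - τ n) ≤
        Real.log Bm - Real.log b + K * z - scP G G1 (l n) (U n) (τ n) := by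
      have hsmall : ∀ᶠ n in atTop, D n * (z + K * z ^ 2) ≤ v0 := by
        have := hDlim.mul_const (z + K * z ^ 2)
        rw [zero_mul] at this
        filter_upwards [this.eventually_lt_const hv0pos] with n hn using hn.le
      filter_upwards [hwin, hUt₀, hεD, hsmall, hT, hT0] with n h1 h2 h3 h4 h5 h6
      have hsub : ∀ r ∈ Icc (τ n) (T n), r ∈ Icc (τ n) (te n) :=
        fun r hr => ⟨hr.1, hr.2.trans h5.1.2⟩
      -- In the window P + KZ grows at least at the rate v0. If Z ≤ 2 - a/2 the growth comes from P'
      -- ≈ 2 - Z, otherwise from KZ' ≈ KB. As P + KZ is bounded above at T and P(τ) = o(G(m)), the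
      -- window has length o(G(m)).
      have key := sub_le_sub_of_deriv_le (φ := fun r => v0 * r) (φ' := fun _ => v0 * 1)
        (χ := fun r => scP G G1 (l n) (U n) r + K * Z n r) h5.1.1.le
        (fun r _ => (hasDerivAt_id r).const_mul v0)
        (fun r hr => ((F.sol n).hasDerivAt_scP h (h2 r (hsub r hr)).2 (h2 r (hsub r hr)).1).add
          (((F.sol n).hasDerivAt_scZ h (h2 r (hsub r hr)).2 (h2 r (hsub r hr)).1).const_mul K))
        (fun r hr => by
          obtain ⟨a1, a2, a3, a4, a5⟩ := h1 r hr
          obtain ⟨e1, e2⟩ := h3 r (hsub r hr)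
          change v0 * 1 ≤ 2 - Z n r - _ * Z n r + K * (B n r - _ * Z n r ^ 2)
          set ε := G2 (U n r) / G1 (U n r) ^ 2
          have b1 : ε * (Z n r + K * Z n r ^ 2) ≤ v0 := by
            refine le_trans ?_ h4
            gcongr
            exact e1.trans e2
          have v1 : v0 ≤ a / 4 := min_le_left _ _
          have v2 : v0 ≤ 1 := min_le_right _ _
          rcases le_or_gt (Z n r) (2 - a / 2) with hc | hc
          · have : 0 ≤ K * B n r := by positivity
            linarith
          · have b2 : gap / 4 ≤ B n r := by
              have b3 := (abs_le.1 a4).1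
              have b4 : (Z n r - 2) ^ 2 ≤ μ := by
                rcases le_or_gt (Z n r) 2 with hd | hd
                · refine le_trans ?_ (le_max_left _ _)
                  nlinarith
                · refine le_trans ?_ (le_max_right _ _)
                  nlinarith
              simp only [hE] at b3
              simp only [hδ] at b3
              have : gap = a ^ 2 - μ := rfl
              linarith
            have b5 : z + 1 ≤ K * B n r := by
              have : K * (gap / 4) = z + 1 := by rw [hK]; field_simp
              rw [← this]; gcongr
            linarith)
      have e1 : scP G G1 (l n) (U n) (T n) ≤ Real.log Bm - Real.log b := by
        rw [LogSol.scP_eq_log w h6.le]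
        obtain ⟨a1, a2, a3, a4, a5⟩ := h1 (T n) (right_mem_Icc.2 h5.1.1.le)
        have := Real.log_le_log a3 a5
        have := Real.log_le_log w.b_pos (w.lower _ h6.le)
        simp only [hBdef] at *
        linarith
      have e2 := (h1 (T n) (right_mem_Icc.2 h5.1.1.le)).2.1
      have e3 := (h1 (τ n) (left_mem_Icc.2 h5.1.1.le)).1
      have e4 := mul_le_mul_of_nonneg_left e2 hK0.le
      have e5 := mul_nonneg hK0.le e3
      linarith
    have hlimup : Tendsto (fun n => ((Real.log Bm - Real.log b + K * z) / G (m n)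
        - scP G G1 (l n) (U n) (τ n) / G (m n)) / v0) atTop (𝓝 0) := by
      have := ((tendsto_const_nhds (x := Real.log Bm - Real.log b + K * z)).div_atTop
        F.tendsto_N |>.sub hP).div_const v0
      simpa using this
    refine squeeze_zero' ?_ ?_ hlimup
    · filter_upwards [hT, F.eventually_good 0] with n h1 h2
      exact div_nonneg (by linarith [h1.1.1]) h2.2.2.1.le
    · filter_upwards [hup, F.eventually_good 0] with n h1 h2
      rw [← sub_div, le_div_iff₀ hv0pos, div_mul_eq_mul_div]
      exact div_le_div_of_nonneg_right (by linarith) h2.2.2.1.le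
  -- the scaled height does not change
  have hST : Tendsto (fun n => S n (T n)) atTop (𝓝 σ) := by
    have hR : Tendsto (fun n => G1 (m n) / G1 (U n (te n))) atTop
        (𝓝 (1 / slope' (1 - 1 / q) (σ + η))) := by
      rw [one_div]
      exact (hG1e.inv₀ hsl.ne').congr fun n => by simp
    -- In the window y G'(U) ≤ z and G'(U) is comparable with G'(m), so the depth moves with speed
    -- O(1/G(m)) during a time o(G(m)).
    have hdiff : Tendsto (fun n => S n (T n) - S n (τ n)) atTop (𝓝 0) := by
      refine squeeze_zero' (g := fun n => z * (G1 (m n) / G1 (U n (te n)))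
        * ((T n - τ n) / G (m n))) ?_ ?_ ?_
      · filter_upwards [hT, hT0, F.eventually_good 0] with n h1 h2 h3
        have := F.scS_monotoneOn h3.2.1 h3.2.2.1 (mem_Iic.2 (hτ n).le) (mem_Iic.2 h2.le) h1.1.1.le
        simp only [hSdef]; linarith
      · filter_upwards [hT, hwin, hUt₀, hUge, F.eventually_good 0, hte] with n h1 h2 h3 h4 h5 h6
        have hsub : ∀ r ∈ Icc (τ n) (T n), r ∈ Icc (τ n) (te n) :=
          fun r hr => ⟨hr.1, hr.2.trans h1.1.2⟩
        have hge := h.G1_pos _ (h3 (te n) (right_mem_Icc.2 h6.1.le)).1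
        have := sub_le_sub_of_deriv_le (φ := S n)
          (χ := fun r => z * (G1 (m n) / G1 (U n (te n))) / G (m n) * r)
          (χ' := fun _ => z * (G1 (m n) / G1 (U n (te n))) / G (m n) * 1) h1.1.1.le
          (fun r hr => (F.sol n).hasDerivAt_scS (h3 r (hsub r hr)).2)
          (fun r _ => (hasDerivAt_id r).const_mul _)
          (fun r hr => by
            have hN := h5.2.2.1
            have hgm := h5.2.1
            have h7 : G1 (U n (te n)) ≤ G1 (U n r) := h.strictMonoOn_G1.monotoneOn
              (h3 (te n) (right_mem_Icc.2 h6.1.le)).1 (h3 r (hsub r hr)).1 (h4 r (hsub r hr)).1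
            have h8 : y n r * G1 (U n (te n)) ≤ z := by
              refine le_trans ?_ (h2 r hr).2.1
              exact mul_le_mul_of_nonneg_left h7 ((F.sol n).y_nonneg w h (h3 r (hsub r hr)).2)
            have h9 : y n r ≤ z / G1 (U n (te n)) := by rwa [le_div_iff₀ hge]
            calc y n r * (G1 (m n) / G (m n)) ≤ z / G1 (U n (te n)) * (G1 (m n) / G (m n)) := by
                  gcongr
              _ = _ := by ring)
        refine this.trans (le_of_eq ?_)
        ring
      · have := (hR.const_mul z).mul hlen
        simpa using this
    have := hdiff.add hS
    rw [zero_add] at this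
    refine this.congr fun n => ?_
    simp only [hSdef]; ring
  obtain ⟨hUT, -, -⟩ := F.scaled_limits (hT0.mono fun n hn => hn.le) hST hσ0 hσ
  -- Needed because the variation of the weight contributes to the energy an error of order exp T.
  have hTbot : Tendsto T atTop atBot := by
    rw [tendsto_atBot]
    intro M
    obtain ⟨X, hX0, hX⟩ := h.exists_time_lt w (max z Bm) (-M)
    filter_upwards [hUT.eventually_ge_atTop X, hT0, hwin, hT] with n h1 h2 h3 h4
    obtain ⟨a1, a2, a3, a4, a5⟩ := h3 (T n) (right_mem_Icc.2 h4.1.1.le)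
    have := hX _ _ _ _ (F.sol n) (T n) h2 h1 (a2.trans (le_max_left _ _))
      (a5.trans (le_max_right _ _))
    linarith
  -- the energy is conserved
  have hET : Tendsto (fun n => E n (T n)) atTop (𝓝 (a ^ 2 / 2)) := by
    set K2 := Bm * z + z ^ 2 * (z + 2) with hK2
    have hdiff : Tendsto (fun n => E n (T n) - E n (τ n)) atTop (𝓝 0) := by
      have hlim0 : Tendsto (fun n => Bm * C * Real.exp (T n)
          + D n * G (m n) * K2 * ((T n - τ n) / G (m n))) atTop (𝓝 0) := by
        have := ((Real.tendsto_exp_atBot.comp hTbot).const_mul (Bm * C)).add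
          ((hDN.mul_const K2).mul hlen)
        simpa using this
      refine squeeze_zero_norm' ?_ hlim0
      filter_upwards [hT, hwin, hUt₀, hεD, F.eventually_good 0] with n h1 h2 h3 h4 h5
      have hsub : ∀ r ∈ Icc (τ n) (T n), r ∈ Icc (τ n) (te n) :=
        fun r hr => ⟨hr.1, hr.2.trans h1.1.2⟩
      have hN := h5.2.2.1
      -- The terms B(2 - Z) from B' and (Z - 2)B from Z' cancel. What is left carries a factor H'/H
      -- or ε.
      have hEd : ∀ r ∈ Icc (τ n) (T n), HasDerivAt (E n)
          (B n r * (H1 r / H r - G2 (U n r) / G1 (U n r) ^ 2 * Z n r)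
            - G2 (U n r) / G1 (U n r) ^ 2 * Z n r ^ 2 * (Z n r - 2)) r := by
        intro r hr
        have h6 := h3 r (hsub r hr)
        refine (((F.sol n).hasDerivAt_scB h w h6.2 h6.1).add
          (((((F.sol n).hasDerivAt_scZ h h6.2 h6.1).sub_const 2).pow 2).div_const 2)).congr_deriv ?_
        simp only [hBdef, hZdef]
        push_cast
        ring
      have hχd : ∀ r ∈ Icc (τ n) (T n), HasDerivAt
          (fun r => Bm * C * Real.exp r + D n * K2 * r)
          (Bm * C * Real.exp r + D n * K2 * 1) r := fun r _ =>
        ((Real.hasDerivAt_exp r).const_mul _).add ((hasDerivAt_id r).const_mul _)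
      have hbd : ∀ r ∈ Icc (τ n) (T n),
          |B n r * (H1 r / H r - G2 (U n r) / G1 (U n r) ^ 2 * Z n r)
            - G2 (U n r) / G1 (U n r) ^ 2 * Z n r ^ 2 * (Z n r - 2)|
          ≤ Bm * C * Real.exp r + D n * K2 * 1 := by
        intro r hr
        have h6 := h3 r (hsub r hr)
        obtain ⟨a1, a2, a3, a4, a5⟩ := h2 r hr
        obtain ⟨e1, e2⟩ := h4 r (hsub r hr)
        set ε := G2 (U n r) / G1 (U n r) ^ 2
        have hρ : |H1 r / H r| ≤ C * Real.exp r := by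
          rw [abs_div, abs_of_pos (w.pos h6.2.le), div_le_iff₀ (w.pos h6.2.le)]
          exact w.deriv_le r h6.2
        have b1 : |B n r * (H1 r / H r)| ≤ Bm * (C * Real.exp r) := by
          rw [abs_mul, abs_of_pos a3]
          exact mul_le_mul a5 hρ (abs_nonneg _) hBm0.le
        have b2 : |ε * (B n r * Z n r)| ≤ D n * (Bm * z) := by
          rw [abs_of_nonneg (by positivity)]
          exact mul_le_mul e2 (mul_le_mul a5 a2 a1 hBm0.le) (by positivity) (e1.trans e2)
        have b3 : |ε * (Z n r ^ 2 * (Z n r - 2))| ≤ D n * (z ^ 2 * (z + 2)) := by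
          rw [abs_mul, abs_mul, abs_of_nonneg e1, abs_of_nonneg (sq_nonneg (Z n r))]
          have : |Z n r - 2| ≤ z + 2 := abs_le.2 ⟨by linarith, by linarith⟩
          have hz2 : Z n r ^ 2 ≤ z ^ 2 := by gcongr
          exact mul_le_mul e2 (mul_le_mul hz2 this (abs_nonneg _) (by positivity))
            (by positivity) (e1.trans e2)
        have e : B n r * (H1 r / H r - ε * Z n r) - ε * Z n r ^ 2 * (Z n r - 2)
            = B n r * (H1 r / H r) - ε * (B n r * Z n r) - ε * (Z n r ^ 2 * (Z n r - 2)) := by ring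
        rw [e]
        have t1 := abs_sub (B n r * (H1 r / H r) - ε * (B n r * Z n r))
          (ε * (Z n r ^ 2 * (Z n r - 2)))
        have t2 := abs_sub (B n r * (H1 r / H r)) (ε * (B n r * Z n r))
        simp only [hK2]
        linarith
      have u1 := sub_le_sub_of_deriv_le h1.1.1.le hEd hχd fun r hr => (abs_le.1 (hbd r hr)).2
      have u2 := sub_le_sub_of_deriv_le (φ := fun r => -(Bm * C * Real.exp r + D n * K2 * r))
        h1.1.1.le (fun r hr => (hχd r hr).neg) hEd
        fun r hr => (abs_le.1 (hbd r hr)).1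
      have e : D n * G (m n) * K2 * ((T n - τ n) / G (m n)) = D n * K2 * (T n - τ n) := by
        field_simp
      rw [e, Real.norm_eq_abs, abs_le]
      have h7 : 0 ≤ Bm * C * Real.exp (τ n) := by
        have := w.C_nonneg; positivity
      constructor
      · linarith
      · linarith
    have := hdiff.add hElim
    rw [zero_add] at this
    refine this.congr fun n => by ring
  -- hence the window ends at slope `z`
  have hZT : ∀ᶠ n in atTop, Z n (T n) = z := by
    have h1 : Tendsto (fun n => |E n (T n) - a ^ 2 / 2|) atTop (𝓝 0) := by
      have := (hET.sub_const (a ^ 2 / 2)).abs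
      simpa using this
    filter_upwards [hT, h1.eventually_lt_const (show 0 < δ by positivity),
      hST.eventually_lt_const (show σ < σ + η by linarith)] with n h2 h3 h4
    have h5 := h2.2.1
    simp only [hφ] at h5
    have h6 : ¬ (S n (T n) - (σ + η) = 0) := by intro h; linarith
    have h7 : ¬ (|E n (T n) - a ^ 2 / 2| - δ = 0) := by intro h; linarith
    rcases max_choice (max (Z n (T n) - z) (|E n (T n) - a ^ 2 / 2| - δ)) (S n (T n) - (σ + η))
      with h8 | h8
    · rw [h8] at h5
      rcases max_choice (Z n (T n) - z) (|E n (T n) - a ^ 2 / 2| - δ) with h9 | h9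
      · rw [h9] at h5; linarith
      · rw [h9] at h5; exact absurd h5 h7
    · rw [h8] at h5; exact absurd h5 h6
  have hBT : Tendsto (fun n => B n (T n)) atTop (𝓝 ((a ^ 2 - (z - 2) ^ 2) / 2)) := by
    have := hET.sub_const ((z - 2) ^ 2 / 2)
    rw [show a ^ 2 / 2 - (z - 2) ^ 2 / 2 = (a ^ 2 - (z - 2) ^ 2) / 2 by ring] at this
    refine this.congr' ?_
    filter_upwards [hZT] with n hn
    simp only [hE]; rw [hn]; ring
  have hBTpos : 0 < (a ^ 2 - (z - 2) ^ 2) / 2 := by nlinarith [hz.1, hz.2]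
  refine Reach.of_seq hT0 (tendsto_scState.2 ⟨hST, ?_, hBT, ?_⟩)
  · exact tendsto_const_nhds.congr' (hZT.mono fun n hn => hn.symm)
  · have h1 : Tendsto (fun n => Real.log (B n (T n)) / G (m n)) atTop (𝓝 0) :=
      (hBT.log hBTpos.ne').div_atTop F.tendsto_N
    have h2 : Tendsto (fun n => Real.log (H (T n)) / G (m n)) atTop (𝓝 0) := by
      have hb : Tendsto (fun n => Real.log b / G (m n)) atTop (𝓝 0) :=
        tendsto_const_nhds.div_atTop F.tendsto_N
      have hc : Tendsto (fun n => Real.log c / G (m n)) atTop (𝓝 0) :=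
        tendsto_const_nhds.div_atTop F.tendsto_N
      refine tendsto_of_tendsto_of_tendsto_of_le_of_le' hb hc ?_ ?_
      · filter_upwards [hT0, F.eventually_good 0] with n h3 h4
        exact div_le_div_of_nonneg_right (Real.log_le_log w.b_pos (w.lower _ h3.le)) h4.2.2.1.le
      · filter_upwards [hT0, F.eventually_good 0] with n h3 h4
        exact div_le_div_of_nonneg_right (Real.log_le_log (w.pos h3.le) (w.upper _ h3.le))
          h4.2.2.1.le
    have := h1.sub h2
    rw [sub_zero] at this
    refine this.congr' ?_
    filter_upwards [hT0] with n h3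
    rw [LogSol.scP_eq_log w h3.le, sub_div]

end Family

/-! ### A Lyapunov function down to a fixed height -/

/-- The dissipation of the modified energy `(Z - 2)² / 2 + B + k (Z² - β (Z - 2)) Λ`. -/
lemma dissipation_neg {q β c₀ c₁ d ω k ε Z B Λ Λm : ℝ} (hq : q ∈ Ico (1 : ℝ) 2) (hc₀ : 0 < c₀)
    (hc₁ : c₀ ≤ 1) (hβ : β = (2 - q) * c₀ ^ 2 / 8) (hcc : c₁ = (2 - q) * c₀ ^ 3 / 2)
    (hd : 0 < d) (hd1 : d ≤ c₀ / 2) (hd2 : d ≤ 2 * β) (hd3 : d ≤ c₁ / 54)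
    (hω0 : 0 ≤ ω) (hω : ω ≤ 1 / 2) (hω2 : ω ≤ d / 400)
    (hk : 0 < k) (hk1 : k ≤ d / 1680) (hk2 : k * Λm ≤ d / 5600)
    (hε : |ε - k| ≤ ω * k) (hZ : c₀ ≤ Z) (hZ5 : Z ≤ 5) (hB : 0 < B)
    (hΛ : -Λm ≤ Λ) (hBΛ : B * Λ ≤ d / 40)
    (hL : 1 ≤ (Z - 2) ^ 2 / 2 + B + k * (Z ^ 2 - β * (Z - 2)) * Λ) :
    -ε * B * Z - ε * Z ^ 2 * (Z - 2) + k * (Z ^ 2 - β * (Z - 2)) * (Z - 2 + ε * Z)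
      + k * (2 * Z - β) * (B - ε * Z ^ 2) * Λ
      + q * k ^ 2 * Z * (Z ^ 2 - β * (Z - 2)) * Λ < 0 := by
  obtain ⟨hq1, hq2⟩ := hq
  obtain ⟨e, rfl⟩ : ∃ e, ε = k * (1 + e) := ⟨ε / k - 1, by field_simp; ring⟩
  have he : |e| ≤ ω := by
    rw [show k * (1 + e) - k = e * k by ring, abs_mul, abs_of_pos hk] at hε
    exact le_of_mul_le_mul_right hε hk
  obtain ⟨he1, he2⟩ := abs_le.1 he
  have hZ0 : 0 < Z := hc₀.trans_le hZ
  have hc2 : c₀ ^ 2 ≤ c₀ := pow_le_of_le_one hc₀.le hc₁ two_ne_zero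
  have hβ0 : 0 < β := by rw [hβ]; have : 0 < 2 - q := by linarith
                         positivity
  have hβ8 : β ≤ c₀ / 8 := by
    have : (2 - q) * c₀ ^ 2 ≤ 1 * c₀ ^ 2 := by gcongr; linarith
    linarith
  have hZ2 : Z ^ 2 ≤ 25 := by
    have := pow_le_pow_left₀ hZ0.le hZ5 2
    linarith
  have h2q : 0 < 2 - q := by linarith
  obtain ⟨ℓ, hℓ⟩ : ∃ ℓ, ℓ = Z ^ 2 - β * (Z - 2) := ⟨_, rfl⟩
  rw [← hℓ] at hL ⊢
  have hℓ0 : 0 ≤ ℓ := by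
    rcases le_or_gt Z 2 with h | h
    · have : β * (Z - 2) ≤ 0 := mul_nonpos_of_nonneg_of_nonpos hβ0.le (by linarith)
      linarith [sq_nonneg Z]
    · have h1 : β * (Z - 2) ≤ 1 * (Z - 2) := mul_le_mul_of_nonneg_right (by linarith) (by linarith)
      have h2 := mul_le_mul_of_nonneg_right h.le hZ0.le
      linarith
  have hℓ27 : ℓ ≤ 27 := by
    have : β * (2 - Z) ≤ β * 2 := by gcongr; linarith
    linarith
  have hcm : 0 ≤ 2 * Z - β := by linarith
  have hcm10 : 2 * Z - β ≤ 10 := by linarith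
  obtain ⟨Q, hQ⟩ : ∃ Q, Q = q * Z * ℓ - (1 + e) * Z ^ 2 * (2 * Z - β) := ⟨_, rfl⟩
  -- Here ε = k(1 + e) with small e. The correction weighted by Z² cancels the indefinite term
  -- -εZ²(Z - 2) to leading order, and its part -β(Z - 2) produces the dissipation -β(Z - 2)². The
  -- good terms are -BZ, -β(Z - 2)² and, for positive Λ, kΛQ.
  have hX : -(k * (1 + e)) * B * Z - k * (1 + e) * Z ^ 2 * (Z - 2)
      + k * ℓ * (Z - 2 + k * (1 + e) * Z)
      + k * (2 * Z - β) * (B - k * (1 + e) * Z ^ 2) * Λ + q * k ^ 2 * Z * ℓ * Λ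
      = k * (-(1 + e) * (B * Z) - e * (Z ^ 2 * (Z - 2)) - β * (Z - 2) ^ 2
        + k * ((1 + e) * (Z * ℓ)) + (2 * Z - β) * (B * Λ) + k * Λ * Q) := by
    rw [hQ, hℓ]; ring
  rw [hX]
  have hBZ : B * c₀ ≤ B * Z := by gcongr
  have t1 : -(1 + e) * (B * Z) ≤ -(c₀ / 2) * B := by
    have := mul_le_mul_of_nonneg_right (show 1 / 2 ≤ 1 + e by linarith) (mul_pos hB hZ0).le
    linarith
  have t2 : -e * (Z ^ 2 * (Z - 2)) ≤ ω * 75 := by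
    have h1 : |Z ^ 2 * (Z - 2)| ≤ 75 := by
      rw [abs_mul, abs_of_nonneg (sq_nonneg Z)]
      have h3 : |Z - 2| ≤ 3 := abs_le.2 ⟨by linarith, by linarith⟩
      have := mul_le_mul hZ2 h3 (abs_nonneg _) (by norm_num)
      linarith
    calc -e * (Z ^ 2 * (Z - 2)) ≤ |-e * (Z ^ 2 * (Z - 2))| := le_abs_self _
      _ = |e| * |Z ^ 2 * (Z - 2)| := by rw [abs_mul, abs_neg]
      _ ≤ ω * 75 := mul_le_mul he h1 (abs_nonneg _) hω0
  have t3 : k * ((1 + e) * (Z * ℓ)) ≤ d / 8 := by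
    have h1 : (1 + e) * (Z * ℓ) ≤ 3 / 2 * (5 * 27) := by
      have : Z * ℓ ≤ 5 * 27 := mul_le_mul hZ5 hℓ27 hℓ0 (by norm_num)
      exact mul_le_mul (by linarith) this (mul_nonneg hZ0.le hℓ0) (by norm_num)
    have h2 : 0 ≤ (1 + e) * (Z * ℓ) :=
      mul_nonneg (by linarith) (mul_nonneg hZ0.le hℓ0)
    have := mul_le_mul hk1 h1 h2 (by positivity)
    linarith
  -- The leading part of Q is -(2 - q)Z³, negative because q < 2. The size of β relative to (2 -
  -- q)c₀² is chosen so that at most half of it is lost.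
  have hQneg : Q ≤ -(c₁ / 2) := by
    have e1 : Q = -(2 - q) * Z ^ 3 + β * (Z * (2 * q - (q - 1) * Z))
        - e * (Z ^ 2 * (2 * Z - β)) := by rw [hQ, hℓ]; ring
    have h1 : Z * (2 * q - (q - 1) * Z) ≤ 4 * Z := by
      have h0 : 2 * q - (q - 1) * Z ≤ 4 := by
        have := mul_nonneg (show 0 ≤ q - 1 by linarith) hZ0.le
        linarith
      have := mul_le_mul_of_nonneg_left h0 hZ0.le
      linarith
    have h2 : β * (Z * (2 * q - (q - 1) * Z)) ≤ (2 - q) * Z ^ 3 / 2 := by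
      have h3 : β * 8 ≤ (2 - q) * Z ^ 2 := by
        have : c₀ ^ 2 ≤ Z ^ 2 := by gcongr
        have := mul_le_mul_of_nonneg_left this h2q.le
        linarith
      calc β * (Z * (2 * q - (q - 1) * Z)) ≤ β * (4 * Z) := by gcongr
        _ = β * 8 * (Z / 2) := by ring
        _ ≤ (2 - q) * Z ^ 2 * (Z / 2) := by gcongr
        _ = _ := by ring
    have h4 : c₁ ≤ (2 - q) * Z ^ 3 / 2 := by
      have : c₀ ^ 3 ≤ Z ^ 3 := by gcongr
      have := mul_le_mul_of_nonneg_left this h2q.le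
      linarith
    have h5 : -(e * (Z ^ 2 * (2 * Z - β))) ≤ ω * 250 := by
      have h6 := mul_le_mul hZ2 hcm10 hcm (by norm_num)
      have h7 : 0 ≤ Z ^ 2 * (2 * Z - β) := mul_nonneg (sq_nonneg Z) hcm
      calc -(e * (Z ^ 2 * (2 * Z - β))) = -e * (Z ^ 2 * (2 * Z - β)) := by ring
        _ ≤ ω * (25 * 10) := mul_le_mul (by linarith) h6 h7 hω0
        _ = ω * 250 := by norm_num
    linarith
  -- As the modified energy is at least 1, the three good quantities cannot be small simultaneously.
  -- The upper bounds on d match their coefficients, and 27 is the bound for ℓ.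
  have hsum : d ≤ c₀ / 2 * B + β * (Z - 2) ^ 2 + c₁ / 2 * max (k * Λ) 0 := by
    have h1 : k * ℓ * Λ ≤ 27 * max (k * Λ) 0 := by
      have h2 : k * ℓ * Λ = ℓ * (k * Λ) := by ring
      rw [h2]
      calc ℓ * (k * Λ) ≤ ℓ * max (k * Λ) 0 := by gcongr; exact le_max_left _ _
        _ ≤ 27 * max (k * Λ) 0 := by gcongr
    have h3 : 0 ≤ max (k * Λ) 0 := le_max_right _ _
    have h4 : 1 ≤ (Z - 2) ^ 2 / 2 + B + 27 * max (k * Λ) 0 := by linarith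
    have h5 := mul_le_mul_of_nonneg_left h4 hd.le
    have h6 := mul_le_mul_of_nonneg_right hd2 (sq_nonneg (Z - 2))
    have h7 := mul_le_mul_of_nonneg_right hd1 hB.le
    have h8 := mul_le_mul_of_nonneg_right hd3 h3
    linarith
  apply mul_neg_of_pos_of_neg hk
  -- The sign of Λ decides which term is harmful: for Λ ≥ 0 it is (2Z - β)BΛ, controlled by the
  -- bound on BΛ, and for Λ < 0 it is kΛQ, controlled by the smallness of kΛm.
  rcases le_or_gt 0 Λ with hΛ0 | hΛ0
  · have h1 : (2 * Z - β) * (B * Λ) ≤ d / 4 := by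
      have h0 : 0 ≤ B * Λ := by positivity
      have := mul_le_mul hcm10 hBΛ h0 (by norm_num)
      linarith
    have hkΛ : 0 ≤ k * Λ := by positivity
    rw [max_eq_left hkΛ] at hsum
    have h2 := mul_le_mul_of_nonneg_left hQneg hkΛ
    linarith
  · have h1 : (2 * Z - β) * (B * Λ) ≤ 0 :=
      mul_nonpos_of_nonneg_of_nonpos hcm (mul_nonpos_of_nonneg_of_nonpos hB.le hΛ0.le)
    rw [max_eq_right (mul_nonpos_of_nonneg_of_nonpos hk.le hΛ0.le)] at hsum
    have hQl : -700 ≤ Q := by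
      have h3 : 0 ≤ q * Z * ℓ := by positivity
      have h4 : (1 + e) * Z ^ 2 * (2 * Z - β) ≤ 3 / 2 * 25 * 10 := by
        have : (1 + e) * Z ^ 2 ≤ 3 / 2 * 25 :=
          mul_le_mul (by linarith) hZ2 (sq_nonneg Z) (by norm_num)
        exact mul_le_mul this hcm10 hcm (by norm_num)
      linarith
    have h2 : k * Λ * Q ≤ d / 8 := by
      have h5 : k * (-Λ) * (-Q) ≤ k * Λm * 700 := by
        have : k * (-Λ) ≤ k * Λm := by gcongr; linarith
        have : 0 ≤ k * (-Λ) := mul_nonneg hk.le (by linarith)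
        have : 0 ≤ k * Λm := by linarith
        calc k * (-Λ) * (-Q) ≤ k * (-Λ) * 700 := by gcongr; linarith
          _ ≤ _ := by gcongr
      linarith
    linarith

lemma exists_lt_of_hasDerivAt_neg {φ : ℝ → ℝ} {a x d : ℝ} (h : HasDerivAt φ d x) (hd : d < 0)
    (ha : a < x) : ∃ t ∈ Ioo a x, φ x < φ t := by
  have h1 := (hasDerivAt_iff_tendsto_slope.1 h).eventually (gt_mem_nhds hd)
  have h2 : ∀ᶠ t in 𝓝[<] x, slope φ x t < 0 :=
    h1.filter_mono (nhdsWithin_mono x fun t (ht : t < x) => ht.ne)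
  obtain ⟨t, ht1, ht2⟩ := (h2.and (Ioo_mem_nhdsLT ha)).exists
  refine ⟨t, ht2, ?_⟩
  rw [slope_def_field] at ht1
  by_contra hcon
  have := div_nonneg_of_nonpos (by linarith : φ t - φ x ≤ 0) (by linarith [ht2.2] : t - x ≤ 0)
  linarith

section
variable {f G G1 G2 H H1 : ℝ → ℝ} {t₀ q b c C : ℝ}

lemma weight_bounds {β z : ℝ} (hβ0 : 0 ≤ β) (hβ1 : β ≤ 1 / 8) (hz0 : 0 ≤ z) (hz5 : z ≤ 5) :
    0 ≤ z ^ 2 - β * (z - 2) ∧ z ^ 2 - β * (z - 2) ≤ 27 := by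
  constructor
  · rcases le_or_gt z 2 with h1 | h1
    · nlinarith
    · nlinarith
  · nlinarith

lemma sq_le_weight {β z c : ℝ} (hβ0 : 0 ≤ β) (hβ1 : β ≤ 1 / 8) (hc0 : 0 ≤ c) (hc1 : c ≤ 1)
    (hz : c ≤ z) : c ^ 2 ≤ z ^ 2 - β * (z - 2) := by
  rcases le_or_gt z 2 with h | h
  · nlinarith
  · nlinarith

/-- The modified energy. -/
def modEnergy (G G1 H : ℝ → ℝ) (l : ℝ) (U y : ℝ → ℝ) (q β B₀ r : ℝ) : ℝ :=
  (scZ G1 U y r - 2) ^ 2 / 2 + scB G G1 H l U r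
    + 1 / (q * G (U r)) * (scZ G1 U y r ^ 2 - β * (scZ G1 U y r - 2))
      * (Real.log B₀ - scP G G1 l U r)

/-- Since G(U)' = -Z, the coefficient k = 1/(qG(U)) satisfies k' = qk²Z, and Λ' = Z - 2 + εZ. The
coefficient is k and not ε, to which it is asymptotic, because G has only two derivatives and ε need
not be differentiable. -/
lemma LogSol.hasDerivAt_modEnergy {l m : ℝ} {U y : ℝ → ℝ} (s : LogSol f H l m U y)
    (h : Nonlin f G G1 G2 t₀ q) (w : Weight H H1 b c C) (β B₀ : ℝ) {r Z B ε k Λ : ℝ} (hr : r < 0)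
    (hU : t₀ < U r) (hG : 0 < G (U r)) (hZ : Z = scZ G1 U y r) (hB : B = scB G G1 H l U r)
    (hε : ε = G2 (U r) / G1 (U r) ^ 2) (hk : k = 1 / (q * G (U r)))
    (hΛ : Λ = Real.log B₀ - scP G G1 l U r) :
    HasDerivAt (modEnergy G G1 H l U y q β B₀)
      (B * (H1 r / H r) + (-ε * B * Z - ε * Z ^ 2 * (Z - 2)
        + k * (Z ^ 2 - β * (Z - 2)) * (Z - 2 + ε * Z)
        + k * (2 * Z - β) * (B - ε * Z ^ 2) * Λ
        + q * k ^ 2 * Z * (Z ^ 2 - β * (Z - 2)) * Λ)) r := by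
  have hq := h.q_pos
  have dZ := s.hasDerivAt_scZ h hr hU
  have dB := s.hasDerivAt_scB h w hr hU
  have dΛ := (s.hasDerivAt_scP h hr hU).const_sub (Real.log B₀)
  have dk : HasDerivAt (fun x => 1 / (q * G (U x))) (q * k ^ 2 * Z) r := by
    have := ((s.hasDerivAt_G h hr hU).const_mul q).inv (by positivity)
    refine (this.congr_of_eventuallyEq ?_).congr_deriv ?_
    · exact Eventually.of_forall fun x => by simp
    · rw [hk, hZ]; field_simp
  rw [← hZ, ← hε, ← hB] at dZ
  rw [← hZ, ← hε, ← hB] at dB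
  rw [← hZ, ← hε] at dΛ
  have d1 := (((dZ.sub_const 2).pow 2).div_const 2).add dB
  have d2 := (dk.mul ((dZ.pow 2).sub ((dZ.sub_const 2).const_mul β))).mul dΛ
  refine (d1.add d2).congr_deriv ?_
  simp only [Pi.mul_apply, Pi.sub_apply, Pi.pow_apply, ← hZ, ← hk, ← hΛ]
  push_cast
  ring

set_option maxHeartbeats 1000000 in
/-- Once the energy is below that of the first concentration, the slope stays bounded from above
and from below, down to a fixed height. -/
theorem exists_uniform_bounds (h : Nonlin f G G1 G2 t₀ q) (w : Weight H H1 b c C) {L₀ b₀ : ℝ}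
    (hL₀ : L₀ < 2) (hb₀ : 0 < b₀) : ∃ M > t₀, ∃ c₀ > 0, ∃ K₀ : ℝ, 1 ≤ G M ∧
      ∀ (l m : ℝ) (U y : ℝ → ℝ), LogSol f H l m U y → ∀ τ < 0, M ≤ U τ →
        (scZ G1 U y τ - 2) ^ 2 / 2 + scB G G1 H l U τ ≤ L₀ → b₀ ≤ scB G G1 H l U τ →
        ∀ t ∈ Ico τ 0, M ≤ U t → c₀ ≤ scZ G1 U y t ∧ scZ G1 U y t ≤ 5 ∧
          scB G G1 H l U t ≤ 4 ∧ -K₀ * G (U t) ≤ scP G G1 l U t := by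
  have hq := h.q_mem
  have hq0 := h.q_pos
  have h2q : 0 < 2 - q := by linarith [hq.2]
  have hb := w.b_pos
  have hc := w.c_pos
  -- A barrier strictly between the initial energy and 2, the energy of the rest point Z = 0, B = 0.
  -- The value at least 1 is what `dissipation_neg` requires on the barrier.
  set L₁ := max ((L₀ + 2) / 2) 1 with hL₁
  have hL₁2 : L₁ < 2 := max_lt (by linarith) (by norm_num)
  have hL₁1 : 1 ≤ L₁ := le_max_right _ _
  have hL₀₁ : L₀ < L₁ := lt_of_lt_of_le (by linarith) (le_max_left _ _)
  set d₀ := 2 - L₁ with hd₀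
  have hd₀0 : 0 < d₀ := by linarith
  have hd₀1 : d₀ ≤ 1 := by linarith
  -- Below the barrier, up to two errors of d₀/4, one has (Z - 2)² ≤ 4 - d₀, and this forces Z ≥
  -- d₀/8.
  obtain ⟨c₀, hc₀⟩ : ∃ c₀, c₀ = d₀ / 8 := ⟨_, rfl⟩
  have hc₀0 : 0 < c₀ := by rw [hc₀]; positivity
  obtain ⟨β, hβ⟩ : ∃ β, β = (2 - q) * c₀ ^ 2 / 8 := ⟨_, rfl⟩
  obtain ⟨c₁, hc₁⟩ : ∃ c₁, c₁ = (2 - q) * c₀ ^ 3 / 2 := ⟨_, rfl⟩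
  have hβ0 : 0 < β := by rw [hβ]; positivity
  have hc₀1 : c₀ ≤ 1 := by rw [hc₀]; linarith
  have hc₀2 : c₀ ^ 2 ≤ 1 := pow_le_one₀ hc₀0.le hc₀1
  have hβ1 : β ≤ 1 / 8 := by
    have := mul_le_mul (show 2 - q ≤ 1 by linarith [hq.1]) hc₀2 (by positivity) one_pos.le
    linarith
  have hc₁0 : 0 < c₁ := by rw [hc₁]; positivity
  obtain ⟨d, hd⟩ : ∃ d, d = min (c₀ / 2) (min (2 * β) (c₁ / 54)) := ⟨_, rfl⟩
  have hd0 : 0 < d := by rw [hd]; positivity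
  have hd1 : d ≤ c₀ / 2 := hd ▸ min_le_left _ _
  have hd2 : d ≤ 2 * β := hd ▸ (min_le_right _ _).trans (min_le_left _ _)
  have hd3 : d ≤ c₁ / 54 := hd ▸ (min_le_right _ _).trans (min_le_right _ _)
  obtain ⟨ω, hω⟩ : ∃ ω, ω = min (1 / 2) (d / 400) := ⟨_, rfl⟩
  have hω0 : 0 < ω := by rw [hω]; positivity
  have hω1 : ω ≤ 1 / 2 := hω ▸ min_le_left _ _
  have hω2 : ω ≤ d / 400 := hω ▸ min_le_right _ _
  -- The normalization of Λ that makes BΛ ≤ cB₀ = d/40, by log x ≤ x at x = B₀ exp(-P).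
  obtain ⟨B₀, hB₀⟩ : ∃ B₀, B₀ = d / (40 * c) := ⟨_, rfl⟩
  have hB₀0 : 0 < B₀ := by rw [hB₀]; positivity
  -- Λm bounds Λ from below as long as B ≤ 4. Λs bounds Λ from above at the starting time, where B ≥
  -- b₀. Both become harmless after multiplication by k ≤ k₀, that is, at large heights.
  obtain ⟨Λm, hΛm⟩ : ∃ Λm, Λm = |Real.log B₀| + |Real.log 4| + |Real.log b| := ⟨_, rfl⟩
  obtain ⟨Λs, hΛs⟩ : ∃ Λs, Λs = |Real.log B₀| + |Real.log b₀| + |Real.log c| := ⟨_, rfl⟩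
  have hΛm0 : 0 ≤ Λm := by rw [hΛm]; positivity
  have hΛs0 : 0 ≤ Λs := by rw [hΛs]; positivity
  obtain ⟨k₀, hk₀⟩ : ∃ k₀, k₀ = min (min (d / 1680) (d / (5600 * (Λm + 1))))
    (min (d₀ / (108 * (Λm + 1))) ((L₁ - L₀) / (54 * (Λs + 1)))) := ⟨_, rfl⟩
  have hk₀0 : 0 < k₀ := by
    have : 0 < L₁ - L₀ := by linarith
    rw [hk₀]; positivity
  have hk1 : k₀ ≤ d / 1680 := hk₀ ▸ (min_le_left _ _).trans (min_le_left _ _)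
  have hk2 : k₀ * (Λm + 1) ≤ d / 5600 := by
    have : k₀ ≤ d / (5600 * (Λm + 1)) := hk₀ ▸ (min_le_left _ _).trans (min_le_right _ _)
    rw [le_div_iff₀ (by positivity)] at this
    linarith
  have hk3 : k₀ * (Λm + 1) ≤ d₀ / 108 := by
    have : k₀ ≤ d₀ / (108 * (Λm + 1)) := hk₀ ▸ (min_le_right _ _).trans (min_le_left _ _)
    rw [le_div_iff₀ (by positivity)] at this
    linarith
  have hk4 : k₀ * (Λs + 1) ≤ (L₁ - L₀) / 54 := by
    have : k₀ ≤ (L₁ - L₀) / (54 * (Λs + 1)) := hk₀ ▸ (min_le_right _ _).trans (min_le_right _ _)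
    rw [le_div_iff₀ (by positivity)] at this
    linarith
  have hC := w.C_nonneg
  obtain ⟨T, hT⟩ : ∃ T, 4 * C * Real.exp (-T) ≤ d₀ / 4 := by
    have h1 : Tendsto (fun T : ℝ => 4 * C * Real.exp (-T)) atTop (𝓝 0) := by
      simpa using Real.tendsto_exp_neg_atTop_nhds_zero.const_mul (4 * C)
    obtain ⟨T, hT⟩ := (h1.eventually_lt_const (show 0 < d₀ / 4 by positivity)).exists
    exact ⟨T, hT.le⟩
  obtain ⟨X, hX0, hX⟩ := h.exists_time_lt w 5 T
  have hGG : ∀ᶠ x in atTop, |G x * G2 x / G1 x ^ 2 - 1 / q| ≤ ω / 2 := by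
    filter_upwards [Metric.tendsto_nhds.1 h.tendsto_GG2 (ω / 2) (by positivity)] with x hx
    rw [Real.dist_eq] at hx; exact hx.le
  obtain ⟨M, hM⟩ := eventually_atTop.1 ((hGG.and (eventually_ge_atTop X)).and
    ((h.tendsto_G.eventually_ge_atTop 1).and (h.tendsto_G.eventually_ge_atTop (1 / k₀))))
  have hMX : X ≤ M := (hM M le_rfl).1.2
  have hMt : t₀ < M := hX0.trans_le hMX
  refine ⟨M, hMt, c₀, hc₀0, |Real.log B₀| + 6 / c₀ ^ 2, (hM M le_rfl).2.1, ?_⟩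
  intro l m U y s τ hτ hUτ hEτ hbτ t ht hUt
  obtain ⟨k, hk⟩ : ∃ k : ℝ → ℝ, ∀ r, k r = 1 / (q * G (U r)) := ⟨_, fun _ => rfl⟩
  obtain ⟨Z, hZdef⟩ : ∃ Z, Z = scZ G1 U y := ⟨_, rfl⟩
  obtain ⟨B, hBdef⟩ : ∃ B, B = scB G G1 H l U := ⟨_, rfl⟩
  obtain ⟨Λ, hΛdef⟩ : ∃ Λ : ℝ → ℝ, ∀ r, Λ r = Real.log B₀ - scP G G1 l U r := ⟨_, fun _ => rfl⟩
  obtain ⟨L, hLdef'⟩ : ∃ L, L = modEnergy G G1 H l U y q β B₀ := ⟨_, rfl⟩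
  have hLdef : ∀ r, L r = (Z r - 2) ^ 2 / 2 + B r
      + k r * (Z r ^ 2 - β * (Z r - 2)) * Λ r := fun r => by
    rw [hLdef', hk, hZdef, hBdef, hΛdef, modEnergy]
  rw [← hZdef, ← hBdef]
  rw [← hZdef, ← hBdef] at hEτ
  rw [← hBdef] at hbτ
  -- Continuity argument with three barriers. Subtracting 4C exp r compensates the weight term B
  -- H'/H, which is at most 4C exp r while B ≤ 4.
  obtain ⟨φ, hφ⟩ : ∃ φ : ℝ → ℝ, ∀ r, φ r = max (max (Z r - 5) (B r - 4))
    (L r - 4 * C * Real.exp r - L₁) := ⟨_, fun _ => rfl⟩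
  have hUr : ∀ r ∈ Icc τ t, M ≤ U r ∧ r < 0 := fun r hr =>
    ⟨hUt.trans (s.U_antitoneOn w h (mem_Iic.2 (hr.2.trans ht.2.le)) (mem_Iic.2 ht.2.le) hr.2),
      hr.2.trans_lt ht.2⟩
  have hUr0 : ∀ r ∈ Icc τ t, t₀ < U r := fun r hr => hMt.trans_le (hUr r hr).1
  have hG1 : ∀ r ∈ Icc τ t, 1 ≤ G (U r) := fun r hr => (hM _ (hUr r hr).1).2.1
  have hkr : ∀ r ∈ Icc τ t, 0 < k r ∧ k r ≤ k₀ := by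
    intro r hr
    have h1 := (hM _ (hUr r hr).1).2
    have h2 : 0 < G (U r) := by linarith
    rw [hk]
    refine ⟨by positivity, ?_⟩
    rw [div_le_iff₀ (by positivity)]
    have h3 := h1.2
    rw [div_le_iff₀ hk₀0] at h3
    have : 0 ≤ (q - 1) * (k₀ * G (U r)) := mul_nonneg (by linarith [hq.1]) (by positivity)
    linarith
  have hεk : ∀ r ∈ Icc τ t, |G2 (U r) / G1 (U r) ^ 2 - k r| ≤ ω * k r := by
    intro r hr
    have h1 := (hM _ (hUr r hr).1).1.1
    have h2 : 0 < G (U r) := by linarith [hG1 r hr]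
    have e : G2 (U r) / G1 (U r) ^ 2 - k r
        = (G (U r) * G2 (U r) / G1 (U r) ^ 2 - 1 / q) * (1 / G (U r)) := by
      rw [hk]; field_simp
    rw [e, abs_mul, abs_of_pos (show 0 < 1 / G (U r) by positivity)]
    have h3 : ω / 2 * (1 / G (U r)) ≤ ω * k r := by
      rw [hk, div_mul_eq_mul_div, mul_one_div, mul_one_div, div_div,
        div_le_div_iff₀ (by positivity) (by positivity)]
      have : 0 ≤ (2 - q) * (ω * G (U r)) := by positivity
      linarith
    exact (mul_le_mul_of_nonneg_right h1 (by positivity)).trans h3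
  have hZ0 : ∀ r ∈ Icc τ t, 0 ≤ Z r := fun r hr => by
    rw [hZdef]; exact s.scZ_nonneg w h (hUr r hr).2 (hUr0 r hr)
  have hB0 : ∀ r ∈ Icc τ t, 0 < B r := fun r hr => by
    rw [hBdef]; exact LogSol.scB_pos w (hUr r hr).2.le
  have hΛeq : ∀ r ∈ Icc τ t, Λ r = Real.log B₀ - Real.log (B r) + Real.log (H r) := by
    intro r hr
    rw [hΛdef, hBdef, LogSol.scP_eq_log w (hUr r hr).2.le]; ring
  have hℓ : ∀ z ∈ Icc (0 : ℝ) 5, 0 ≤ z ^ 2 - β * (z - 2) ∧ z ^ 2 - β * (z - 2) ≤ 27 :=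
    fun z hz => weight_bounds hβ0.le hβ1 hz.1 hz.2
  -- consequences of the bounds `Z ≤ 5`, `B ≤ 4`
  have hbase : ∀ r ∈ Icc τ t, Z r ≤ 5 → B r ≤ 4 → -Λm ≤ Λ r ∧
      -(d₀ / 4) ≤ k r * (Z r ^ 2 - β * (Z r - 2)) * Λ r ∧ 4 * C * Real.exp r ≤ d₀ / 4 := by
    intro r hr h1 h2
    have hΛ : -Λm ≤ Λ r := by
      rw [hΛeq r hr, hΛm]
      have e1 := Real.log_le_log (hB0 r hr) h2
      have e2 := Real.log_le_log hb (w.lower r (hUr r hr).2.le)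
      linarith [neg_abs_le (Real.log B₀), le_abs_self (Real.log 4), neg_abs_le (Real.log b)]
    refine ⟨hΛ, ?_, ?_⟩
    · obtain ⟨e1, e2⟩ := hℓ (Z r) ⟨hZ0 r hr, h1⟩
      obtain ⟨e3, e4⟩ := hkr r hr
      have e5 : k r * (Z r ^ 2 - β * (Z r - 2)) ≤ k₀ * 27 := mul_le_mul e4 e2 e1 hk₀0.le
      have e6 : 0 ≤ k r * (Z r ^ 2 - β * (Z r - 2)) := mul_nonneg e3.le e1
      have e7 : k r * (Z r ^ 2 - β * (Z r - 2)) * Λm ≤ k₀ * 27 * Λm := by gcongr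
      have e8 : k r * (Z r ^ 2 - β * (Z r - 2)) * -Λm ≤ k r * (Z r ^ 2 - β * (Z r - 2)) * Λ r := by
        gcongr
      linarith
    · have e1 := hX l m U y s r (hUr r hr).2 (hMX.trans (hUr r hr).1)
        (by rw [← hZdef]; exact h1) (by rw [← hBdef]; linarith)
      have e2 : Real.exp r ≤ Real.exp (-T) := Real.exp_le_exp.2 e1.le
      have : 4 * C * Real.exp r ≤ 4 * C * Real.exp (-T) := by gcongr
      linarith
  have hc₀Z : ∀ r ∈ Icc τ t, Z r ≤ 5 → B r ≤ 4 → L r - 4 * C * Real.exp r ≤ L₁ → c₀ ≤ Z r := by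
    intro r hr h1 h2 h3
    obtain ⟨e1, e2, e3⟩ := hbase r hr h1 h2
    by_contra hcon
    have h4 := hZ0 r hr
    have h5 := hB0 r hr
    rw [hLdef] at h3
    have h6 : (Z r - 2) ^ 2 ≤ 4 - d₀ := by linarith
    have h7 : (2 - d₀ / 8) ^ 2 ≤ (2 - Z r) ^ 2 := pow_le_pow_left₀ (by linarith) (by linarith) 2
    linarith [sq_nonneg d₀]
  have hLd : ∀ r ∈ Icc τ t, HasDerivAt L
      (B r * (H1 r / H r) + (-(G2 (U r) / G1 (U r) ^ 2) * B r * Z r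
        - G2 (U r) / G1 (U r) ^ 2 * Z r ^ 2 * (Z r - 2)
        + k r * (Z r ^ 2 - β * (Z r - 2)) * (Z r - 2 + G2 (U r) / G1 (U r) ^ 2 * Z r)
        + k r * (2 * Z r - β) * (B r - G2 (U r) / G1 (U r) ^ 2 * Z r ^ 2) * Λ r
        + q * k r ^ 2 * Z r * (Z r ^ 2 - β * (Z r - 2)) * Λ r)) r := by
    intro r hr
    rw [hLdef']
    exact s.hasDerivAt_modEnergy h w β B₀ (hUr r hr).2 (hUr0 r hr) (by linarith [hG1 r hr])
      (by rw [hZdef]) (by rw [hBdef]) rfl (hk r) (hΛdef r)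
  have hφc : ContinuousOn φ (Icc τ t) := by
    have cZ : ContinuousOn Z (Icc τ t) := fun r hr => by
      rw [hZdef]
      exact (s.hasDerivAt_scZ h (hUr r hr).2 (hUr0 r hr)).continuousAt.continuousWithinAt
    have cB : ContinuousOn B (Icc τ t) := fun r hr => by
      rw [hBdef]
      exact (s.hasDerivAt_scB h w (hUr r hr).2 (hUr0 r hr)).continuousAt.continuousWithinAt
    have cL : ContinuousOn L (Icc τ t) := fun r hr =>
      (hLd r hr).continuousAt.continuousWithinAt
    have : φ = fun r => max (max (Z r - 5) (B r - 4)) (L r - 4 * C * Real.exp r - L₁) :=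
      funext hφ
    rw [this]
    fun_prop
  have hφτ : φ τ < 0 := by
    have hm : τ ∈ Icc τ t := left_mem_Icc.2 ht.1
    have h1 := hB0 τ hm
    have h2 := hZ0 τ hm
    have hsq := sq_nonneg (Z τ - 2)
    have h3 : Z τ < 5 := by
      by_contra hcon
      rw [not_lt] at hcon
      have := pow_le_pow_left₀ (by norm_num : (0 : ℝ) ≤ 3) (show 3 ≤ Z τ - 2 by linarith) 2
      linarith
    have h4 : B τ < 4 := by linarith
    rw [hφ]
    refine max_lt (max_lt (by linarith) (by linarith)) ?_
    have h5 : Λ τ ≤ Λs := by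
      rw [hΛeq τ hm, hΛs]
      have e1 := Real.log_le_log hb₀ hbτ
      have e2 := Real.log_le_log (w.pos hτ.le) (w.upper τ hτ.le)
      linarith [le_abs_self (Real.log B₀), neg_abs_le (Real.log b₀), le_abs_self (Real.log c)]
    obtain ⟨e1, e2⟩ := hℓ (Z τ) ⟨h2, h3.le⟩
    obtain ⟨e3, e4⟩ := hkr τ hm
    have e5 : k τ * (Z τ ^ 2 - β * (Z τ - 2)) ≤ k₀ * 27 := mul_le_mul e4 e2 e1 hk₀0.le
    have e6 : 0 ≤ k τ * (Z τ ^ 2 - β * (Z τ - 2)) := mul_nonneg e3.le e1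
    have e7 : k τ * (Z τ ^ 2 - β * (Z τ - 2)) * Λ τ ≤ k₀ * 27 * Λs := by
      calc k τ * (Z τ ^ 2 - β * (Z τ - 2)) * Λ τ
          ≤ k τ * (Z τ ^ 2 - β * (Z τ - 2)) * Λs := by gcongr
        _ ≤ _ := by gcongr
    have e8 : 0 ≤ 4 * C * Real.exp τ := by positivity
    rw [hLdef]
    linarith
  -- the window does not end
  have hwin : φ t < 0 := by
    by_contra hcon
    obtain ⟨T', hT', hT0, -, hTlt⟩ := exists_first_zero ht.1 hφc hφτ (not_lt.1 hcon)
    have hm : T' ∈ Icc τ t := ⟨hT'.1.le, hT'.2⟩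
    have hle : φ T' ≤ 0 := hT0.le
    rw [hφ, max_le_iff, max_le_iff] at hle
    have h1 : Z T' ≤ 5 := by linarith [hle.1.1]
    have h2 : B T' ≤ 4 := by linarith [hle.1.2]
    have h3 : L T' - 4 * C * Real.exp T' ≤ L₁ := by linarith [hle.2]
    obtain ⟨e1, e2, e3⟩ := hbase T' hm h1 h2
    have h4 := hZ0 T' hm
    have h5 := hB0 T' hm
    have hsq := sq_nonneg (Z T' - 2)
    -- Z = 5 or B = 4 would require an energy well above 2, so a first exit can only be through the
    -- energy barrier. There the dissipation makes the derivative negative, contradicting that the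
    -- barrier was not reached before.
    have h6 : L T' - 4 * C * Real.exp T' = L₁ := by
      rcases max_choice (max (Z T' - 5) (B T' - 4)) (L T' - 4 * C * Real.exp T' - L₁)
        with h8 | h8
      · exfalso
        rw [hφ, h8] at hT0
        rw [hLdef] at h3
        rcases max_choice (Z T' - 5) (B T' - 4) with h9 | h9
        · rw [h9] at hT0
          have : Z T' = 5 := by linarith
          rw [this] at h3 e2
          linarith
        · rw [h9] at hT0
          linarith
      · simp only [hφ] at hT0
        rw [h8] at hT0
        linarith
    have hcZ := hc₀Z T' hm h1 h2 h3
    have hT'0 := (hUr T' hm).2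
    have hBΛ : B T' * Λ T' ≤ d / 40 := by
      obtain ⟨P, hP⟩ : ∃ P, P = scP G G1 l U T' := ⟨_, rfl⟩
      have e4 : B T' = H T' * Real.exp P := by rw [hBdef, hP, scB]
      have e5 : Λ T' = Real.log B₀ - P := by rw [hΛdef, hP]
      have e6 : Real.log B₀ - P ≤ B₀ * Real.exp (-P) := by
        have := Real.log_le_self (show 0 ≤ B₀ * Real.exp (-P) by positivity)
        rwa [Real.log_mul hB₀0.ne' (Real.exp_pos _).ne', Real.log_exp, ← sub_eq_add_neg] at this
      have e7 := w.upper T' hT'0.le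
      have e8 := w.pos hT'0.le
      calc B T' * Λ T' ≤ H T' * Real.exp P * (B₀ * Real.exp (-P)) := by
            rw [e4, e5]; gcongr
        _ = H T' * B₀ := by rw [Real.exp_neg]; field_simp
        _ ≤ c * B₀ := by gcongr
        _ = d / 40 := by rw [hB₀]; field_simp
    have hneg := dissipation_neg (ε := G2 (U T') / G1 (U T') ^ 2) hq hc₀0
      (by rw [hc₀]; linarith) hβ hc₁ hd0 hd1 hd2 hd3 hω0.le hω1 hω2 (hkr T' hm).1
      ((hkr T' hm).2.trans hk1) (by
        have := mul_le_mul_of_nonneg_right (hkr T' hm).2 hΛm0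
        linarith) (hεk T' hm) hcZ h1 h5 e1 hBΛ (by
        have : 0 ≤ 4 * C * Real.exp T' := by positivity
        have : L T' = (Z T' - 2) ^ 2 / 2 + B T'
          + k T' * (Z T' ^ 2 - β * (Z T' - 2)) * Λ T' := hLdef T'
        linarith)
    have hρ : B T' * (H1 T' / H T') ≤ 4 * C * Real.exp T' := by
      have e4 : H1 T' / H T' ≤ C * Real.exp T' := by
        rw [div_le_iff₀ (w.pos hT'0.le)]
        exact (le_abs_self _).trans (w.deriv_le T' hT'0)
      calc B T' * (H1 T' / H T') ≤ B T' * (C * Real.exp T') := by gcongr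
        _ ≤ 4 * (C * Real.exp T') := by gcongr
        _ = _ := by ring
    have hder := (hLd T' hm).sub ((Real.hasDerivAt_exp T').const_mul (4 * C))
    obtain ⟨r, hr, hlt⟩ := exists_lt_of_hasDerivAt_neg hder (by linarith) hT'.1
    have h7 := hTlt r ⟨hr.1.le, hr.2⟩
    rw [hφ, max_lt_iff] at h7
    simp only [Pi.sub_apply] at hlt
    linarith [h7.2]
  have hm : t ∈ Icc τ t := right_mem_Icc.2 ht.1
  rw [hφ, max_lt_iff, max_lt_iff] at hwin
  have h1 : Z t ≤ 5 := by linarith [hwin.1.1]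
  have h2 : B t ≤ 4 := by linarith [hwin.1.2]
  have h3 : L t - 4 * C * Real.exp t ≤ L₁ := by linarith [hwin.2]
  have hcZ := hc₀Z t hm h1 h2 h3
  refine ⟨hcZ, h1, h2, ?_⟩
  obtain ⟨e1, e2, e3⟩ := hbase t hm h1 h2
  have hg1 := hG1 t hm
  have hℓc := sq_le_weight hβ0.le hβ1 hc₀0.le hc₀1 hcZ
  have h4 : k t * (Z t ^ 2 - β * (Z t - 2)) * Λ t ≤ 3 := by
    have := hB0 t hm
    have := sq_nonneg (Z t - 2)
    rw [hLdef] at h3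
    linarith
  -- The correction term of the bounded modified energy is at least c₀²Λ/(qG(U)) for Λ > 0, and q <
  -- 2. This is the lower bound for P.
  have h5 : Λ t ≤ 6 / c₀ ^ 2 * G (U t) := by
    rcases le_or_gt (Λ t) 0 with h6 | h6
    · refine h6.trans ?_
      positivity
    · have h7 : k t * c₀ ^ 2 * Λ t ≤ 3 := by
        refine le_trans ?_ h4
        have := (hkr t hm).1
        gcongr
      have h8 : k t * c₀ ^ 2 * Λ t = c₀ ^ 2 * Λ t / (q * G (U t)) := by
        rw [hk]; ring
      rw [h8, div_le_iff₀ (by positivity)] at h7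
      rw [div_mul_eq_mul_div, le_div_iff₀ (by positivity)]
      have := mul_le_mul_of_nonneg_right hq.2.le (show 0 ≤ G (U t) by linarith)
      linarith
  have h6 : scP G G1 l U t = Real.log B₀ - Λ t := by rw [hΛdef]; ring
  rw [h6]
  have h7 := neg_abs_le (Real.log B₀)
  have h8 := mul_le_mul_of_nonneg_left hg1 (abs_nonneg (Real.log B₀))
  linarith

end

/-! ### The recurrence in scaled variables -/

/-- The scaled depth of the concentrations. -/
def depth (q : ℝ) (k : ℕ) : ℝ :=
  if q = 1 then Real.log (1 / η q k) else (1 - δ q k) / (1 - 1 / q)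

section recurrence
variable {q : ℝ}

lemma δ_mem (hq : q ∈ Ico (1 : ℝ) 2) (k : ℕ) : δ q k ∈ Ioc (0 : ℝ) 1 := by
  induction k with
  | zero => simp [δ]
  | succ k ih =>
    have hx := (ratio_spec hq (a_mem hq k)).1
    rw [δ]
    split_ifs
    · simp
    · exact ⟨mul_pos hx.1 ih.1, mul_le_one₀ hx.2.le ih.1.le ih.2⟩

lemma η_pos (hq : q ∈ Ico (1 : ℝ) 2) (k : ℕ) : 0 < η q k := by
  induction k with
  | zero => simp [η]
  | succ k ih =>
    have hx := (ratio_spec hq (a_mem hq k)).1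
    rw [η]
    split_ifs
    · exact mul_pos hx.1 ih
    · exact Real.rpow_pos_of_pos (δ_mem hq _).1 _

lemma η_le_one (hq : q ∈ Ico (1 : ℝ) 2) (k : ℕ) : η q k ≤ 1 := by
  induction k with
  | zero => simp [η]
  | succ k ih =>
    have hx := (ratio_spec hq (a_mem hq k)).1
    rw [η]
    split_ifs with h
    · exact mul_le_one₀ hx.2.le (η_pos hq k).le ih
    · have := conj_gt_two (lt_of_le_of_ne hq.1 (Ne.symm h)) hq.2
      exact Real.rpow_le_one (δ_mem hq _).1.le (δ_mem hq _).2 (by linarith)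

lemma η_eq_of_ne_one (h : q ≠ 1) (k : ℕ) : η q k = δ q k ^ q.conjExponent := by
  cases k with
  | zero => simp [η, δ]
  | succ k => rw [η, if_neg h]

lemma kappa_pos (hq : q ∈ Ico (1 : ℝ) 2) (h : q ≠ 1) : 0 < 1 - 1 / q := by
  have h1 : 1 < q := lt_of_le_of_ne hq.1 (Ne.symm h)
  have : 1 / q < 1 := by rw [div_lt_one (by linarith)]; exact h1
  linarith

lemma one_div_kappa (hq : q ∈ Ico (1 : ℝ) 2) (h : q ≠ 1) :
    1 / (1 - 1 / q) = q.conjExponent := by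
  have h1 : q - 1 ≠ 0 := sub_ne_zero.2 h
  have h2 : q ≠ 0 := by linarith [hq.1]
  unfold Real.conjExponent
  field_simp

lemma one_sub_depth (hq : q ∈ Ico (1 : ℝ) 2) (h : q ≠ 1) (k : ℕ) :
    1 - (1 - 1 / q) * depth q k = δ q k := by
  have := (kappa_pos hq h).ne'
  rw [depth, if_neg h]
  field_simp
  ring

lemma kappa_mul_depth_lt (hq : q ∈ Ico (1 : ℝ) 2) (k : ℕ) : (1 - 1 / q) * depth q k < 1 := by
  by_cases h : q = 1
  · subst h; simp
  · linarith [one_sub_depth hq h k, (δ_mem hq k).1]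

lemma depth_nonneg (hq : q ∈ Ico (1 : ℝ) 2) (k : ℕ) : 0 ≤ depth q k := by
  unfold depth
  split_ifs with h
  · apply Real.log_nonneg
    rw [le_div_iff₀ (η_pos hq k), one_mul]
    exact η_le_one hq k
  · exact div_nonneg (by linarith [(δ_mem hq k).2]) (kappa_pos hq h).le

lemma depth_zero : depth q 0 = 0 := by
  simp [depth, δ, η]

/-- Identifies η_k as the limit of G(U)/G(m) at the k-th center: for q > 1 by 1 - κ·depth = δ and
1/κ = p, for q = 1 by exp(-log(1/η)) = η. -/
lemma profile_depth (hq : q ∈ Ico (1 : ℝ) 2) (k : ℕ) :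
    profile (1 - 1 / q) (depth q k) = η q k := by
  by_cases h : q = 1
  · have h0 : (1 : ℝ) - 1 / q = 0 := by rw [h]; norm_num
    rw [profile, if_pos h0, depth, if_pos h, one_div, Real.log_inv, neg_neg,
      Real.exp_log (η_pos hq k)]
  · rw [profile, if_neg (kappa_pos hq h).ne', one_sub_depth hq h, one_div_kappa hq h,
      η_eq_of_ne_one h]

lemma depth_lt_succ (hq : q ∈ Ico (1 : ℝ) 2) (k : ℕ) : depth q k < depth q (k + 1) := by
  have hx := (ratio_spec hq (a_mem hq k)).1
  by_cases h : q = 1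
  · have h1 := η_pos hq k
    rw [depth, if_pos h, depth, if_pos h]
    apply Real.log_lt_log (by positivity)
    rw [η, if_pos h]
    apply one_div_lt_one_div_of_lt (mul_pos hx.1 h1)
    nlinarith [hx.2]
  · have h1 := (δ_mem hq k).1
    have h2 : δ q (k + 1) = ratio q (a q k) * δ q k := by rw [δ, if_neg h]
    rw [depth, if_neg h, depth, if_neg h, h2]
    apply div_lt_div_of_pos_right _ (kappa_pos hq h)
    nlinarith [hx.2]

/-- This is `ratioEq` at its root, multiplied by η_k. It says that log(λ r² f'(U))/G(m) returns to
zero exactly at the next depth. -/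
lemma chord_depth (hq : q ∈ Ico (1 : ℝ) 2) (k : ℕ) :
    2 * slope' (1 - 1 / q) (depth q k) / (2 + a q k) * (depth q (k + 1) - depth q k)
      + profile (1 - 1 / q) (depth q (k + 1)) - profile (1 - 1 / q) (depth q k) = 0 := by
  obtain ⟨hx, hxe⟩ := ratio_spec hq (a_mem hq k)
  have ha := (a_mem hq k).1
  rw [slope', profile_depth hq, profile_depth hq]
  have hη := η_pos hq k
  by_cases h : q = 1
  · have h0 : (1 : ℝ) - 1 / q = 0 := by rw [h]; norm_num
    rw [h0, zero_mul, sub_zero, div_one, depth, if_pos h, depth, if_pos h]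
    have h1 : η q (k + 1) = ratio q (a q k) * η q k := by rw [η, if_pos h]
    rw [ratioEq, if_pos h] at hxe
    rw [h1, one_div, one_div, Real.log_inv, Real.log_inv, Real.log_mul hx.1.ne' hη.ne']
    rw [one_div, Real.log_inv] at hxe
    linear_combination η q k * hxe
  · have hδ := (δ_mem hq k).1
    have hp := one_div_kappa hq h
    have hκ := kappa_pos hq h
    have h2 : δ q (k + 1) = ratio q (a q k) * δ q k := by rw [δ, if_neg h]
    rw [one_sub_depth hq h, depth, if_neg h, depth, if_neg h, η_eq_of_ne_one h,
      η_eq_of_ne_one h, h2, Real.mul_rpow hx.1.le hδ.le]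
    rw [ratioEq, if_neg h] at hxe
    rw [← sub_div, div_eq_mul_one_div (1 - ratio q (a q k) * δ q k - (1 - δ q k)), hp]
    have e : 2 * (δ q k ^ q.conjExponent / δ q k) / (2 + a q k)
        * ((1 - ratio q (a q k) * δ q k - (1 - δ q k)) * q.conjExponent)
        = δ q k ^ q.conjExponent * (2 * q.conjExponent / (2 + a q k) * (1 - ratio q (a q k))) := by
      field_simp
      ring
    rw [e]
    linear_combination δ q k ^ q.conjExponent * hxe

/-- The quotient of the two slopes is x for q = 1 and x^(p-1) for q > 1, so this is the recurrence
for a read as the arrival slope after motion with constant y. -/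
lemma slope_depth (hq : q ∈ Ico (1 : ℝ) 2) (k : ℕ) :
    (2 + a q k) / slope' (1 - 1 / q) (depth q k) * slope' (1 - 1 / q) (depth q (k + 1))
      = 2 - a q (k + 1) := by
  obtain ⟨hx, -⟩ := ratio_spec hq (a_mem hq k)
  rw [slope', slope', profile_depth hq, profile_depth hq]
  have hη := η_pos hq k
  by_cases h : q = 1
  · have h0 : (1 : ℝ) - 1 / q = 0 := by rw [h]; norm_num
    have h1 : η q (k + 1) = ratio q (a q k) * η q k := by rw [η, if_pos h]
    rw [h0, zero_mul, zero_mul, sub_zero, div_one, div_one, h1, a, if_pos h]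
    field_simp
    ring
  · have hδ := (δ_mem hq k).1
    have h2 : δ q (k + 1) = ratio q (a q k) * δ q k := by rw [δ, if_neg h]
    have hδp := Real.rpow_pos_of_pos hδ q.conjExponent
    rw [one_sub_depth hq h, one_sub_depth hq h, η_eq_of_ne_one h, η_eq_of_ne_one h, h2,
      Real.mul_rpow hx.1.le hδ.le, a, if_neg h, Real.rpow_sub_one hx.1.ne']
    have := hx.1
    field_simp
    ring

/-- Index 1 is the second concentration. Its energy is thus strictly below 2, as
`exists_uniform_bounds` requires of the starting point. -/
lemma a_one_lt_two (hq : q ∈ Ico (1 : ℝ) 2) : a q 1 < 2 := by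
  obtain ⟨hx, -⟩ := ratio_spec hq (a_mem hq 0)
  have h0 : a q 0 = 2 := rfl
  have : a q 1 = 2 - (if q = 1 then ratio q (a q 0) else ratio q (a q 0) ^ (q.conjExponent - 1))
      * (2 + a q 0) := rfl
  rw [this, h0]
  rw [h0] at hx
  split_ifs
  · linarith [hx.1]
  · linarith [Real.rpow_pos_of_pos hx.1 (q.conjExponent - 1)]

/-- The slope of the profile tends to zero at the end of its domain. -/
lemma exists_slope'_lt (hq : q ∈ Ico (1 : ℝ) 2) {ε : ℝ} (hε : 0 < ε) :
    ∃ x, 0 ≤ x ∧ (1 - 1 / q) * x < 1 ∧ slope' (1 - 1 / q) x < ε := by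
  by_cases h : q = 1
  · have h0 : (1 : ℝ) - 1 / q = 0 := by rw [h]; norm_num
    obtain ⟨x, hx, hx0⟩ := ((Real.tendsto_exp_neg_atTop_nhds_zero.eventually_lt_const hε).and
      (eventually_ge_atTop 0)).exists
    rw [h0]
    exact ⟨x, hx0, by simp, by simpa [slope', profile] using hx⟩
  · have hκ := kappa_pos hq h
    have hp := conj_gt_two (lt_of_le_of_ne hq.1 (Ne.symm h)) hq.2
    set w := min (ε / 2) (1 / 2) with hw
    have hw0 : 0 < w := by positivity
    have hw1 : w ≤ 1 / 2 := min_le_right _ _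
    have hwε : w ≤ ε / 2 := min_le_left _ _
    have e : 1 - (1 - 1 / q) * ((1 - w) / (1 - 1 / q)) = w := by field_simp; ring
    refine ⟨(1 - w) / (1 - 1 / q), div_nonneg (by linarith) hκ.le, by linarith, ?_⟩
    rw [slope', profile, if_neg hκ.ne', e, one_div_kappa hq h, div_lt_iff₀ hw0]
    have : w ^ q.conjExponent ≤ w ^ (2 : ℝ) :=
      Real.rpow_le_rpow_of_exponent_ge hw0 (by linarith) hp.le
    rw [Real.rpow_two] at this
    nlinarith

end recurrence

/-- The quotient log G'/log G tends to 1/q > 0, because the quotient of the derivatives is G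
G''/G'². -/
lemma Nonlin.tendsto_G1 {f G G1 G2 : ℝ → ℝ} {t₀ q : ℝ} (h : Nonlin f G G1 G2 t₀ q) :
    Tendsto G1 atTop atTop := by
  obtain ⟨X, hX⟩ := eventually_atTop.1
    ((h.tendsto_G.eventually_gt_atTop 0).and (eventually_gt_atTop t₀))
  have hlogG : Tendsto (fun t => Real.log (G t)) atTop atTop :=
    Real.tendsto_log_atTop.comp h.tendsto_G
  have h1 : Tendsto (fun t => Real.log (G1 t) / Real.log (G t)) atTop (𝓝 (1 / q)) := by
    refine tendsto_div_of_deriv_div (a := X) (χ' := fun t => G1 t / G t)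
      (φ' := fun t => G2 t / G1 t) (fun t ht => ?_) (fun t ht => ?_) (fun t ht => ?_) ?_ hlogG
    · have := (hX t ht.le).2
      exact (h.hasDerivAt_G1 t this).log (h.G1_pos t this).ne'
    · have := hX t ht.le
      exact (h.hasDerivAt_G t this.2).log this.1.ne'
    · have := hX t ht.le
      exact div_pos (h.G1_pos t this.2) this.1
    · refine h.tendsto_GG2.congr fun t => ?_
      rw [div_div_div_eq, sq, mul_comm (G t)]
  have h2 : Tendsto (fun t => Real.log (G1 t)) atTop atTop := by
    refine (h1.pos_mul_atTop (one_div_pos.2 h.q_pos) hlogG).congr' ?_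
    filter_upwards [hlogG.eventually_gt_atTop 0] with t ht
    field_simp
  refine (Real.tendsto_exp_atTop.comp h2).congr' ?_
  filter_upwards [eventually_gt_atTop t₀] with t ht
  exact Real.exp_log (h.G1_pos t ht)

/-! ### Induction over the concentrations and uniform bounds -/

namespace Family
variable {f G G1 G2 H H1 : ℝ → ℝ} {t₀ q b c C : ℝ} {l m : ℕ → ℝ} {U y : ℕ → ℝ → ℝ}

/-- The solutions arrive at every concentration with slope `2 - a`. -/
theorem reach_before (F : Family f G G1 G2 H H1 t₀ q b c C l m U y) (k : ℕ) :
    Reach (scState G G1 H l m U y) (depth q k, 2 - a q k, 0, 0) := by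
  have hq := F.nonlin.q_mem
  induction k with
  | zero =>
    have : a q 0 = 2 := rfl
    rw [depth_zero, this, sub_self]
    exact F.reach_zero
  | succ k ih =>
    have ha := a_mem hq k
    have hσ0 := depth_nonneg hq k
    have hσ := kappa_mul_depth_lt hq k
    -- The end of the concentration is the limit z → 2 + a of the states reached on the way.
    have hafter : Reach (scState G G1 H l m U y) (depth q k, 2 + a q k, 0, 0) := by
      apply Reach.of_mem_closure
      have hcont : Continuous (fun z : ℝ => ((depth q k, z, (a q k ^ 2 - (z - 2) ^ 2) / 2, 0) :
          ℝ × ℝ × ℝ × ℝ)) := by fun_prop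
      have h1 := (hcont.tendsto (2 + a q k)).mono_left
        (nhdsWithin_le_nhds (s := Iio (2 + a q k)))
      rw [show (a q k ^ 2 - (2 + a q k - 2) ^ 2) / 2 = 0 by ring] at h1
      refine mem_closure_of_tendsto h1 ?_
      filter_upwards [Ioo_mem_nhdsLT (show 2 - a q k < 2 + a q k by linarith [ha.1])] with z hz
      exact F.reach_bubble ha.1 ha.2 hσ0 hσ hz ih
    have hσ' := kappa_mul_depth_lt hq (k + 1)
    have hlt := depth_lt_succ hq k
    have hκ0 := F.nonlin.kappa_nonneg
    have hκ1 := F.nonlin.kappa_lt_half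
    -- The next depth is approached from the left: `reach_travel` needs a strictly negative chord
    -- function, which strict convexity provides before its second zero.
    apply Reach.of_mem_closure
    set κ := 1 - 1 / q with hκ
    have hcont : ContinuousAt (fun x : ℝ => ((x, (2 + a q k) / slope' κ (depth q k) * slope' κ x, 0,
        2 * slope' κ (depth q k) / (2 + a q k) * (x - depth q k) + profile κ x
          - profile κ (depth q k)) : ℝ × ℝ × ℝ × ℝ)) (depth q (k + 1)) := by
      have h1 := continuousAt_slope' hσ'
      have h2 := (hasDerivAt_profile hσ').continuousAt
      fun_prop
    have h1 := hcont.tendsto.mono_left (nhdsWithin_le_nhds (s := Iio (depth q (k + 1))))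
    rw [chord_depth hq k, slope_depth hq k] at h1
    refine mem_closure_of_tendsto h1 ?_
    filter_upwards [Ioo_mem_nhdsLT hlt] with x hx
    exact F.reach_travel ha.1 hσ0 hx.1 (by nlinarith [hx.2])
      (profile_chord_neg (by linarith) hκ0 hσ' (chord_depth hq k) hx) hafter

/-- The centers of the concentrations. -/
theorem reach_center (F : Family f G G1 G2 H H1 t₀ q b c C l m U y) (k : ℕ) :
    Reach (scState G G1 H l m U y) (depth q k, 2, a q k ^ 2 / 2, 0) := by
  have hq := F.nonlin.q_mem
  have ha := a_mem hq k
  have := F.reach_bubble ha.1 ha.2 (depth_nonneg hq k) (kappa_mul_depth_lt hq k) (z := 2)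
    ⟨by linarith [ha.1], by linarith [ha.1]⟩ (F.reach_before k)
  simpa using this

/-- Uniform bounds on the solutions outside of the first concentration, down to a fixed
height. -/
theorem exists_bounds (F : Family f G G1 G2 H H1 t₀ q b c C l m U y) :
    ∃ M > t₀, ∃ c₀ > 0, ∃ K : ℝ, ∃ τ : ℕ → ℝ, (∀ n, τ n < 0) ∧
      Tendsto (fun n => scS G G1 (m n) (U n) (τ n)) atTop (𝓝 (depth q 1)) ∧
      ∀ᶠ n in atTop, |Real.log (l n)| ≤ K ∧
        (∀ t ∈ Ico (τ n) 0, M ≤ U n t → c₀ ≤ scZ G1 (U n) (y n) t ∧ scZ G1 (U n) (y n) t ≤ 5) ∧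
        M ≤ U n (τ n) ∧ ∃ t ∈ Ico (τ n) 0, U n t = M := by
  have h := F.nonlin
  have w := F.weight
  have hq := h.q_mem
  obtain ⟨τ, hτ, hlim⟩ := (F.reach_center 1).exists_seq
  obtain ⟨hS, hZ, hB, -⟩ := tendsto_scState.1 hlim
  obtain ⟨hU, -, -⟩ := F.scaled_limits (Eventually.of_forall fun n => (hτ n).le) hS
    (depth_nonneg hq 1) (kappa_mul_depth_lt hq 1)
  have ha1 := a_mem hq 1
  have ha2 := a_one_lt_two hq
  set e := a q 1 ^ 2 / 2 with he
  have he0 : 0 < e := by have := ha1.1; positivity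
  have he2 : e < 2 := by nlinarith [ha1.1]
  obtain ⟨M, hM, c₀, hc₀, K₀, hGM, hbd⟩ := exists_uniform_bounds h w
    (L₀ := (e + 2) / 2) (b₀ := e / 2) (by linarith) (by linarith)
  have hEτ : Tendsto (fun n => (scZ G1 (U n) (y n) (τ n) - 2) ^ 2 / 2
      + scB G G1 H (l n) (U n) (τ n)) atTop (𝓝 e) := by
    have := (((hZ.sub_const 2).pow 2).div_const 2).add hB
    simpa using this
  have hM0 : 0 < M := h.t₀_nonneg.trans_lt hM
  have hg := h.G1_pos M hM
  -- The two entries come from solving P = log l + 2t + G(M) + log G'(M) for log l at the point t of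
  -- height M, where P is bounded on both sides and t is bounded below.
  refine ⟨M, hM, c₀, hc₀, max (Real.log 4 - Real.log b - G M - Real.log (G1 M)
    + 2 * (M / (c₀ / G1 M))) (K₀ * G M + G M + Real.log (G1 M)), τ, hτ, hS, ?_⟩
  filter_upwards [hEτ.eventually_lt_const (show e < (e + 2) / 2 by linarith),
    hB.eventually_const_lt (show e / 2 < e by linarith), hU.eventually_ge_atTop M] with n h1 h2 h3
  have s := F.sol n
  have hall := hbd _ _ _ _ s (τ n) (hτ n) h3 h1.le h2.le
  obtain ⟨t, ht, htM⟩ := intermediate_value_Icc' (hτ n).le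
    (s.cont_U.mono Icc_subset_Iic_self) (show M ∈ Icc (U n 0) (U n (τ n)) from
      ⟨by rw [s.U_zero]; exact hM0.le, h3⟩)
  have ht0 : t < 0 := s.lt_zero_of_U_pos ht.2 (by rw [htM]; exact hM0)
  obtain ⟨b1, b2, b3, b4⟩ := hall t ⟨ht.1, ht0⟩ htM.ge
  refine ⟨?_, fun r hr hrM => ⟨(hall r hr hrM).1, (hall r hr hrM).2.1⟩, h3, t, ⟨ht.1, ht0⟩, htM⟩
  have hy : c₀ / G1 M ≤ y n t := by
    rw [div_le_iff₀ hg]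
    rw [scZ, htM] at b1
    exact b1
  -- From t on, y is at least c₀/G'(M), and U has only the height M left to fall.
  have htime : -t ≤ M / (c₀ / G1 M) := by
    rw [le_div_iff₀ (by positivity)]
    have hmono : AntitoneOn (fun r => U n r + c₀ / G1 M * r) (Icc t 0) := by
      apply antitoneOn_of_hasDerivWithinAt_nonpos (convex_Icc t 0)
        (f' := fun r => -y n r + c₀ / G1 M * 1)
      · exact (s.cont_U.mono Icc_subset_Iic_self).add (by fun_prop)
      · intro r hr
        rw [interior_Icc] at hr
        exact ((s.hasDerivAt_U r hr.2).add ((hasDerivAt_id r).const_mul _)).hasDerivWithinAt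
      · intro r hr
        rw [interior_Icc] at hr
        have := s.y_monotoneOn w h (mem_Iio.2 ht0) (mem_Iio.2 hr.2) hr.1.le
        linarith
    have := hmono (left_mem_Icc.2 ht0.le) (right_mem_Icc.2 ht0.le) ht0.le
    simp only [s.U_zero, htM, mul_zero] at this
    linarith
  have hlogB : scP G G1 (l n) (U n) t ≤ Real.log 4 - Real.log b := by
    rw [LogSol.scP_eq_log w ht0.le]
    have := Real.log_le_log (LogSol.scB_pos w ht0.le) b3
    have := Real.log_le_log w.b_pos (w.lower t ht0.le)
    linarith
  rw [scP, htM] at hlogB b4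
  rw [abs_le]
  constructor
  · have := le_max_right (Real.log 4 - Real.log b - G M - Real.log (G1 M)
      + 2 * (M / (c₀ / G1 M))) (K₀ * G M + G M + Real.log (G1 M))
    linarith
  · refine le_trans ?_ (le_max_left _ _)
    linarith

end Family

/-! ### Passage to logarithmic coordinates -/

section bridge
variable {h f : ℝ → ℝ} {t₀ q : ℝ}

lemma H0.nonlin (h0 : H0 h f t₀) (h1 : H1 f t₀ q) (hq : q ∈ Ico (1 : ℝ) 2) :
    Nonlin f (g f) (g' f t₀) (g'' f t₀) t₀ q := by
  have hg : ContDiffOn ℝ 2 (g f) (Ici t₀) :=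
    h0.f_contDiff_two.log fun t ht => (h0.f_pos t ht).ne'
  have hg' : ContDiffOn ℝ 1 (g' f t₀) (Ici t₀) :=
    hg.derivWithin (uniqueDiffOn_Ici t₀) (by norm_num)
  exact
  { t₀_nonneg := h0.t₀_nonneg
    f_nonneg := h0.f_nonneg
    f_cont := h0.f_contDiff.continuousOn
    f_eq := fun t ht => (Real.exp_log (h0.f_pos t (le_of_lt ht))).symm
    hasDerivAt_G := fun t ht => ((hg.differentiableOn (by norm_num)) t
      (le_of_lt ht)).hasDerivWithinAt.hasDerivAt (Ici_mem_nhds ht)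
    hasDerivAt_G1 := fun t ht => ((hg'.differentiableOn (by norm_num)) t
      (le_of_lt ht)).hasDerivWithinAt.hasDerivAt (Ici_mem_nhds ht)
    G1_pos := fun t ht => h1.g'_pos t (le_of_lt ht)
    G2_pos := fun t ht => h1.g''_pos t (le_of_lt ht)
    q_mem := hq
    lim_q := h1.lim_q }

lemma Nonlin.f'_eq {G G1 G2 : ℝ → ℝ} (n : Nonlin f G G1 G2 t₀ q) {x : ℝ} (hx : t₀ < x) :
    f' f x = f x * G1 x := by
  have h1 : HasDerivAt f (f x * G1 x) x := by
    rw [n.f_eq x hx]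
    refine (n.hasDerivAt_G x hx).exp.congr_of_eventuallyEq ?_
    filter_upwards [Ioi_mem_nhds hx] with y hy using n.f_eq y hy
  exact h1.hasDerivWithinAt.derivWithin
    (uniqueDiffOn_Ici 0 x (n.t₀_nonneg.trans (le_of_lt hx)))

lemma exp_mem_Ioo {t : ℝ} (ht : t < 0) : Real.exp t ∈ Ioo (0 : ℝ) 1 :=
  ⟨Real.exp_pos t, by simpa using ht⟩

lemma exp_mem_Icc {t : ℝ} (ht : t ≤ 0) : Real.exp t ∈ Icc (0 : ℝ) 1 :=
  ⟨(Real.exp_pos t).le, by simpa using ht⟩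

lemma tendsto_exp_atBot_Icc : Tendsto Real.exp atBot (𝓝[Icc 0 1] 0) := by
  refine tendsto_nhdsWithin_iff.2 ⟨Real.tendsto_exp_atBot, ?_⟩
  filter_upwards [eventually_le_atBot 0] with t ht using exp_mem_Icc ht

/-- C is max |h'| / min h. The decaying factor exp t is due to the chain rule. -/
lemma H0.weight (h0 : H0 h f t₀) : ∃ b c C, Weight (fun t => h (Real.exp t))
    (fun t => derivWithin h (Icc 0 1) (Real.exp t) * Real.exp t) b c C := by
  have hc := h0.h_contDiff.continuousOn
  have hc' : ContinuousOn (derivWithin h (Icc 0 1)) (Icc 0 1) :=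
    h0.h_contDiff.continuousOn_derivWithin (uniqueDiffOn_Icc zero_lt_one) le_rfl
  have hne : (Icc (0 : ℝ) 1).Nonempty := nonempty_Icc.2 zero_le_one
  obtain ⟨x, hx, hmin⟩ := isCompact_Icc.exists_isMinOn hne hc
  obtain ⟨z, hz, hmax⟩ := isCompact_Icc.exists_isMaxOn hne hc
  obtain ⟨v, hv, hmax'⟩ := isCompact_Icc.exists_isMaxOn hne hc'.abs
  have hb := h0.h_pos x hx
  refine ⟨h x, h z, |derivWithin h (Icc 0 1) v| / h x, ?_⟩
  exact
  { b_pos := hb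
    C_nonneg := by positivity
    lower := fun t ht => hmin (exp_mem_Icc ht)
    upper := fun t ht => hmax (exp_mem_Icc ht)
    hasDerivAt := fun t ht => by
      have h1 : HasDerivAt h (derivWithin h (Icc 0 1) (Real.exp t)) (Real.exp t) :=
        ((h0.h_contDiff.differentiableOn (by norm_num)) _
          (exp_mem_Icc ht.le)).hasDerivWithinAt.hasDerivAt
          (Icc_mem_nhds (exp_mem_Ioo ht).1 (exp_mem_Ioo ht).2)
      exact h1.comp t (Real.hasDerivAt_exp t)
    deriv_le := fun t ht => by
      have h1 : |derivWithin h (Icc 0 1) (Real.exp t)| ≤ |derivWithin h (Icc 0 1) v| :=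
        hmax' (exp_mem_Icc ht.le)
      have h2 : h x ≤ h (Real.exp t) := hmin (exp_mem_Icc ht.le)
      have he := Real.exp_pos t
      rw [abs_mul, abs_of_pos he, div_mul_eq_mul_div, div_mul_eq_mul_div, le_div_iff₀ hb]
      gcongr }

/-- With y = -r u', multiplying the equation by r² removes the first-order term: y' = λ r² h f(u).
-/
lemma IsSolution.logSol {l m : ℝ} {u : ℝ → ℝ} (s : IsSolution h f l m u) :
    LogSol f (fun t => h (Real.exp t)) l m (fun t => u (Real.exp t))
      (fun t => -(Real.exp t * derivWithin u (Icc 0 1) (Real.exp t))) := by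
  have hcu := s.contDiff.continuousOn
  have hu' : ContDiffOn ℝ 1 (derivWithin u (Icc 0 1)) (Icc 0 1) :=
    s.contDiff.derivWithin (uniqueDiffOn_Icc zero_lt_one) (by norm_num)
  have hz : (0 : ℝ) ∈ Icc (0 : ℝ) 1 := left_mem_Icc.2 zero_le_one
  exact
  { l_pos := s.l_pos
    m_pos := s.m_pos
    cont_U := hcu.comp Real.continuous_exp.continuousOn fun t ht => exp_mem_Icc ht
    hasDerivAt_U := fun t ht => by
      have h1 : HasDerivAt u (derivWithin u (Icc 0 1) (Real.exp t)) (Real.exp t) :=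
        ((s.contDiff.differentiableOn (by norm_num)) _
          (exp_mem_Icc ht.le)).hasDerivWithinAt.hasDerivAt
          (Icc_mem_nhds (exp_mem_Ioo ht).1 (exp_mem_Ioo ht).2)
      refine (h1.comp t (Real.hasDerivAt_exp t)).congr_deriv ?_
      ring
    hasDerivAt_y := fun t ht => by
      have hm := exp_mem_Ioo ht
      have h1 : HasDerivAt (derivWithin u (Icc 0 1))
          (derivWithin (derivWithin u (Icc 0 1)) (Icc 0 1) (Real.exp t)) (Real.exp t) :=
        ((hu'.differentiableOn (by norm_num)) _
          (exp_mem_Icc ht.le)).hasDerivWithinAt.hasDerivAt (Icc_mem_nhds hm.1 hm.2)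
      refine ((Real.hasDerivAt_exp t).mul (h1.comp t (Real.hasDerivAt_exp t))).neg.congr_deriv ?_
      have he := s.equation _ hm
      have h2 : Real.exp (2 * t) = Real.exp t * Real.exp t := by
        rw [← Real.exp_add]; ring_nf
      have h3 := hm.1.ne'
      simp only [Function.comp]
      calc _ = Real.exp t * Real.exp t
            * (-derivWithin (derivWithin u (Icc 0 1)) (Icc 0 1) (Real.exp t)
              - 1 / Real.exp t * derivWithin u (Icc 0 1) (Real.exp t)) := by
            field_simp; ring
        _ = _ := by rw [he, h2]; ring
    U_bot := by
      have := (hcu 0 hz).tendsto.comp tendsto_exp_atBot_Icc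
      rwa [s.at_zero] at this
    y_bot := by
      have := (hu'.continuousOn 0 hz).tendsto.comp tendsto_exp_atBot_Icc
      rw [s.deriv_zero] at this
      simpa using (Real.tendsto_exp_atBot.mul this).neg
    U_zero := by simpa using s.at_one
    U_pos := fun t ht => s.pos _ (exp_mem_Ioo ht) }

end bridge

/-! ### Size of the parameter, position of the centers, pointwise divergence -/

namespace Family
variable {f G G1 G2 H H1 : ℝ → ℝ} {t₀ q b c C : ℝ} {l m : ℕ → ℝ} {U y : ℕ → ℝ → ℝ}

lemma comp (F : Family f G G1 G2 H H1 t₀ q b c C l m U y) {φ : ℕ → ℕ} (hφ : StrictMono φ) :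
    Family f G G1 G2 H H1 t₀ q b c C (fun n => l (φ n)) (fun n => m (φ n)) (fun n => U (φ n))
      (fun n => y (φ n)) where
  nonlin := F.nonlin
  weight := F.weight
  sol := fun n => F.sol (φ n)
  lim_m := F.lim_m.comp hφ.tendsto_atTop

/-- By `exists_bounds` log l is even bounded, while G(m) → ∞. -/
lemma log_l_div (F : Family f G G1 G2 H H1 t₀ q b c C l m U y) :
    Tendsto (fun n => Real.log (l n) / G (m n)) atTop (𝓝 0) := by
  obtain ⟨M, hM, c₀, hc₀, K, τ, -, -, hev⟩ := F.exists_bounds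
  have h1 : Tendsto (fun n => K / G (m n)) atTop (𝓝 0) :=
    tendsto_const_nhds.div_atTop F.tendsto_N
  refine squeeze_zero_norm' ?_ h1
  filter_upwards [hev, F.eventually_good 0] with n h2 h3
  rw [Real.norm_eq_abs, abs_div, abs_of_pos h3.2.2.1]
  exact div_le_div_of_nonneg_right h2.1 h3.2.2.1.le

/-- The position of points whose height is known and at which `B` converges. -/
lemma tendsto_time_div (F : Family f G G1 G2 H H1 t₀ q b c C l m U y) {t : ℕ → ℝ} {σ β : ℝ}
    (ht : ∀ n, t n < 0) (hσ0 : 0 ≤ σ) (hσ : (1 - 1 / q) * σ < 1) (hβ : 0 < β)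
    (hS : Tendsto (fun n => scS G G1 (m n) (U n) (t n)) atTop (𝓝 σ))
    (hB : Tendsto (fun n => scB G G1 H (l n) (U n) (t n)) atTop (𝓝 β)) :
    Tendsto (fun n => -t n / G (m n)) atTop (𝓝 (profile (1 - 1 / q) σ / 2)) := by
  have h := F.nonlin
  have w := F.weight
  obtain ⟨hU, hG, hG1⟩ := F.scaled_limits (Eventually.of_forall fun n => (ht n).le) hS hσ0 hσ
  have e1 : Tendsto (fun n => Real.log (scB G G1 H (l n) (U n) (t n)) / G (m n)) atTop (𝓝 0) :=
    (hB.log hβ.ne').div_atTop F.tendsto_N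
  have e2 : Tendsto (fun n => Real.log (H (t n)) / G (m n)) atTop (𝓝 0) := by
    refine tendsto_of_tendsto_of_tendsto_of_le_of_le'
      (tendsto_const_nhds.div_atTop F.tendsto_N : Tendsto (fun n => Real.log b / G (m n)) _ _)
      (tendsto_const_nhds.div_atTop F.tendsto_N : Tendsto (fun n => Real.log c / G (m n)) _ _)
      ?_ ?_
    · filter_upwards [F.eventually_good 0] with n h4
      exact div_le_div_of_nonneg_right (Real.log_le_log w.b_pos (w.lower _ (ht n).le)) h4.2.2.1.le
    · filter_upwards [F.eventually_good 0] with n h4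
      exact div_le_div_of_nonneg_right
        (Real.log_le_log (w.pos (ht n).le) (w.upper _ (ht n).le)) h4.2.2.1.le
  have e3 : Tendsto (fun n => Real.log (G1 (U n (t n)) / G1 (m n)) / G (m n)) atTop (𝓝 0) :=
    (hG1.log (slope'_pos hσ).ne').div_atTop F.tendsto_N
  have e4 : Tendsto (fun n => Real.log (G1 (m n)) / G (m n)) atTop (𝓝 0) :=
    h.tendsto_logG1_div.comp F.lim_m
  -- The definition of P solved for -t: among log l, G(U), log G'(U) and P, only G(U) is of order
  -- G(m).
  have := (((F.log_l_div.add hG).add (e3.add e4)).sub (e1.sub e2)).div_const 2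
  simp only [add_zero, zero_add, sub_zero] at this
  refine this.congr' ?_
  filter_upwards [F.eventually_good 0, hU.eventually_gt_atTop t₀] with n h1 h2
  have h3 := LogSol.scP_eq_log (G := G) (G1 := G1) (l := l n) (U := U n) w (ht n).le
  rw [Real.log_div (h.G1_pos _ h2).ne' h1.2.1.ne']
  have h4 := h1.2.2.1
  field_simp
  rw [scP] at h3
  linarith

/-- Pointwise divergence away from the boundary. -/
lemma tendsto_G1_mul_U (F : Family f G G1 G2 H H1 t₀ q b c C l m U y) {t : ℝ} (ht : t < 0) :
    Tendsto (fun n => G1 (m n) * U n t) atTop atTop := by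
  have h := F.nonlin
  have w := F.weight
  obtain ⟨M, hM, c₀, hc₀, K, τ, -, -, hev⟩ := F.exists_bounds
  have hM0 : 0 < M := h.t₀_nonneg.trans_lt hM
  have hg := h.G1_pos M hM
  -- A lower bound for U n t independent of n: either the height is still at least M, or the slope
  -- from t to the boundary is at least c₀/G'(M).
  set v := min M (c₀ / G1 M * -t) with hv
  have hv0 : 0 < v := lt_min hM0 (mul_pos (by positivity) (by linarith))
  refine tendsto_atTop_mono' _ ?_ ((h.tendsto_G1.comp F.lim_m).atTop_mul_const hv0)
  filter_upwards [hev, F.eventually_good 0] with n ⟨_, h2, _, r, hr, hrM⟩ h3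
  have s := F.sol n
  have hle : v ≤ U n t := by
    rcases le_or_gt t r with h4 | h4
    · refine (min_le_left _ _).trans ?_
      rw [← hrM]
      exact s.U_antitoneOn w h (mem_Iic.2 ht.le) (mem_Iic.2 hr.2.le) h4
    · refine (min_le_right _ _).trans ?_
      have h5 := (h2 r hr hrM.ge).1
      rw [scZ, hrM, ← div_le_iff₀ hg] at h5
      have hmono : AntitoneOn (fun x => U n x + c₀ / G1 M * x) (Icc t 0) := by
        apply antitoneOn_of_hasDerivWithinAt_nonpos (convex_Icc t 0)
          (f' := fun x => -y n x + c₀ / G1 M * 1)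
        · exact (s.cont_U.mono Icc_subset_Iic_self).add (by fun_prop)
        · intro x hx
          rw [interior_Icc] at hx
          exact ((s.hasDerivAt_U x hx.2).add ((hasDerivAt_id x).const_mul _)).hasDerivWithinAt
        · intro x hx
          rw [interior_Icc] at hx
          have := s.y_monotoneOn w h (mem_Iio.2 hr.2) (mem_Iio.2 hx.2) (h4.trans hx.1).le
          linarith
      have := hmono (left_mem_Icc.2 ht.le) (right_mem_Icc.2 ht.le) ht.le
      simp only [s.U_zero, mul_zero] at this
      linarith
  exact mul_le_mul_of_nonneg_left hle h3.2.1.le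

end Family

/-! ### Divergence of the energy -/

/-- On an interval on which `Z` is bounded below, the energy controls the decay of `G'(U)`. -/
lemma LogSol.energy_ge {f G G1 G2 H H1 U y Φ : ℝ → ℝ} {t₀ q b c C l m c₀ D τ t : ℝ}
    (s : LogSol f H l m U y) (w : Weight H H1 b c C) (h : Nonlin f G G1 G2 t₀ q)
    (hτt : τ ≤ t) (ht : t < 0) (hU : t₀ < U t) (hc₀ : 0 ≤ c₀)
    (hΦ : ContinuousOn Φ (Icc 0 1))
    (hB : ∀ x < 0, t₀ < U x → Φ (Real.exp x) = scB G G1 H l U x / Real.exp x)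
    (hZ : ∀ x ∈ Icc τ t, c₀ ≤ scZ G1 U y x ∧ scZ G1 U y x ≤ D) :
    c₀ * (Real.log (G1 (U τ)) - Real.log (G1 (U t))) - D
      ≤ ∫ r in Real.exp τ..Real.exp t, Φ r := by
  have hpos : ∀ r ∈ Icc (Real.exp τ) (Real.exp t), 0 < r ∧ Real.log r ∈ Icc τ t ∧
      t₀ < U (Real.log r) := by
    intro r hr
    have h0 := (Real.exp_pos τ).trans_le hr.1
    have h1 : Real.log r ∈ Icc τ t :=
      ⟨(Real.le_log_iff_exp_le h0).2 hr.1, (Real.log_le_iff_le_exp h0).2 hr.2⟩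
    exact ⟨h0, h1, hU.trans_le (s.U_antitoneOn w h (mem_Iic.2 (h1.2.trans ht.le))
      (mem_Iic.2 ht.le) h1.2)⟩
  -- In the variable t the derivative of Z - c₀ log G'(U) is B - εZ(Z - c₀) ≤ B. The factor 1/r
  -- passes to the radius.
  have hW : ∀ r ∈ Icc (Real.exp τ) (Real.exp t), HasDerivAt
      (fun r => scZ G1 U y (Real.log r) - c₀ * Real.log (G1 (U (Real.log r))))
      ((scB G G1 H l U (Real.log r) - G2 (U (Real.log r)) / G1 (U (Real.log r)) ^ 2
        * scZ G1 U y (Real.log r) ^ 2 - c₀ * -(G2 (U (Real.log r)) / G1 (U (Real.log r)) ^ 2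
        * scZ G1 U y (Real.log r))) * r⁻¹) r := by
    intro r hr
    obtain ⟨h0, h1, h2⟩ := hpos r hr
    have h3 := h1.2.trans_lt ht
    exact ((s.hasDerivAt_scZ h h3 h2).sub ((s.hasDerivAt_logG1 h h3 h2).const_mul c₀)).comp r
      (Real.hasDerivAt_log h0.ne')
  have key : ∀ B E Z : ℝ, 0 ≤ E * (Z * (Z - c₀)) → B - E * Z ^ 2 - c₀ * -(E * Z) ≤ B :=
    fun B E Z hE => by linarith
  have := intervalIntegral.sub_le_integral_of_hasDeriv_right_of_le (φ := Φ)
    (Real.exp_le_exp.2 hτt)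
    (fun r hr => (hW r hr).continuousAt.continuousWithinAt)
    (fun r hr => (hW r (Ioo_subset_Icc_self hr)).hasDerivWithinAt)
    ((hΦ.mono (Icc_subset_Icc (Real.exp_pos _).le
      (exp_mem_Icc ht.le).2)).integrableOn_compact isCompact_Icc)
    (fun r hr => by
      obtain ⟨h0, h1, h2⟩ := hpos r (Ioo_subset_Icc_self hr)
      have h3 := h1.2.trans_lt ht
      have h4 := hB _ h3 h2
      rw [Real.exp_log h0] at h4
      rw [h4, div_eq_mul_inv]
      refine mul_le_mul_of_nonneg_right ?_ (inv_nonneg.2 h0.le)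
      have h5 : 0 ≤ G2 (U (Real.log r)) / G1 (U (Real.log r)) ^ 2 :=
        div_nonneg (h.G2_pos _ h2).le (sq_nonneg _)
      have h6 := mul_nonneg h5 (mul_nonneg (s.scZ_nonneg w h h3 h2)
        (sub_nonneg.2 (hZ _ h1).1))
      exact key _ _ _ h6)
  simp only [Real.log_exp] at this
  have h7 := (hZ t (right_mem_Icc.2 hτt)).1
  have h8 := (hZ τ (left_mem_Icc.2 hτt)).2
  linarith

namespace Family
variable {f G G1 G2 H H1 : ℝ → ℝ} {t₀ q b c C : ℝ} {l m : ℕ → ℝ} {U y : ℕ → ℝ → ℝ}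

/-- If the depth exceeds every admissible value, then `G'(U) / G'(m)` tends to zero. -/
lemma tendsto_slope_zero (F : Family f G G1 G2 H H1 t₀ q b c C l m U y) {v : ℕ → ℝ} {M : ℝ}
    (hM : t₀ < M) (hS : ∀ x ≥ 0, (1 - 1 / q) * x < 1 →
      ∀ᶠ n in atTop, x ≤ (m n - v n) * (G1 (m n) / G (m n))) :
    Tendsto (fun n => G1 (max (v n) M) / G1 (m n)) atTop (𝓝 0) := by
  have h := F.nonlin
  have hpos : ∀ n, t₀ < max (v n) M := fun n => hM.trans_le (le_max_right _ _)
  refine tendsto_order.2 ⟨fun ε hε => ?_, fun ε hε => ?_⟩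
  · filter_upwards [F.eventually_good 0] with n h1
    exact hε.trans (div_pos (h.G1_pos _ (hpos n)) h1.2.1)
  -- A reference depth at which G'/G'(m) is already below ε. The given points are eventually deeper,
  -- and G' is increasing.
  obtain ⟨x, hx0, hx1, hx⟩ := exists_slope'_lt h.q_mem hε
  have h1 := h.scaled_limits (v := fun n => m n - x * (G (m n) / G1 (m n))) (σ := x) F.lim_m
    (tendsto_const_nhds.congr' (by
      filter_upwards [F.eventually_good 0] with n h1
      have := h1.2.1
      have := h1.2.2.1
      field_simp
      ring))
    (by
      filter_upwards [F.eventually_good 0] with n h1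
      have := mul_nonneg hx0 (div_pos h1.2.2.1 h1.2.1).le
      linarith) hx0 hx1
  obtain ⟨hv, -, hG1⟩ := h1
  have h2 : Tendsto (fun n => G1 M / G1 (m n)) atTop (𝓝 0) :=
    tendsto_const_nhds.div_atTop (h.tendsto_G1.comp F.lim_m)
  filter_upwards [hS x hx0 hx1, hv.eventually_gt_atTop t₀, hG1.eventually_lt_const hx,
    h2.eventually_lt_const hε, F.eventually_good 0] with n h3 h4 h5 h6 h7
  rcases le_total (v n) M with h8 | h8
  · rwa [max_eq_right h8]
  · rw [max_eq_left h8]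
    refine lt_of_le_of_lt (div_le_div_of_nonneg_right ?_ h7.2.1.le) h5
    refine h.strictMonoOn_G1.monotoneOn (hM.trans_le h8) h4 ?_
    have h9 := h7.2.1
    have h10 := h7.2.2.1
    have : x * (G (m n) / G1 (m n)) ≤ m n - v n := by
      have h11 := mul_le_mul_of_nonneg_right h3 (div_pos h10 h9).le
      have h12 : (m n - v n) * (G1 (m n) / G (m n)) * (G (m n) / G1 (m n)) = m n - v n := by
        field_simp
      linarith
    linarith

/-- The energy is unbounded up to points whose depth exceeds every admissible value. -/
theorem tendsto_energy (F : Family f G G1 G2 H H1 t₀ q b c C l m U y) {Φ : ℕ → ℝ → ℝ}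
    {t : ℕ → ℝ} (ht : ∀ n, t n < 0)
    (hΦ : ∀ n, ContinuousOn (Φ n) (Icc 0 1))
    (hB : ∀ n, ∀ x < 0, t₀ < U n x → Φ n (Real.exp x) = scB G G1 H (l n) (U n) x / Real.exp x)
    (hlow : ∀ M, ∃ D ≥ 0, ∀ n, ∀ x ≤ 0, U n x ≤ M → -(l n * D) ≤ Φ n (Real.exp x))
    (hS : ∀ x ≥ 0, (1 - 1 / q) * x < 1 →
      ∀ᶠ n in atTop, x ≤ scS G G1 (m n) (U n) (t n)) :
    Tendsto (fun n => ∫ r in (0 : ℝ)..Real.exp (t n), Φ n r) atTop atTop := by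
  have h := F.nonlin
  have w := F.weight
  obtain ⟨M, hM, c₀, hc₀, K, τ, hτ, hτS, hev⟩ := F.exists_bounds
  obtain ⟨D, hD0, hD⟩ := hlow M
  have hlim0 := F.tendsto_slope_zero hM hS
  obtain ⟨hUτ, -, hG1τ⟩ := F.scaled_limits (Eventually.of_forall fun n => (hτ n).le) hτS
    (depth_nonneg h.q_mem 1) (kappa_mul_depth_lt h.q_mem 1)
  have hs0 := slope'_pos (kappa_mul_depth_lt h.q_mem 1)
  set σ := slope' (1 - 1 / q) (depth q 1) with hσ
  have hlog : Tendsto (fun n => -Real.log (G1 (max (U n (t n)) M) / G1 (m n))) atTop atTop := by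
    refine tendsto_neg_atBot_atTop.comp (Real.tendsto_log_nhdsGT_zero.comp ?_)
    refine tendsto_nhdsWithin_iff.2 ⟨hlim0, ?_⟩
    filter_upwards [F.eventually_good 0] with n h1
    exact div_pos (h.G1_pos _ (hM.trans_le (le_max_right _ _))) h1.2.1
  have hbig : Tendsto (fun n => c₀ * (Real.log (G1 (U n (τ n)) / G1 (m n))
      + -Real.log (G1 (max (U n (t n)) M) / G1 (m n))) + (-5 - Real.exp K * D)) atTop atTop :=
    tendsto_atTop_add_const_right _ _
      (((hG1τ.log hs0.ne').add_atTop hlog).const_mul_atTop hc₀)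
  refine tendsto_atTop_mono' _ ?_ hbig
  filter_upwards [hev, F.eventually_good 0, hlim0.eventually_lt_const (half_pos hs0),
    hG1τ.eventually_const_lt (half_lt_self hs0)] with n ⟨hl, hZ, hMτ, r, hr, hrM⟩ h2 h3 h4
  have s := F.sol n
  have anti := s.U_antitoneOn w h
  -- the point where the height is `max (U (t n)) M`
  obtain ⟨x, hx0, hxt, hxU, hcase⟩ : ∃ x < 0, x ≤ t n ∧ U n x = max (U n (t n)) M ∧
      ∀ z ∈ Ioo x (t n), U n z ≤ M := by
    rcases le_total (t n) r with h5 | h5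
    · refine ⟨t n, ht n, le_rfl, ?_, fun z hz => absurd (hz.1.trans hz.2) (lt_irrefl _)⟩
      rw [max_eq_left]
      rw [← hrM]
      exact anti (mem_Iic.2 (ht n).le) (mem_Iic.2 hr.2.le) h5
    · refine ⟨r, hr.2, h5, ?_, fun z hz => ?_⟩
      · rw [hrM, max_eq_right]
        rw [← hrM]
        exact anti (mem_Iic.2 hr.2.le) (mem_Iic.2 (ht n).le) h5
      · rw [← hrM]
        exact anti (mem_Iic.2 hr.2.le) (mem_Iic.2 (hz.2.trans (ht n)).le) hz.1.le
  rw [← hxU] at h3 ⊢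
  have hUx : M ≤ U n x := hxU ▸ le_max_right _ _
  have hUx0 := hM.trans_le hUx
  have hUτ0 := hM.trans_le hMτ
  -- At τ the ratio G'(U)/G'(m) is near a positive limit and at x it is near zero, so x comes later.
  have hτx : τ n ≤ x := by
    by_contra! hcon
    have h5 := anti (mem_Iic.2 hx0.le) (mem_Iic.2 (hτ n).le) hcon.le
    have h6 := div_le_div_of_nonneg_right
      (h.strictMonoOn_G1.monotoneOn hUτ0 hUx0 h5) h2.2.1.le
    linarith
  have hint : ∀ α β : ℝ, α ∈ Icc (0 : ℝ) 1 → β ∈ Icc (0 : ℝ) 1 →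
      IntervalIntegrable (Φ n) MeasureTheory.volume α β := fun α β hα hβ =>
    ((hΦ n).mono (uIcc_subset_Icc hα hβ)).intervalIntegrable
  have m0 : (0 : ℝ) ∈ Icc (0 : ℝ) 1 := left_mem_Icc.2 zero_le_one
  have mτ := exp_mem_Icc (hτ n).le
  have mx := exp_mem_Icc hx0.le
  have mt := exp_mem_Icc (ht n).le
  -- Three pieces: up to τ the integrand is positive, between τ and x the integral diverges by
  -- `energy_ge`, and beyond x the height is at most M and the integrand is bounded below since λ ≤
  -- exp K.
  rw [← intervalIntegral.integral_add_adjacent_intervals (hint _ _ m0 mx) (hint _ _ mx mt),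
    ← intervalIntegral.integral_add_adjacent_intervals (hint _ _ m0 mτ) (hint _ _ mτ mx)]
  have i1 : 0 ≤ ∫ r in (0 : ℝ)..Real.exp (τ n), Φ n r := by
    have := intervalIntegral.integral_mono_on_of_le_Ioo (f := fun _ => (0 : ℝ)) (g := Φ n)
      mτ.1 (by simp) (hint _ _ m0 mτ) (fun z hz => by
        have h5 : Real.log z < τ n := (Real.log_lt_iff_lt_exp hz.1).2 hz.2
        have h6 := h5.trans (hτ n)
        have h7 := hB n _ h6 (hUτ0.trans_le
          (anti (mem_Iic.2 h6.le) (mem_Iic.2 (hτ n).le) h5.le))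
        rw [Real.exp_log hz.1] at h7
        rw [h7]
        exact (div_pos (LogSol.scB_pos w h6.le) hz.1).le)
    simpa using this
  have i2 := s.energy_ge w h hτx hx0 hUx0 hc₀.le (hΦ n) (hB n)
    (fun z hz => hZ z ⟨hz.1, hz.2.trans_lt hx0⟩
      (hUx.trans (anti (mem_Iic.2 (hz.2.trans hx0.le)) (mem_Iic.2 hx0.le) hz.2)))
  have i3 : -(Real.exp K * D) ≤ ∫ r in Real.exp x..Real.exp (t n), Φ n r := by
    have := intervalIntegral.integral_mono_on_of_le_Ioo (f := fun _ => -(l n * D)) (g := Φ n)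
      (Real.exp_le_exp.2 hxt) (by simp) (hint _ _ mx mt) (fun z hz => by
        have h0 := (Real.exp_pos _).trans hz.1
        have h5 : x < Real.log z := (Real.lt_log_iff_exp_lt h0).2 hz.1
        have h6 : Real.log z < t n := (Real.log_lt_iff_lt_exp h0).2 hz.2
        have h7 := hD n _ (h6.trans (ht n)).le (hcase _ ⟨h5, h6⟩)
        rwa [Real.exp_log h0] at h7)
    refine le_trans ?_ this
    rw [intervalIntegral.integral_const, smul_eq_mul, mul_neg, neg_le_neg_iff]
    have h5 : l n ≤ Real.exp K :=
      (Real.log_le_iff_le_exp s.l_pos).1 ((le_abs_self _).trans hl)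
    have h6 : Real.exp (t n) - Real.exp x ≤ 1 := by linarith [mt.2, mx.1]
    have h7 : l n * D ≤ Real.exp K * D := mul_le_mul_of_nonneg_right h5 hD0
    have h8 : 0 ≤ l n * D := mul_nonneg s.l_pos.le hD0
    calc _ ≤ 1 * (l n * D) := mul_le_mul_of_nonneg_right h6 h8
      _ ≤ _ := by linarith
  rw [Real.log_div (h.G1_pos _ hUτ0).ne' h2.2.1.ne', Real.log_div (h.G1_pos _ hUx0).ne' h2.2.1.ne']
  have e : Real.log (G1 (U n (τ n))) - Real.log (G1 (m n))
      + -(Real.log (G1 (U n x)) - Real.log (G1 (m n)))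
      = Real.log (G1 (U n (τ n))) - Real.log (G1 (U n x)) := by ring
  rw [e]
  linarith

end Family

/-! ### The solutions in terms of the radius -/

section radial
variable {h f : ℝ → ℝ} {t₀ q : ℝ}

lemma IsSolution.nonneg {l m : ℝ} {u : ℝ → ℝ} (s : IsSolution h f l m u) {r : ℝ}
    (hr : r ∈ Icc (0 : ℝ) 1) : 0 ≤ u r := by
  rcases hr.1.eq_or_lt with h0 | h0
  · rw [← h0, s.at_zero]; exact s.m_pos.le
  rcases hr.2.eq_or_lt with h1 | h1
  · rw [h1, s.at_one]
  · exact (s.pos r ⟨h0, h1⟩).le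

lemma H0.continuousOn_f' (h0 : H0 h f t₀) : ContinuousOn (f' f) (Ici 0) :=
  h0.f_contDiff.continuousOn_derivWithin (uniqueDiffOn_Ici 0) le_rfl

lemma H0.continuousOn_energy (h0 : H0 h f t₀) {l m : ℝ} {u : ℝ → ℝ}
    (s : IsSolution h f l m u) :
    ContinuousOn (fun r => l * h r * f' f (u r) * r) (Icc 0 1) :=
  ((continuousOn_const.mul h0.h_contDiff.continuousOn).mul
    (h0.continuousOn_f'.comp s.contDiff.continuousOn fun _ hr => s.nonneg hr)).mul continuousOn_id

/-- At low heights f' may be negative, so only a lower bound by compactness is available. The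
constant does not depend on the solution. -/
lemma H0.energy_lower (h0 : H0 h f t₀) (M : ℝ) : ∃ D ≥ 0, ∀ {l m : ℝ} {u : ℝ → ℝ},
    IsSolution h f l m u → ∀ r ∈ Icc (0 : ℝ) 1, u r ≤ M →
      -(l * D) ≤ l * h r * f' f (u r) * r := by
  obtain ⟨A, hA⟩ := isCompact_Icc.exists_bound_of_continuousOn h0.h_contDiff.continuousOn
  obtain ⟨D, hD⟩ := (isCompact_Icc (a := (0 : ℝ)) (b := M)).exists_bound_of_continuousOn
    (h0.continuousOn_f'.mono Icc_subset_Ici_self)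
  refine ⟨|A| * |D|, by positivity, fun {l m u} s r hr hu => ?_⟩
  have h1 : |h r| ≤ |A| := (hA r hr).trans (le_abs_self A)
  have h2 : |f' f (u r)| ≤ |D| := (hD _ ⟨s.nonneg hr, hu⟩).trans (le_abs_self D)
  have h3 : |r| ≤ 1 := by rw [abs_of_nonneg hr.1]; exact hr.2
  refine (abs_le.1 ?_).1
  rw [abs_mul, abs_mul, abs_mul, abs_of_pos s.l_pos]
  calc l * |h r| * |f' f (u r)| * |r| ≤ l * |A| * |D| * 1 := by
        have := s.l_pos.le
        gcongr
    _ = l * (|A| * |D|) := by ring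

lemma scB_log_eq {l m r : ℝ} {u G G1 G2 : ℝ → ℝ} (n : Nonlin f G G1 G2 t₀ q)
    (s : IsSolution h f l m u) (hr : 0 < r) (hu : t₀ < u r) :
    scB G G1 (fun t => h (Real.exp t)) l (fun t => u (Real.exp t)) (Real.log r)
      = l * r ^ 2 * h r * f' f (u r) := by
  have he : Real.exp (2 * Real.log r) = r ^ 2 := by
    rw [two_mul, Real.exp_add, Real.exp_log hr]; ring
  have := s.logSol.scB_eq n (t := Real.log r) (by rwa [Real.exp_log hr])
  rw [this, Real.exp_log hr, he, n.f'_eq hu]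
  ring

end radial

lemma δ_of_eq_one (k : ℕ) : δ 1 k = 1 := by
  cases k <;> simp [δ]

section depth
variable {f G G1 G2 : ℝ → ℝ} {t₀ q : ℝ} {m v : ℕ → ℝ}

/-- The depth determines the relative height. -/
lemma Nonlin.tendsto_height (n : Nonlin f G G1 G2 t₀ q) (hm : Tendsto m atTop atTop) {σ : ℝ}
    (hS : Tendsto (fun n => (m n - v n) * (G1 (m n) / G (m n))) atTop (𝓝 σ)) :
    Tendsto (fun n => v n / m n) atTop (𝓝 (1 - (1 - 1 / q) * σ)) := by
  refine (((n.tendsto_psi_div.comp hm).mul hS).const_sub 1).congr' ?_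
  filter_upwards [hm.eventually_gt_atTop t₀, hm.eventually_gt_atTop 0,
    (n.tendsto_G.comp hm).eventually_gt_atTop 0] with k h1 h2 h3
  have := n.G1_pos _ h1
  simp only [Function.comp] at h3 ⊢
  field_simp
  ring

/-- The relative height determines the depth if `q > 1`. -/
lemma Nonlin.tendsto_depth (n : Nonlin f G G1 G2 t₀ q) (hq : q ≠ 1)
    (hm : Tendsto m atTop atTop) {d : ℝ}
    (hd : Tendsto (fun n => v n / m n) atTop (𝓝 d)) :
    Tendsto (fun n => (m n - v n) * (G1 (m n) / G (m n))) atTop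
      (𝓝 ((1 - d) / (1 - 1 / q))) := by
  refine ((hd.const_sub 1).div (n.tendsto_psi_div.comp hm) (kappa_pos n.q_mem hq).ne').congr' ?_
  filter_upwards [hm.eventually_gt_atTop t₀, hm.eventually_gt_atTop 0,
    (n.tendsto_G.comp hm).eventually_gt_atTop 0] with k h1 h2 h3
  have := n.G1_pos _ h1
  simp only [Function.comp] at h3
  change (1 - v k / m k) / (G (m k) / G1 (m k) / m k) = _
  field_simp

end depth

end DiscBlowup
end

/-! ### The theorem -/

theorem theorem1p3 (h f : ℝ → ℝ) (t₀ q : ℝ) (h0 : DiscBlowup.H0 h f t₀)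
    (h1 : DiscBlowup.H1 f t₀ q) (hq : q ∈ Set.Ico (1 : ℝ) 2)
    (l m : ℕ → ℝ) (u : ℕ → ℝ → ℝ)
    (hsol : ∀ n, DiscBlowup.IsSolution h f (l n) (m n) (u n))
    (hm : Tendsto m atTop atTop) :
    -- divergence of the energy
    (∀ r : ℕ → ℝ, (∀ n, r n ∈ Set.Ioo (0 : ℝ) 1) →
      (1 < q → Tendsto (fun n => u n (r n) / m n) atTop (𝓝 0)) →
      (q = 1 → Tendsto (fun n => (m n - u n (r n)) *
        (DiscBlowup.g' f t₀ (m n) / DiscBlowup.g f (m n))) atTop atTop) →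
      Tendsto (fun n => ∫ s in (0 : ℝ)..r n, l n * h s * DiscBlowup.f' f (u n s) * s)
        atTop atTop) ∧
    -- pointwise divergence
    (∀ r ∈ Set.Ico (0 : ℝ) 1,
      Tendsto (fun n => DiscBlowup.g' f t₀ (m n) * u n r) atTop atTop) ∧
    -- along a subsequence there are centers of concentration of every order
    (∃ φ : ℕ → ℕ, StrictMono φ ∧ ∃ r : ℕ → ℕ → ℝ, ∀ k,
      DiscBlowup.IsCenter h f t₀ q (fun n => l (φ n)) (fun n => m (φ n)) (fun n => u (φ n)) k
        (r k)) ∧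
    -- asymptotic formulas for the parameter and for the centers along any subsequence
    ((q = 1 → DiscBlowup.H2 f) →
      Tendsto (fun n => Real.log (1 / l n) / DiscBlowup.g f (m n)) atTop (𝓝 0) ∧
      ∀ φ : ℕ → ℕ, StrictMono φ → ∀ (k : ℕ) (r : ℕ → ℝ),
        DiscBlowup.IsCenter h f t₀ q (fun n => l (φ n)) (fun n => m (φ n)) (fun n => u (φ n)) k
          r →
        Tendsto (fun n => Real.log (1 / r n) / DiscBlowup.g f (m (φ n))) atTop
          (𝓝 (DiscBlowup.η q k / 2))) := by
  open DiscBlowup in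
  have N := h0.nonlin h1 hq
  obtain ⟨b, c, C, w⟩ := h0.weight
  have F : Family f (g f) (g' f t₀) (g'' f t₀) _ _ t₀ q b c C l m _ _ :=
    ⟨N, w, fun n => (hsol n).logSol, hm⟩
  -- The subsequence is the identity, because the limit states are attained along the whole
  -- sequence.
  refine ⟨fun r hr hq1 hq2 => ?_, fun r hr => ?_, ⟨id, strictMono_id, ?_⟩, fun _ => ⟨?_, ?_⟩⟩
  · have hexp : ∀ n, Real.exp (Real.log (r n)) = r n := fun n => Real.exp_log (hr n).1
    have := F.tendsto_energy (Φ := fun n s => l n * h s * f' f (u n s) * s)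
      (t := fun n => Real.log (r n)) (fun n => Real.log_neg (hr n).1 (hr n).2)
      (fun n => h0.continuousOn_energy (hsol n))
      (fun n x _ hU => by
        have := scB_log_eq N (hsol n) (Real.exp_pos x) hU
        rw [Real.log_exp] at this
        rw [this]
        have := (Real.exp_pos x).ne'
        field_simp)
      (fun M => by
        obtain ⟨D, hD0, hD⟩ := h0.energy_lower M
        exact ⟨D, hD0, fun n x hx hU => hD (hsol n) _ (exp_mem_Icc hx) hU⟩)
      (fun x hx0 hx1 => by
        simp only [scS, hexp]
        by_cases h : q = 1
        · exact (hq2 h).eventually_ge_atTop x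
        · have hκ := kappa_pos hq h
          -- For q > 1, u/μ → 0 means that the depth tends to 1/κ, which exceeds every x with κx <
          -- 1.
          refine (N.tendsto_depth h hm (hq1 (lt_of_le_of_ne hq.1 (Ne.symm h)))).eventually_const_le ?_
          rw [lt_div_iff₀ hκ]
          linarith)
    simpa only [hexp] using this
  · rcases hr.1.eq_or_lt with h2 | h2
    · rw [← h2]
      simp only [(hsol _).at_zero]
      exact (N.tendsto_G1.comp hm).atTop_mul_atTop₀ hm
    · have := F.tendsto_G1_mul_U (Real.log_neg h2 hr.2)
      simpa only [Real.exp_log h2] using this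
  · choose τ hτ hlim using fun k => (F.reach_center k).exists_seq
    refine ⟨fun k n => Real.exp (τ k n), fun k => ?_⟩
    obtain ⟨hS, -, hB, -⟩ := tendsto_scState.1 (hlim k)
    obtain ⟨hU, -, -⟩ := F.scaled_limits (Eventually.of_forall fun n => (hτ k n).le) hS
      (depth_nonneg hq k) (kappa_mul_depth_lt hq k)
    exact
    { mem := fun n => exp_mem_Ioo (hτ k n)
      height := by
        have h3 := N.tendsto_height hm hS
        by_cases h2 : q = 1
        · subst h2
          rw [δ_of_eq_one]
          simpa using h3
        · rwa [one_sub_depth hq h2] at h3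
      height_of_q_eq_one := fun h2 => by
        have h3 := hS
        rwa [depth, if_pos h2] at h3
      scale := by
        refine hB.congr' ?_
        filter_upwards [hU.eventually_gt_atTop t₀] with n h2
        have := scB_log_eq N (hsol n) (Real.exp_pos (τ k n)) h2
        rwa [Real.log_exp] at this }
  · have := F.log_l_div.neg
    rw [neg_zero] at this
    refine this.congr fun n => ?_
    rw [one_div, Real.log_inv, neg_div]
  · intro φ hφ k r hr
    have F' := F.comp hφ
    have hexp : ∀ n, Real.exp (Real.log (r n)) = r n := fun n => Real.exp_log (hr.mem n).1
    have ht : ∀ n, Real.log (r n) < 0 := fun n => Real.log_neg (hr.mem n).1 (hr.mem n).2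
    have hS : Tendsto (fun n => scS (g f) (g' f t₀) (m (φ n))
        (fun t => u (φ n) (Real.exp t)) (Real.log (r n))) atTop (𝓝 (depth q k)) := by
      simp only [scS, hexp, depth]
      split_ifs with h2
      · exact hr.height_of_q_eq_one h2
      · exact N.tendsto_depth h2 F'.lim_m hr.height
    obtain ⟨hU, -, -⟩ := F'.scaled_limits (Eventually.of_forall fun n => (ht n).le) hS
      (depth_nonneg hq k) (kappa_mul_depth_lt hq k)
    have hB : Tendsto (fun n => scB (g f) (g' f t₀) (fun t => h (Real.exp t)) (l (φ n))
        (fun t => u (φ n) (Real.exp t)) (Real.log (r n))) atTop (𝓝 (a q k ^ 2 / 2)) := by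
      refine hr.scale.congr' ?_
      filter_upwards [hU.eventually_gt_atTop t₀] with n h2
      rw [hexp] at h2
      exact (scB_log_eq N (hsol (φ n)) (hr.mem n).1 h2).symm
    have ha := (a_mem hq k).1
    have := F'.tendsto_time_div ht (depth_nonneg hq k) (kappa_mul_depth_lt hq k)
      (by positivity) hS hB
    rw [profile_depth hq k] at this
    refine this.congr fun n => ?_
    rw [one_div, Real.log_inv]
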